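/- Let $k$ be a field. Differential graded (DG) objects are written cohomologically (differentials of degree $+1$) and DG modules are right modules. Let $A=\bigoplus_{i\ge 0}A^i$ be a simply connected DG $k$-algebra of finite type, i.e. a non-negatively graded DG $k$-algebra with $\dim_k H^*A<\infty$, $H^0A\cong k$ and $H^1A=0$. Let $\mathbf D(A)$ be the derived category of DG $A$-modules (the localisation of the homotopy category of DG $A$-modules at the quasi-isomorphisms), and let $A^{\mathrm{op}}$ be the opposite DG algebra, with multiplication $a\cdot_{\mathrm{op}}b=(-1)^{|a||b|}ba$. For a complex $Y$ put $\sup H^*Y=\sup\{i\in\mathbb Z\mid H^iY\ne 0\}$, $\inf H^*Y=\inf\{i\in\mathbb Z\mid H^iY\neq 0\}$ and $\operatorname{amp}Y=\sup H^*Y-\inf H^*Y$. Let $M\neq 0$ be a compact object of $\mathbf D(A)$ (i.e. $\operatorname{Hom}_{\mathbf D(A)}(M,-)$ preserves coproducts). Then for every $X\ne 0$ in $\mathbf D(A^{\mathrm{op}})$ with $\dim_k H^*X<\infty$: 1. $\inf H^*(M\otimes_A^{\mathbf L}X)=\inf H^*M+\inf H^*X$; 2. $\sup H^*(M\otimes_A^{\mathbf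 L}X)\ge \inf H^*M+\sup H^*X$; 3. $\operatorname{amp}(M\otimes_A^{\mathbf L}X)\ge\operatorname{amp}X$. In particular, $\operatorname{amp}M\ge\operatorname{amp}A$. -/

import Mathlib

open CategoryTheory CategoryTheory.Limits MulOpposite
open scoped DirectSum TensorProduct

universe u

namespace DG

/-- A cochain complex of `k`-vector spaces, given by an ambient vector space with subspaces
`gr n` (the degree `n` parts) and a linear map `d` which restricts to differentials
`gr n → gr (n + 1)`. -/
structure Cpx (k : Type u) [Field k] where
  carrier : Type u
  [addCommGroup : AddCommGroup carrier]
  [module : Module k carrier]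
  gr : ℤ → Submodule k carrier
  d : carrier →ₗ[k] carrier
  d_mem : ∀ {n : ℤ} {x : carrier}, x ∈ gr n → d x ∈ gr (n + 1)
  d_d : ∀ x : carrier, d (d x) = 0

attribute [instance] Cpx.addCommGroup Cpx.module

namespace Cpx

variable {k : Type u} [Field k] (V : Cpx k)

/-- Cocycles of degree `n`. -/
def Z (n : ℤ) : Submodule k V.carrier := LinearMap.ker V.d ⊓ V.gr n

/-- Coboundaries of degree `n`. -/
def B (n : ℤ) : Submodule k V.carrier := (V.gr (n - 1)).map V.d

/-- The `n`-th cohomology `Ker dⁿ / Im dⁿ⁻¹`. -/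
abbrev H (n : ℤ) : Type u := V.Z n ⧸ (V.B n).submoduleOf (V.Z n)

/-- The total cohomology `H^*`, the direct sum of all cohomology spaces. -/
abbrev totalH : Type u := ⨁ n : ℤ, V.H n

/-- `sup H^*`, in `ℤ ∪ {±∞}` (realised inside the extended reals). -/
noncomputable def supH : EReal := ⨆ n : {n : ℤ // Nontrivial (V.H n)}, (((n : ℤ) : ℝ) : EReal)

/-- `inf H^*`, in `ℤ ∪ {±∞}` (realised inside the extended reals). -/
noncomputable def infH : EReal := ⨅ n : {n : ℤ // Nontrivial (V.H n)}, (((n : ℤ) : ℝ) : EReal)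

/-- The amplitude `sup H^* - inf H^*`. -/
noncomputable def amp : EReal := V.supH - V.infH

end Cpx

/-- A differential graded algebra over the field `k`: a `ℤ`-graded `k`-algebra with a
`k`-linear differential of degree `+1` satisfying the graded Leibniz rule. -/
structure DGAlgebra (k : Type u) [Field k] where
  carrier : Type u
  [ring : Ring carrier]
  [algebra : Algebra k carrier]
  gr : ℤ → Submodule k carrier
  [gradedAlgebra : GradedAlgebra gr]
  d : carrier →ₗ[k] carrier
  d_mem : ∀ {n : ℤ} {a : carrier}, a ∈ gr n → d a ∈ gr (n + 1)
  d_d : ∀ a : carrier, d (d a) = 0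
  leibniz : ∀ {n : ℤ} {a : carrier} (b : carrier), a ∈ gr n →
    d (a * b) = d a * b + n.negOnePow • (a * d b)

attribute [instance] DGAlgebra.ring DGAlgebra.algebra DGAlgebra.gradedAlgebra

section

variable {k : Type u} [Field k]

/-- The complex underlying a differential graded algebra. -/
def DGAlgebra.toCpx (A : DGAlgebra k) : Cpx k where
  carrier := A.carrier
  gr := A.gr
  d := A.d
  d_mem := A.d_mem
  d_d := A.d_d

/-- A simply connected differential graded algebra of finite type: `A` is concentrated in
nonnegative degrees, its total cohomology is finite-dimensional, `H⁰ A ≅ k` and `H¹ A = 0`.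
(As `H⁰ A` is a unital `k`-algebra, a `k`-linear isomorphism `H⁰ A ≅ k` is the same condition as
an isomorphism of algebras.) -/
structure DGAlgebra.IsSimplyConnectedOfFiniteType (A : DGAlgebra k) : Prop where
  gr_eq_bot : ∀ n : ℤ, n < 0 → A.gr n = ⊥
  finite : Module.Finite k A.toCpx.totalH
  h_zero : Nonempty (A.toCpx.H 0 ≃ₗ[k] k)
  h_one : Subsingleton (A.toCpx.H 1)

/-- A differential graded (right) module over `A`. The right action of `a` on `x` is
`op a • x`. -/
structure DGModule (A : DGAlgebra k) extends Cpx k where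
  [rmodule : Module A.carrierᵐᵒᵖ carrier]
  [tower : IsScalarTower k A.carrierᵐᵒᵖ carrier]
  [decomposition : DirectSum.Decomposition gr]
  smul_mem : ∀ {m n : ℤ} {x : carrier} {a : A.carrier}, x ∈ gr m → a ∈ A.gr n →
    op a • x ∈ gr (m + n)
  leibniz : ∀ {n : ℤ} {x : carrier} (a : A.carrier), x ∈ gr n →
    d (op a • x) = op a • d x + n.negOnePow • (op (A.d a) • x)

attribute [instance] DGModule.rmodule DGModule.tower DGModule.decomposition

namespace DGModule

variable {A : DGAlgebra k}

/-- A morphism of differential graded modules: an `A`-linear map of degree `0` commuting with the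
differentials. -/
@[ext]
structure Hom (M N : DGModule A) where
  toLin : M.carrier →ₗ[A.carrierᵐᵒᵖ] N.carrier
  map_mem : ∀ {n : ℤ} {x : M.carrier}, x ∈ M.gr n → toLin x ∈ N.gr n
  map_d : ∀ x : M.carrier, toLin (M.d x) = N.d (toLin x)

/-- The category `C(A)` of differential graded `A`-modules. -/
instance : Category (DGModule A) where
  Hom := Hom
  id M := ⟨LinearMap.id, fun h => h, fun _ => rfl⟩
  comp f g := ⟨g.toLin ∘ₗ f.toLin, fun h => g.map_mem (f.map_mem h), fun x => by
    simp [f.map_d, g.map_d]⟩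

/-- The linear map underlying a morphism. -/
def lin {M N : DGModule A} (f : M ⟶ N) : M.carrier →ₗ[A.carrierᵐᵒᵖ] N.carrier := Hom.toLin f

lemma lin_mem {M N : DGModule A} (f : M ⟶ N) {n : ℤ} {x : M.carrier} (hx : x ∈ M.gr n) :
    lin f x ∈ N.gr n := Hom.map_mem f hx

lemma lin_d {M N : DGModule A} (f : M ⟶ N) (x : M.carrier) :
    lin f (M.d x) = N.d (lin f x) := Hom.map_d f x

@[simp] lemma lin_comp {M N P : DGModule A} (f : M ⟶ N) (g : N ⟶ P) (x : M.carrier) :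
    lin (f ≫ g) x = lin g (lin f x) := rfl

@[simp] lemma lin_id (M : DGModule A) (x : M.carrier) : lin (𝟙 M) x = x := rfl

/-- The restriction of a morphism to cocycles of degree `n`. -/
def mapZ {M N : DGModule A} (f : M ⟶ N) (n : ℤ) : M.Z n →ₗ[k] N.Z n :=
  ((lin f).restrictScalars k).restrict fun x hx => by
    refine ⟨?_, lin_mem f hx.2⟩
    have h : M.d x = 0 := hx.1
    simp [LinearMap.mem_ker, ← lin_d, h]

/-- The map induced by a morphism on the `n`-th cohomology. -/
def mapH {M N : DGModule A} (f : M ⟶ N) (n : ℤ) : M.H n →ₗ[k] N.H n :=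
  Submodule.mapQ _ _ (mapZ f n) (by
    rintro ⟨x, hx⟩ ⟨y, hy, rfl⟩
    exact ⟨lin f y, lin_mem f hy, (lin_d f y).symm⟩)

/-- Quasi-isomorphisms: morphisms which are bijective on cohomology. -/
def QIso {M N : DGModule A} (f : M ⟶ N) : Prop := ∀ n : ℤ, Function.Bijective (mapH f n)

/-- `f` and `g` are homotopic: `f - g = d ∘ h + h ∘ d` for an `A`-linear map `h` of
degree `-1`. -/
def Homotopic {M N : DGModule A} (f g : M ⟶ N) : Prop :=
  ∃ h : M.carrier →ₗ[A.carrierᵐᵒᵖ] N.carrier,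
    (∀ (n : ℤ) (x : M.carrier), x ∈ M.gr n → h x ∈ N.gr (n - 1)) ∧
    ∀ x : M.carrier, lin f x - lin g x = N.d (h x) + h (M.d x)

variable (A) in
/-- The homotopy relation on the morphisms of `C(A)`. -/
def homotopyRel : HomRel (DGModule A) := fun _ _ f g => Homotopic f g

instance : Congruence (homotopyRel A) where
  equivalence := by
    refine ⟨fun f => ⟨0, by simp, by simp⟩, ?_, ?_⟩
    · rintro f g ⟨h, h1, h2⟩
      refine ⟨-h, fun n x hx => neg_mem (h1 n x hx), fun x => ?_⟩
      rw [← neg_sub, h2]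
      simp [add_comm]
    · rintro f g e ⟨h, h1, h2⟩ ⟨h', h1', h2'⟩
      refine ⟨h + h', fun n x hx => add_mem (h1 n x hx) (h1' n x hx), fun x => ?_⟩
      rw [← sub_add_sub_cancel _ (lin g x), h2, h2']
      simp only [LinearMap.add_apply, map_add]
      abel
  comp_left := by
    rintro M N P f g g' ⟨h, h1, h2⟩
    refine ⟨h ∘ₗ lin f, fun n x hx => h1 n _ (lin_mem f hx), fun x => ?_⟩
    simp [h2, lin_d]
  comp_right := by
    rintro M N P f f' g ⟨h, h1, h2⟩
    refine ⟨lin g ∘ₗ h, fun n x hx => lin_mem g (h1 n _ hx), fun x => ?_⟩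
    simp [← map_sub, h2, lin_d]

end DGModule

/-- The homotopy category `H(A)`: differential graded modules, morphisms up to homotopy. -/
abbrev HoCat (A : DGAlgebra k) : Type (u + 1) := Quotient (DGModule.homotopyRel A)

/-- The canonical functor `C(A) ⥤ H(A)`. -/
abbrev toHo (A : DGAlgebra k) : DGModule A ⥤ HoCat A := Quotient.functor _

/-- The class of quasi-isomorphisms in `H(A)`: the homotopy classes of quasi-isomorphisms. -/
def qisHo (A : DGAlgebra k) : MorphismProperty (HoCat A) := fun M N f =>
  ∃ s : M.as ⟶ N.as, DGModule.QIso s ∧ (toHo A).map s = f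

/-- The derived category `D(A)`: the localisation of `H(A)` at the quasi-isomorphisms. Its objects
are the differential graded `A`-modules. -/
abbrev DerCat (A : DGAlgebra k) : Type (u + 1) := (qisHo A).Localization

/-- The canonical functor `C(A) ⥤ D(A)`, which is the identity on objects. -/
noncomputable abbrev toDer (A : DGAlgebra k) : DGModule A ⥤ DerCat A := toHo A ⋙ (qisHo A).Q

/-- An object `M` is compact if every morphism from `M` to a coproduct `∐ i, Y i` (of a family
indexed by a set in the universe `u`) factors through the coproduct of a finite subfamily. -/
def IsCompactObj {C : Type (u + 1)} [Category C] (M : C) : Prop :=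
  ∀ (I : Type u) (Y : I → C) (c : Cofan Y) (_ : IsColimit c) (f : M ⟶ c.pt),
    ∃ (S : Finset I) (c' : Cofan fun i : S => Y i) (hc' : IsColimit c') (g : M ⟶ c'.pt),
      g ≫ Cofan.IsColimit.desc hc' (fun i => c.inj i) = f

section sign

lemma negOnePow_smul_smul {V : Type*} [AddCommGroup V] (m n : ℤ) (x : V) :
    m.negOnePow • n.negOnePow • x = (m + n).negOnePow • x := by
  rw [smul_smul, Int.negOnePow_add]

lemma negOnePow_smul_congr {V : Type*} [AddCommGroup V] {m n : ℤ} (h : Even (m - n)) (x : V) :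
    m.negOnePow • x = n.negOnePow • x := by
  rw [(Int.negOnePow_eq_iff m n).2 h]

lemma map_negOnePow_smul {V W F : Type*} [AddCommGroup V] [AddCommGroup W] [FunLike F V W]
    [AddMonoidHomClass F V W] (f : F) (n : ℤ) (x : V) :
    f (n.negOnePow • x) = n.negOnePow • f x := by
  simp only [Units.smul_def, map_zsmul]

lemma negOnePow_smul_mem {V : Type*} [AddCommGroup V] [Module k V] (p : Submodule k V) (n : ℤ)
    {x : V} (hx : x ∈ p) : n.negOnePow • x ∈ p := by
  rw [Units.smul_def]
  exact zsmul_mem hx _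

variable {V : Type*} [AddCommGroup V] [Module k V] (gr : ℤ → Submodule k V)
  [DirectSum.Decomposition gr]

/-- The linear map `x ↦ (-1)^(i * n) x` for `x` of degree `n`. -/
noncomputable def sgnPow (i : ℤ) : V →ₗ[k] V :=
  DirectSum.toModule k ℤ V (fun n => (((i * n).negOnePow : ℤˣ) : ℤ) • (gr n).subtype) ∘ₗ
    (DirectSum.decomposeLinearEquiv gr).toLinearMap

lemma sgnPow_of_mem (i : ℤ) {n : ℤ} {x : V} (hx : x ∈ gr n) :
    sgnPow gr i x = (i * n).negOnePow • x := by
  rw [sgnPow, LinearMap.comp_apply, LinearEquiv.coe_coe, DirectSum.decomposeLinearEquiv_apply,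
    DirectSum.decompose_of_mem gr hx, ← DirectSum.lof_eq_of k, DirectSum.toModule_lof]
  simp [Units.smul_def]

lemma sgnPow_mem (i : ℤ) {n : ℤ} {x : V} (hx : x ∈ gr n) : sgnPow gr i x ∈ gr n := by
  rw [sgnPow_of_mem gr i hx]
  exact negOnePow_smul_mem _ _ hx

lemma hom_induction {p : V → Prop} (h0 : p 0) (hadd : ∀ x y, p x → p y → p (x + y))
    (hom : ∀ (n : ℤ) (x : V), x ∈ gr n → p x) (x : V) : p x :=
  DirectSum.Decomposition.inductionOn gr h0 (fun {i} m => hom i m m.2) hadd x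

end sign

namespace DGAlgebra

variable (A : DGAlgebra k)

/-- The multiplication `a ⬝ b = (-1)^(|a| |b|) b a` of the opposite algebra. -/
noncomputable def opMul : A.carrier →ₗ[k] A.carrier →ₗ[k] A.carrier :=
  DirectSum.toModule k ℤ (A.carrier →ₗ[k] A.carrier)
      (fun i => (LinearMap.lcomp k A.carrier (sgnPow A.gr i)) ∘ₗ (LinearMap.mul k A.carrier).flip ∘ₗ
        (A.gr i).subtype) ∘ₗ
    (DirectSum.decomposeLinearEquiv A.gr).toLinearMap

variable {A}

lemma opMul_left {i : ℤ} {a : A.carrier} (ha : a ∈ A.gr i) (b : A.carrier) :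
    A.opMul a b = sgnPow A.gr i b * a := by
  rw [opMul, LinearMap.comp_apply, LinearEquiv.coe_coe, DirectSum.decomposeLinearEquiv_apply,
    DirectSum.decompose_of_mem A.gr ha, ← DirectSum.lof_eq_of k, DirectSum.toModule_lof]
  simp

lemma opMul_of_mem {i j : ℤ} {a b : A.carrier} (ha : a ∈ A.gr i) (hb : b ∈ A.gr j) :
    A.opMul a b = (i * j).negOnePow • (b * a) := by
  rw [opMul_left ha, sgnPow_of_mem _ _ hb, smul_mul_assoc]

lemma opMul_mem {i j : ℤ} {a b : A.carrier} (ha : a ∈ A.gr i) (hb : b ∈ A.gr j) :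
    A.opMul a b ∈ A.gr (i + j) := by
  rw [opMul_of_mem ha hb, add_comm]
  exact negOnePow_smul_mem _ _ (SetLike.mul_mem_graded hb ha)

lemma one_opMul (a : A.carrier) : A.opMul 1 a = a := by
  induction a using hom_induction A.gr with
  | h0 => simp
  | hadd x y hx hy => rw [map_add, hx, hy]
  | hom n x hx => rw [opMul_of_mem SetLike.GradedOne.one_mem hx]; simp

lemma opMul_one (a : A.carrier) : A.opMul a 1 = a := by
  induction a using hom_induction A.gr with
  | h0 => simp
  | hadd x y hx hy => rw [map_add, LinearMap.add_apply, hx, hy]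
  | hom n x hx => rw [opMul_of_mem hx SetLike.GradedOne.one_mem]; simp

lemma opMul_assoc (a b c : A.carrier) : A.opMul (A.opMul a b) c = A.opMul a (A.opMul b c) := by
  induction a using hom_induction A.gr with
  | h0 => simp
  | hadd x y hx hy => simp only [map_add, LinearMap.add_apply, hx, hy]
  | hom i a ha =>
  induction b using hom_induction A.gr with
  | h0 => simp
  | hadd x y hx hy => simp only [map_add, LinearMap.add_apply, hx, hy]
  | hom j b hb =>
  induction c using hom_induction A.gr with
  | h0 => simp
  | hadd x y hx hy => simp only [map_add, hx, hy]
  | hom l c hc =>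
  rw [opMul_of_mem (opMul_mem ha hb) hc, opMul_of_mem ha (opMul_mem hb hc), opMul_of_mem ha hb,
    opMul_of_mem hb hc, mul_smul_comm, smul_mul_assoc, negOnePow_smul_smul, negOnePow_smul_smul,
    mul_assoc]
  apply negOnePow_smul_congr
  ring_nf
  simp

lemma opMul_leibniz {i : ℤ} {a : A.carrier} (ha : a ∈ A.gr i) (b : A.carrier) :
    A.d (A.opMul a b) = A.opMul (A.d a) b + i.negOnePow • A.opMul a (A.d b) := by
  induction b using hom_induction A.gr with
  | h0 => simp
  | hadd x y hx hy => simp only [map_add, hx, hy, smul_add]; abel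
  | hom j b hb =>
  rw [opMul_of_mem ha hb, opMul_of_mem (A.d_mem ha) hb, opMul_of_mem ha (A.d_mem hb),
    map_negOnePow_smul, A.leibniz _ hb, smul_add, negOnePow_smul_smul, negOnePow_smul_smul,
    add_comm]
  congr 1 <;> apply negOnePow_smul_congr <;> ring_nf <;> simp

variable (A) in
/-- The vector space underlying the opposite algebra (a copy of `A`). -/
def OpCarrier : Type u := A.carrier

instance : AddCommGroup A.OpCarrier := inferInstanceAs (AddCommGroup A.carrier)

instance : Module k A.OpCarrier := inferInstanceAs (Module k A.carrier)

noncomputable instance : Ring A.OpCarrier :=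
  { (inferInstance : AddCommGroup A.OpCarrier) with
    mul := fun a b => A.opMul a b
    one := (1 : A.carrier)
    mul_assoc := opMul_assoc
    one_mul := one_opMul
    mul_one := opMul_one
    zero_mul := fun a => LinearMap.map_zero₂ A.opMul a
    mul_zero := fun a => (A.opMul a).map_zero
    left_distrib := fun a b c => (A.opMul a).map_add b c
    right_distrib := fun a b c => LinearMap.map_add₂ A.opMul a b c }

noncomputable instance : Algebra k A.OpCarrier :=
  Algebra.ofModule (fun r a b => LinearMap.map_smul₂ A.opMul r a b)
    (fun r a b => (A.opMul a).map_smul r b)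

/-- The opposite differential graded algebra `A^op`: the same graded space and differential,
with multiplication `a ⬝ b = (-1)^(|a| |b|) b a`. -/
noncomputable def op (A : DGAlgebra k) : DGAlgebra k :=
  { carrier := A.OpCarrier
    gr := A.gr
    gradedAlgebra :=
      { one_mem := (SetLike.GradedOne.one_mem : (1 : A.carrier) ∈ A.gr 0)
        mul_mem := fun _ _ _ _ ha hb => opMul_mem ha hb
        decompose' := A.gradedAlgebra.toDecomposition.decompose'
        left_inv := A.gradedAlgebra.toDecomposition.left_inv
        right_inv := A.gradedAlgebra.toDecomposition.right_inv }
    d := A.d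
    d_mem := A.d_mem
    d_d := A.d_d
    leibniz := fun b ha => opMul_leibniz ha b }

/-- The identity map from `A` to `A^op`. -/
noncomputable def toOp : A.carrier ≃ₗ[k] A.op.carrier where
  toFun a := a
  invFun a := a
  map_add' _ _ := rfl
  map_smul' _ _ := rfl
  left_inv _ := rfl
  right_inv _ := rfl

lemma toOp_mem {n : ℤ} {a : A.carrier} (ha : a ∈ A.gr n) : toOp a ∈ A.op.gr n := ha

lemma toOp_d (a : A.carrier) : toOp (A.d a) = A.op.d (toOp a) := rfl

lemma toOp_mul {i j : ℤ} {a b : A.carrier} (ha : a ∈ A.gr i) (hb : b ∈ A.gr j) :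
    toOp a * toOp b = (i * j).negOnePow • toOp (b * a) := opMul_of_mem ha hb

end DGAlgebra

section tensor

variable {A : DGAlgebra k} (M : DGModule A) (X : DGModule A.op)

/-- The subspace of `M ⊗ X` generated by the elements `x a ⊗ y - x ⊗ a y` for homogeneous
`x`, `a`, `y`, where `a y = (-1)^(|a| |y|) y a` is the left action of `A` on the
`A^op`-module `X`. -/
def tensorRel : Submodule k (M.carrier ⊗[k] X.carrier) :=
  Submodule.span k {t | ∃ (p r q : ℤ) (x : M.carrier) (a : A.carrier) (y : X.carrier),
    x ∈ M.gr p ∧ a ∈ A.gr r ∧ y ∈ X.gr q ∧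
    t = (MulOpposite.op a • x) ⊗ₜ[k] y -
      x ⊗ₜ[k] ((r * q).negOnePow • (MulOpposite.op (DGAlgebra.toOp a) • y))}

/-- The differential `x ⊗ y ↦ d x ⊗ y + (-1)^|x| x ⊗ d y` on `M ⊗ X`. -/
noncomputable def tensorD₀ : M.carrier ⊗[k] X.carrier →ₗ[k] M.carrier ⊗[k] X.carrier :=
  TensorProduct.map M.d LinearMap.id + TensorProduct.map (sgnPow M.gr 1) X.d

variable {M X}

lemma tensorD₀_tmul {p : ℤ} {x : M.carrier} (hx : x ∈ M.gr p) (y : X.carrier) :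
    tensorD₀ M X (x ⊗ₜ y) = M.d x ⊗ₜ[k] y + p.negOnePow • (x ⊗ₜ[k] X.d y) := by
  simp [tensorD₀, sgnPow_of_mem M.gr 1 hx, Units.smul_def, TensorProduct.smul_tmul']

lemma tmul_negOnePow_smul (n : ℤ) (x : M.carrier) (y : X.carrier) :
    x ⊗ₜ[k] (n.negOnePow • y) = n.negOnePow • (x ⊗ₜ[k] y) :=
  map_negOnePow_smul (TensorProduct.mk k M.carrier X.carrier x) n y

lemma negOnePow_smul_tmul (n : ℤ) (x : M.carrier) (y : X.carrier) :
    (n.negOnePow • x) ⊗ₜ[k] y = n.negOnePow • (x ⊗ₜ[k] y) :=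
  map_negOnePow_smul ((TensorProduct.mk k M.carrier X.carrier).flip y) n x

lemma tensorRel_le : tensorRel M X ≤ (tensorRel M X).comap (tensorD₀ M X) := by
  rw [tensorRel, Submodule.span_le]
  rintro _ ⟨p, r, q, x, a, y, hx, ha, hy, rfl⟩
  have h1 : _ ∈ tensorRel M X := Submodule.subset_span
    ⟨p + 1, r, q, M.d x, a, y, M.d_mem hx, ha, hy, rfl⟩
  have h2 : _ ∈ tensorRel M X := Submodule.subset_span
    ⟨p, r + 1, q, x, A.d a, y, hx, A.d_mem ha, hy, rfl⟩
  have h3 : _ ∈ tensorRel M X := Submodule.subset_span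
    ⟨p, r, q + 1, x, a, X.d y, hx, ha, X.d_mem hy, rfl⟩
  change tensorD₀ M X _ ∈ tensorRel M X
  convert add_mem (add_mem h1 (negOnePow_smul_mem _ p h2)) (negOnePow_smul_mem _ (p + r) h3) using 1
  rw [map_sub, tensorD₀_tmul (M.smul_mem hx ha), tensorD₀_tmul hx, M.leibniz a hx,
    map_negOnePow_smul, X.leibniz _ hy, DGAlgebra.toOp_d]
  simp only [smul_sub, smul_add, TensorProduct.add_tmul, TensorProduct.tmul_add,
    tmul_negOnePow_smul, negOnePow_smul_tmul, negOnePow_smul_smul]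
  rw [negOnePow_smul_congr (m := p + (r + 1) * q) (n := p + (r * q + q)) (by ring_nf; simp),
    negOnePow_smul_congr (m := p + r + r * (q + 1)) (n := p + r * q) (by ring_nf; simp)]
  abel

lemma tensorD₀_tensorD₀ (t : M.carrier ⊗[k] X.carrier) : tensorD₀ M X (tensorD₀ M X t) = 0 := by
  induction t with
  | zero => simp
  | add x y hx hy => rw [map_add, map_add, hx, hy, add_zero]
  | tmul x y =>
  induction x using hom_induction M.gr with
  | h0 => simp
  | hadd x x' hx hx' => rw [TensorProduct.add_tmul, map_add, map_add, hx, hx', add_zero]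
  | hom p x hx =>
  rw [tensorD₀_tmul hx, map_add, map_negOnePow_smul, tensorD₀_tmul (M.d_mem hx), tensorD₀_tmul hx,
    M.d_d, X.d_d, Int.negOnePow_succ]
  simp

variable (M X)

/-- The tensor product `M ⊗_A X`, a complex of `k`-vector spaces. Its degree `n` part is spanned
by the classes of `x ⊗ y` with `|x| + |y| = n`. -/
noncomputable def tensor : Cpx k where
  carrier := (M.carrier ⊗[k] X.carrier) ⧸ tensorRel M X
  gr n := Submodule.span k {t | ∃ (p q : ℤ) (x : M.carrier) (y : X.carrier),
    x ∈ M.gr p ∧ y ∈ X.gr q ∧ p + q = n ∧ t = (tensorRel M X).mkQ (x ⊗ₜ[k] y)}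
  d := (tensorRel M X).mapQ (tensorRel M X) (tensorD₀ M X) tensorRel_le
  d_mem := by
    intro n t ht
    induction ht using Submodule.span_induction with
    | zero => simp
    | add x y _ _ hx hy => rw [map_add]; exact add_mem hx hy
    | smul c x _ hx => rw [map_smul]; exact Submodule.smul_mem _ c hx
    | mem t ht =>
      obtain ⟨p, q, x, y, hx, hy, rfl, rfl⟩ := ht
      rw [Submodule.mkQ_apply, Submodule.mapQ_apply, tensorD₀_tmul hx, ← Submodule.mkQ_apply,
        map_add, map_negOnePow_smul]
      exact add_mem (Submodule.subset_span ⟨p + 1, q, _, _, M.d_mem hx, hy, by ring, rfl⟩)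
        (negOnePow_smul_mem _ _
          (Submodule.subset_span ⟨p, q + 1, _, _, hx, X.d_mem hy, by ring, rfl⟩))
  d_d := by
    intro t
    obtain ⟨t, rfl⟩ := Submodule.mkQ_surjective _ t
    rw [Submodule.mkQ_apply, Submodule.mapQ_apply, Submodule.mapQ_apply, tensorD₀_tensorD₀,
      Submodule.Quotient.mk_zero]

end tensor

/-- A differential graded module `P` is homotopically projective if `Hom_{H(A)}(P, -)` sends
quasi-isomorphisms to isomorphisms; as this concerns quasi-isomorphisms between all
differential graded modules, in particular their shifts, this means that the total Hom complex
functor of `P` preserves quasi-isomorphisms. -/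
def IsHProjective {A : DGAlgebra k} (P : DGModule A) : Prop :=
  ∀ ⦃N N' : DGModule A⦄ (s : N ⟶ N'), DGModule.QIso s →
    Function.Bijective fun f : (toHo A).obj P ⟶ (toHo A).obj N => f ≫ (toHo A).map s

/-! The existence of homotopically projective resolutions. -/

namespace Res

open DGModule

section qiso

variable {A : DGAlgebra k} {N N' : DGModule A} {s : N ⟶ N'}

lemma mapH_mk (n : ℤ) (y : N.Z n) :
    mapH s n (Submodule.Quotient.mk y) = Submodule.Quotient.mk (mapZ s n y) := rfl

lemma mk_eq_zero_iff (n : ℤ) (y : N.Z n) :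
    (Submodule.Quotient.mk y : N.H n) = 0 ↔ ∃ t ∈ N.gr (n - 1), N.d t = y := by
  rw [Submodule.Quotient.mk_eq_zero]
  rfl

lemma qiso_inj (hs : QIso s) {n : ℤ} {y : N.carrier} (hy : y ∈ N.gr n) (hd : N.d y = 0)
    {t : N'.carrier} (ht : t ∈ N'.gr (n - 1)) (hst : N'.d t = lin s y) :
    ∃ t ∈ N.gr (n - 1), N.d t = y := by
  have h := (injective_iff_map_eq_zero _).1 (hs n).1 (Submodule.Quotient.mk ⟨y, hd, hy⟩)
    (by rw [mapH_mk, mk_eq_zero_iff]; exact ⟨t, ht, hst⟩)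
  rwa [mk_eq_zero_iff] at h

lemma qiso_surj (hs : QIso s) {n : ℤ} {t : N'.carrier} (ht : t ∈ N'.gr n) (hd : N'.d t = 0) :
    ∃ y ∈ N.gr n, N.d y = 0 ∧ ∃ t' ∈ N'.gr (n - 1), N'.d t' = t - lin s y := by
  obtain ⟨y, hy⟩ := (hs n).2 (Submodule.Quotient.mk ⟨t, hd, ht⟩)
  obtain ⟨⟨y, hy1, hy2⟩, rfl⟩ := Submodule.Quotient.mk_surjective _ y
  refine ⟨y, hy2, hy1, ?_⟩
  rw [eq_comm, ← sub_eq_zero, mapH_mk, ← Submodule.Quotient.mk_sub, mk_eq_zero_iff] at hy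
  exact hy

lemma qiso_of (h1 : ∀ (n : ℤ) (y : N.carrier), y ∈ N.gr n → N.d y = 0 →
      ∀ t ∈ N'.gr (n - 1), N'.d t = lin s y → ∃ t ∈ N.gr (n - 1), N.d t = y)
    (h2 : ∀ (n : ℤ) (t : N'.carrier), t ∈ N'.gr n → N'.d t = 0 →
      ∃ y ∈ N.gr n, N.d y = 0 ∧ lin s y = t) : QIso s := by
  intro n
  constructor
  · rw [injective_iff_map_eq_zero]
    intro y hy
    obtain ⟨⟨y, hy1, hy2⟩, rfl⟩ := Submodule.Quotient.mk_surjective _ y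
    rw [mapH_mk, mk_eq_zero_iff] at hy
    obtain ⟨t, ht, ht'⟩ := hy
    rw [mk_eq_zero_iff]
    exact h1 n y hy2 hy1 t ht ht'
  · intro t
    obtain ⟨⟨t, ht1, ht2⟩, rfl⟩ := Submodule.Quotient.mk_surjective _ t
    obtain ⟨y, hy, hy', rfl⟩ := h2 n t ht2 ht1
    exact ⟨Submodule.Quotient.mk ⟨y, hy', hy⟩, rfl⟩

end qiso

lemma d_one (A : DGAlgebra k) : A.d 1 = 0 := by
  have h := A.leibniz (a := 1) 1 SetLike.GradedOne.one_mem
  simpa using h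

variable {A : DGAlgebra k} (M : DGModule A)

/-- Generators of the resolution: `mk n b a m i` is a generator of degree `i` mapped to `m` with
differential `∑ j, b j * a j`, provided these data are admissible. -/
inductive Gen : Type u
  | mk (n : ℕ) (b : Fin n → Gen) (a : Fin n → A.carrier) (m : M.carrier) (i : ℤ) : Gen

variable {M}

/-- The degree of a generator. -/
def Gen.deg : Gen M → ℤ
  | .mk _ _ _ _ i => i

open Classical in
/-- The differential and the image in `M` of a generator. -/
noncomputable def Gen.dm : Gen M → (Gen M →₀ A.carrier) × M.carrier
  | .mk _ b a m i =>
    if (∀ j, a j ∈ A.gr (i + 1 - (b j).deg)) ∧ m ∈ M.gr i ∧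
        ∑ j, (MulOpposite.op (a j) • (b j).dm.1 +
          (b j).deg.negOnePow • Finsupp.single (b j) (A.d (a j))) = 0 ∧
        ∑ j, MulOpposite.op (a j) • (b j).dm.2 = M.d m
    then (∑ j, Finsupp.single (b j) (a j), m) else 0

/-- The free module on the generators. -/
abbrev F (M : DGModule A) : Type u := Gen M →₀ A.carrier

/-- The linear extension of a map on generators. -/
noncomputable def ext {T : Type u} [AddCommGroup T] [Module A.carrierᵐᵒᵖ T] (v : Gen M → T) :
    F M →ₗ[A.carrierᵐᵒᵖ] T :=
  Finsupp.lsum ℕ fun g =>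
    { toFun := fun a => MulOpposite.op a • v g
      map_add' := fun a b => by rw [MulOpposite.op_add, add_smul]
      map_smul' := fun r a => by
        rw [RingHom.id_apply, smul_smul]
        rfl }

@[simp] lemma ext_single {T : Type u} [AddCommGroup T] [Module A.carrierᵐᵒᵖ T] (v : Gen M → T)
    (g : Gen M) (a : A.carrier) : ext v (Finsupp.single g a) = MulOpposite.op a • v g := by
  simp [ext]

lemma op_smul_single (g : Gen M) (a c : A.carrier) :
    MulOpposite.op a • (Finsupp.single g c : F M) = Finsupp.single g (c * a) := by
  rw [Finsupp.smul_single]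
  rfl

/-- The differential of the resolution. -/
noncomputable def D : F M →ₗ[k] F M :=
  (ext fun g : Gen M => g.dm.1).restrictScalars k +
    Finsupp.lsum k fun g : Gen M => ((g.deg.negOnePow : ℤˣ) : ℤ) • (Finsupp.lsingle g ∘ₗ A.d)

lemma D_single (g : Gen M) (c : A.carrier) : D (Finsupp.single g c) =
    MulOpposite.op c • g.dm.1 + g.deg.negOnePow • (Finsupp.single g (A.d c) : F M) := by
  simp [D, Units.smul_def]

/-- The degree `n` part. -/
def gr (M : DGModule A) (n : ℤ) : Submodule k (F M) where
  carrier := {x | ∀ g, x g ∈ A.gr (n - g.deg)}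
  zero_mem' := fun _ => zero_mem _
  add_mem' := fun hx hy g => add_mem (hx g) (hy g)
  smul_mem' := fun c _ hx g => Submodule.smul_mem _ c (hx g)

lemma single_mem {n : ℤ} {g : Gen M} {c : A.carrier} (hc : c ∈ A.gr (n - g.deg)) :
    (Finsupp.single g c : F M) ∈ gr M n := by
  classical
  intro g'
  rw [Finsupp.single_apply]
  split_ifs with h
  · rwa [← h]
  · exact zero_mem _

lemma gr_induction {n : ℤ} {Q : F M → Prop} (h0 : Q 0) (hadd : ∀ x y, Q x → Q y → Q (x + y))
    (hs : ∀ g c, c ∈ A.gr (n - g.deg) → Q (Finsupp.single g c)) {x : F M} (hx : x ∈ gr M n) :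
    Q x := by
  rw [← Finsupp.sum_single x]
  exact Finset.sum_induction _ Q hadd h0 fun g _ => hs g _ (hx g)

lemma dm_cases (g : Gen M) :
    (g.dm = 0) ∨ (∃ (n : ℕ) (b : Fin n → Gen M) (a : Fin n → A.carrier),
      g.dm.1 = ∑ j, Finsupp.single (b j) (a j) ∧ (∀ j, a j ∈ A.gr (g.deg + 1 - (b j).deg)) ∧
      g.dm.2 ∈ M.gr g.deg ∧ D g.dm.1 = 0 ∧ ext (fun g : Gen M => g.dm.2) g.dm.1 = M.d g.dm.2) := by
  obtain ⟨n, b, a, m, i⟩ := g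
  by_cases h : (∀ j, a j ∈ A.gr (i + 1 - (b j).deg)) ∧ m ∈ M.gr i ∧
        ∑ j, (MulOpposite.op (a j) • (b j).dm.1 +
          (b j).deg.negOnePow • Finsupp.single (b j) (A.d (a j))) = 0 ∧
        ∑ j, MulOpposite.op (a j) • (b j).dm.2 = M.d m
  · refine Or.inr ⟨n, b, a, ?_⟩
    rw [Gen.dm, if_pos h]
    obtain ⟨h1, h2, h3, h4⟩ := h
    refine ⟨rfl, h1, h2, ?_, ?_⟩
    · simpa only [map_sum, D_single] using h3
    · simpa only [map_sum, ext_single] using h4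
  · left
    rw [Gen.dm, if_neg h]

lemma dm_mem (g : Gen M) : g.dm.1 ∈ gr M (g.deg + 1) := by
  obtain h | ⟨n, b, a, h, h1, -⟩ := dm_cases g
  · rw [h]; exact zero_mem _
  · rw [h]; exact sum_mem fun j _ => single_mem (h1 j)

lemma dm_mem' (g : Gen M) : g.dm.2 ∈ M.gr g.deg := by
  obtain h | ⟨n, b, a, h, h1, h2, -⟩ := dm_cases g
  · rw [h]; exact zero_mem _
  · exact h2

lemma D_dm (g : Gen M) : D g.dm.1 = 0 := by
  obtain h | ⟨n, b, a, h, h1, h2, h3, -⟩ := dm_cases g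
  · rw [h]; simp
  · exact h3

lemma ext_dm (g : Gen M) : ext (fun g : Gen M => g.dm.2) g.dm.1 = M.d g.dm.2 := by
  obtain h | ⟨n, b, a, h, h1, h2, h3, h4⟩ := dm_cases g
  · rw [h]; simp
  · exact h4

lemma smul_mem {m n : ℤ} {x : F M} {a : A.carrier} (hx : x ∈ gr M m) (ha : a ∈ A.gr n) :
    MulOpposite.op a • x ∈ gr M (m + n) := by
  intro g
  have h := SetLike.mul_mem_graded (hx g) ha
  rw [show m - g.deg + n = m + n - g.deg by ring] at h
  exact h

lemma D_mem {n : ℤ} {x : F M} (hx : x ∈ gr M n) : D x ∈ gr M (n + 1) := by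
  refine gr_induction (Q := fun x => D x ∈ gr M (n + 1)) (by simp) ?_ ?_ hx
  · intro x y hx hy
    rw [map_add]
    exact add_mem hx hy
  · intro g c hc
    rw [D_single]
    refine add_mem ?_ (negOnePow_smul_mem _ _ (single_mem ?_))
    · have h := smul_mem (dm_mem g) hc
      rwa [show g.deg + 1 + (n - g.deg) = n + 1 by ring] at h
    · have h := A.d_mem hc
      rwa [show n - g.deg + 1 = n + 1 - g.deg by ring] at h

lemma negOnePow_smul_single (n : ℤ) (g : Gen M) (a : A.carrier) :
    (Finsupp.single g (n.negOnePow • a) : F M) = n.negOnePow • Finsupp.single g a :=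
  map_negOnePow_smul (Finsupp.singleAddHom g) n a

lemma op_smul_negOnePow {T : Type*} [AddCommGroup T] [Module A.carrierᵐᵒᵖ T] (n : ℤ)
    (a : A.carrierᵐᵒᵖ) (x : T) : a • n.negOnePow • x = n.negOnePow • a • x :=
  map_negOnePow_smul (DistribSMul.toAddMonoidHom T a) n x

lemma D_leibniz {n : ℤ} {x : F M} (a : A.carrier) (hx : x ∈ gr M n) :
    D (MulOpposite.op a • x) = MulOpposite.op a • D x +
      n.negOnePow • (MulOpposite.op (A.d a) • x) := by
  refine gr_induction (Q := fun x => D (MulOpposite.op a • x) = MulOpposite.op a • D x +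
      n.negOnePow • (MulOpposite.op (A.d a) • x)) (by simp) ?_ ?_ hx
  · intro x y hx hy
    simp only [smul_add, map_add, hx, hy]
    abel
  · intro g c hc
    rw [op_smul_single, D_single, D_single, A.leibniz a hc, MulOpposite.op_mul, mul_smul, smul_add,
      Finsupp.single_add, op_smul_negOnePow, negOnePow_smul_single, smul_add, negOnePow_smul_smul,
      op_smul_single, op_smul_single, add_sub_cancel, add_assoc]

lemma D_D (x : F M) : D (D x) = 0 := by
  induction x using Finsupp.induction_linear with
  | zero => simp
  | add x y hx hy => rw [map_add, map_add, hx, hy, add_zero]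
  | single g c =>
    rw [D_single, map_add, D_leibniz c (dm_mem g), D_dm, map_negOnePow_smul, D_single, A.d_d,
      Int.negOnePow_succ]
    simp

/-- The decomposition of the free module into homogeneous components. -/
noncomputable def decomp (M : DGModule A) : F M →ₗ[k] ⨁ n, gr M n :=
  Finsupp.lsum k fun g : Gen M =>
    DirectSum.toModule k ℤ _ (fun n => (DirectSum.lof k ℤ (fun n => gr M n) (n + g.deg)) ∘ₗ
      ((Finsupp.lsingle g : A.carrier →ₗ[k] F M).restrict (p := A.gr n) (q := gr M (n + g.deg))
        fun x hx => single_mem (by simpa using hx))) ∘ₗ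
    (DirectSum.decomposeLinearEquiv A.gr).toLinearMap

lemma lof_congr {m n : ℤ} (h : m = n) (x : F M) (hm : x ∈ gr M m) (hn : x ∈ gr M n) :
    DirectSum.lof k ℤ (fun n => gr M n) m ⟨x, hm⟩ = DirectSum.lof k ℤ (fun n => gr M n) n ⟨x, hn⟩ := by
  subst h; rfl

lemma decomp_single {n : ℤ} (g : Gen M) {c : A.carrier} (hc : c ∈ A.gr (n - g.deg)) :
    decomp M (Finsupp.single g c) = DirectSum.lof k ℤ (fun n => gr M n) n ⟨_, single_mem hc⟩ := by
  rw [decomp, Finsupp.lsum_single, LinearMap.comp_apply, LinearEquiv.coe_coe,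
    DirectSum.decomposeLinearEquiv_apply, DirectSum.decompose_of_mem A.gr hc,
    ← DirectSum.lof_eq_of k, DirectSum.toModule_lof]
  exact lof_congr (by ring) _ _ _

noncomputable instance : DirectSum.Decomposition (gr M) :=
  DirectSum.Decomposition.ofLinearMap _ (decomp M)
    (by
      ext g c : 2
      induction c using hom_induction A.gr with
      | h0 => simp
      | hadd x y hx hy => simp only [map_add, hx, hy]
      | hom n c hc =>
        have hc' : c ∈ A.gr (n + g.deg - g.deg) := by simpa using hc
        simp only [LinearMap.comp_apply, Finsupp.lsingle_apply]
        rw [decomp_single g hc', DirectSum.coeLinearMap_lof]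
        rfl)
    (by
      ext n x : 2
      obtain ⟨x, hx⟩ := x
      simp only [LinearMap.comp_apply, DirectSum.coeLinearMap_lof, LinearMap.id_apply]
      have key : ∃ hx' : x ∈ gr M n,
          decomp M x = DirectSum.lof k ℤ (fun n => gr M n) n ⟨x, hx'⟩ := by
        refine gr_induction (Q := fun x => ∃ hx' : x ∈ gr M n,
          decomp M x = DirectSum.lof k ℤ (fun n => gr M n) n ⟨x, hx'⟩) ?_ ?_ ?_ hx
        · exact ⟨zero_mem _, by rw [map_zero]; exact (map_zero _).symm⟩
        · rintro x y ⟨hx, hx'⟩ ⟨hy, hy'⟩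
          exact ⟨add_mem hx hy, by rw [map_add, hx', hy', ← map_add]; rfl⟩
        · intro g c hc
          exact ⟨single_mem hc, decomp_single g hc⟩
      exact key.2)

/-- The resolution as a differential graded module. -/
noncomputable def res (M : DGModule A) : DGModule A where
  carrier := F M
  gr := gr M
  d := D
  d_mem := D_mem
  d_d := D_D
  smul_mem := smul_mem
  leibniz := D_leibniz

lemma ext_mem {n : ℤ} {x : F M} (hx : x ∈ gr M n) : ext (fun g : Gen M => g.dm.2) x ∈ M.gr n := by
  refine gr_induction (Q := fun x => ext (fun g : Gen M => g.dm.2) x ∈ M.gr n) (by simp) ?_ ?_ hx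
  · intro x y hx hy
    rw [map_add]
    exact add_mem hx hy
  · intro g c hc
    rw [ext_single]
    have h := M.smul_mem (dm_mem' g) hc
    rwa [add_sub_cancel] at h

lemma ext_D (x : F M) : ext (fun g : Gen M => g.dm.2) (D x) =
    M.d (ext (fun g : Gen M => g.dm.2) x) := by
  induction x using Finsupp.induction_linear with
  | zero => simp
  | add x y hx hy => simp only [map_add, hx, hy]
  | single g c =>
    rw [D_single, map_add, map_smul, ext_dm, map_negOnePow_smul, ext_single, ext_single,
      M.leibniz c (dm_mem' g)]

/-- The augmentation of the resolution. -/
noncomputable def aug (M : DGModule A) : res M ⟶ M where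
  toLin := ext fun g : Gen M => g.dm.2
  map_mem := ext_mem
  map_d := ext_D

lemma D_single_one (g : Gen M) : D (Finsupp.single g 1) = g.dm.1 := by
  rw [D_single, d_one]
  simp

lemma single_one_mem (g : Gen M) : (Finsupp.single g 1 : F M) ∈ gr M g.deg :=
  single_mem (by rw [sub_self]; exact SetLike.GradedOne.one_mem)

lemma aug_inj {n : ℤ} {y : F M} (hy : y ∈ gr M n) (hd : D y = 0) {t : M.carrier}
    (ht : t ∈ M.gr (n - 1)) (hty : M.d t = ext (fun g : Gen M => g.dm.2) y) :
    ∃ x ∈ gr M (n - 1), D x = y := by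
  let e := y.support.equivFin
  let g : Gen M := .mk _ (fun j => (e.symm j : Gen M)) (fun j => y (e.symm j)) t (n - 1)
  have hsum : ∑ j, Finsupp.single (e.symm j : Gen M) (y (e.symm j)) = y := by
    rw [Equiv.sum_comp e.symm (fun g : y.support => Finsupp.single (g : Gen M) (y g)),
      Finset.sum_coe_sort y.support (fun g => Finsupp.single g (y g))]
    exact Finsupp.sum_single y
  have hg : g.dm = (y, t) := by
    rw [Gen.dm, if_pos, hsum]
    refine ⟨fun j => ?_, ht, ?_, ?_⟩
    · have := hy (e.symm j)
      simpa using this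
    · rw [← hsum] at hd
      simpa only [map_sum, D_single] using hd
    · have h : ext (fun g : Gen M => g.dm.2)
          (∑ j, Finsupp.single (e.symm j : Gen M) (y (e.symm j))) = M.d t := by rw [hsum, hty]
      simpa only [map_sum, ext_single] using h
  exact ⟨Finsupp.single g 1, single_one_mem g, by rw [D_single_one, hg]⟩

lemma aug_surj {n : ℤ} {t : M.carrier} (ht : t ∈ M.gr n) (hd : M.d t = 0) :
    ∃ x ∈ gr M n, D x = 0 ∧ ext (fun g : Gen M => g.dm.2) x = t := by
  let g : Gen M := .mk 0 Fin.elim0 Fin.elim0 t n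
  have hg : g.dm = (0, t) := by
    rw [Gen.dm, if_pos]
    · simp
    · exact ⟨fun j => j.elim0, ht, by simp, by simp [hd]⟩
  refine ⟨Finsupp.single g 1, single_one_mem g, by rw [D_single_one, hg], ?_⟩
  rw [ext_single, hg]
  simp

lemma qiso_aug (M : DGModule A) : QIso (aug M) :=
  qiso_of (fun _ _ hy hd _ ht hty => aug_inj hy hd ht hty) fun _ _ ht hd => aug_surj ht hd

open Classical in
/-- Recursive choice of values on generators. -/
noncomputable def pick {T : Type u} [AddCommGroup T] [Module A.carrierᵐᵒᵖ T]
    (R : Gen M → T → T → Prop) : Gen M → T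
  | .mk n b a m i =>
    let w : T := if (Gen.mk n b a m i).dm.1 = ∑ j, Finsupp.single (b j) (a j) then
      ∑ j, MulOpposite.op (a j) • pick R (b j) else 0
    if h : ∃ v, R (.mk n b a m i) w v then h.choose else 0

lemma dm_mk_cases {n b a m i} : (Gen.mk n b a m i : Gen M).dm.1 = ∑ j, Finsupp.single (b j) (a j) ∨
    (Gen.mk n b a m i : Gen M).dm.1 = 0 := by
  rw [Gen.dm]
  split_ifs
  · exact Or.inl rfl
  · exact Or.inr rfl

lemma exists_ext {T : Type u} [AddCommGroup T] [Module A.carrierᵐᵒᵖ T]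
    (R : Gen M → T → T → Prop) : ∃ v : F M →ₗ[A.carrierᵐᵒᵖ] T, ∀ g : Gen M,
      (∃ t, R g (v g.dm.1) t) → R g (v g.dm.1) (v (Finsupp.single g 1)) := by
  classical
  refine ⟨ext (pick R), fun g => ?_⟩
  rw [ext_single, MulOpposite.op_one, one_smul]
  obtain ⟨n, b, a, m, i⟩ := g
  have hw : ext (pick R) (Gen.mk n b a m i).dm.1 =
      if (Gen.mk n b a m i).dm.1 = ∑ j, Finsupp.single (b j) (a j) then
      ∑ j, MulOpposite.op (a j) • pick R (b j) else 0 := by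
    split_ifs with h
    · simp only [h, map_sum, ext_single]
    · rw [dm_mk_cases.resolve_left h, map_zero]
  intro h
  rw [hw] at h ⊢
  rw [pick, dif_pos h]
  exact h.choose_spec

lemma gen_induction {E : Gen M → Prop} {Q : ℤ → F M → Prop} (h0 : ∀ n, Q n 0)
    (hadd : ∀ n x y, Q n x → Q n y → Q n (x + y))
    (hmul : ∀ n g c, c ∈ A.gr (n - g.deg) → E g → Q n (Finsupp.single g c))
    (hstep : ∀ g : Gen M, Q (g.deg + 1) g.dm.1 → E g) {n : ℤ} {x : F M} (hx : x ∈ gr M n) :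
    Q n x := by
  have hE : ∀ g : Gen M, E g := by
    intro g
    induction g with
    | mk n b a m i ih =>
      apply hstep
      rw [Gen.dm]
      split_ifs with h
      · change Q (i + 1) (∑ j, (Finsupp.single (b j) (a j) : F M))
        exact Finset.sum_induction (fun j => (Finsupp.single (b j) (a j) : F M)) (Q _) (hadd _)
          (h0 _) fun j _ => hmul _ _ _ (h.1 j) (ih j)
      · exact h0 _
  exact gr_induction (h0 n) (hadd n) (fun g c hc => hmul n g c hc (hE g)) hx

lemma hproj_surj {N N' : DGModule A} (s : N ⟶ N') (hs : QIso s) (f : res M ⟶ N') :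
    ∃ g : res M ⟶ N, Homotopic (g ≫ s) f := by
  let f' : F M →ₗ[A.carrierᵐᵒᵖ] N'.carrier := lin f
  have hfm : ∀ {n : ℤ} {x : F M}, x ∈ gr M n → f' x ∈ N'.gr n := fun h => lin_mem f h
  have hfd : ∀ x : F M, f' (D x) = N'.d (f' x) := lin_d f
  obtain ⟨v, hv⟩ := exists_ext (M := M) (T := N.carrier × N'.carrier) fun g w v =>
    v.1 ∈ N.gr g.deg ∧ v.2 ∈ N'.gr (g.deg - 1) ∧ N.d v.1 = w.1 ∧
      lin s v.1 - f' (Finsupp.single g 1) = N'.d v.2 + w.2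
  have main : ∀ {n : ℤ} {x : F M}, x ∈ gr M n → (v x).1 ∈ N.gr n ∧ (v x).2 ∈ N'.gr (n - 1) ∧
      N.d (v x).1 = (v (D x)).1 ∧
      lin s (v x).1 - f' x = N'.d (v x).2 + (v (D x)).2 := by
    intro n x hx
    refine gen_induction
      (E := fun g => (v (Finsupp.single g 1)).1 ∈ N.gr g.deg ∧
        (v (Finsupp.single g 1)).2 ∈ N'.gr (g.deg - 1) ∧
        N.d (v (Finsupp.single g 1)).1 = (v g.dm.1).1 ∧
        lin s (v (Finsupp.single g 1)).1 - f' (Finsupp.single g 1) =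
          N'.d (v (Finsupp.single g 1)).2 + (v g.dm.1).2)
      (Q := fun n x => (v x).1 ∈ N.gr n ∧ (v x).2 ∈ N'.gr (n - 1) ∧
        N.d (v x).1 = (v (D x)).1 ∧
        lin s (v x).1 - f' x = N'.d (v x).2 + (v (D x)).2) ?_ ?_ ?_ ?_ hx
    · intro n
      simp
    · rintro n x y ⟨h1, h2, h3, h4⟩ ⟨h1', h2', h3', h4'⟩
      refine ⟨?_, ?_, ?_, ?_⟩
      · rw [map_add]; exact add_mem h1 h1'
      · rw [map_add]; exact add_mem h2 h2'
      · simp only [map_add, Prod.fst_add, h3, h3']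
      · simp only [map_add, Prod.fst_add, Prod.snd_add, add_sub_add_comm, h4, h4']
        abel
    · rintro n g c hc ⟨h1, h2, h3, h4⟩
      have hx : (Finsupp.single g c : F M) = MulOpposite.op c • Finsupp.single g 1 := by
        rw [op_smul_single, one_mul]
      have hD : D (Finsupp.single g c : F M) = MulOpposite.op c • g.dm.1 +
          g.deg.negOnePow • MulOpposite.op (A.d c) • (Finsupp.single g 1 : F M) := by
        rw [D_single, op_smul_single, one_mul]
      have e1 : g.deg + (n - g.deg) = n := by ring
      have e2 : g.deg - 1 + (n - g.deg) = n - 1 := by ring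
      rw [hD, hx]
      simp only [map_smul, map_add, map_negOnePow_smul, Prod.smul_fst, Prod.smul_snd,
        Prod.fst_add, Prod.snd_add]
      refine ⟨e1 ▸ N.smul_mem h1 hc, e2 ▸ N'.smul_mem h2 hc, ?_, ?_⟩
      · rw [N.leibniz c h1, h3]
      · rw [← smul_sub, h4, N'.leibniz c h2, smul_add, Int.negOnePow_sub, Int.negOnePow_one]
        simp only [mul_neg, mul_one, Units.neg_smul]
        abel
    · rintro g ⟨h1, h2, h3, h4⟩
      refine hv g ?_
      rw [D_dm, map_zero] at h3 h4
      rw [add_sub_cancel_right] at h2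
      have hf : f' g.dm.1 = N'.d (f' (Finsupp.single g 1)) := by rw [← hfd, D_single_one]
      simp only [Prod.fst_zero, Prod.snd_zero, add_zero] at h3 h4
      obtain ⟨n0, hn0, hn0'⟩ := qiso_inj hs h1 h3
        (t := f' (Finsupp.single g 1) + (v g.dm.1).2)
        (by rw [add_sub_cancel_right]; exact add_mem (hfm (single_one_mem g)) h2)
        (by rw [map_add, ← h4, ← hf]; abel)
      rw [add_sub_cancel_right] at hn0
      obtain ⟨n1, hn1, hn1', t', ht', htt⟩ := qiso_surj hs
        (t := lin s n0 - f' (Finsupp.single g 1) - (v g.dm.1).2) (n := g.deg)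
        (sub_mem (sub_mem (lin_mem s hn0) (hfm (single_one_mem g))) h2)
        (by rw [map_sub, map_sub, ← lin_d, hn0', ← hf, h4, sub_self])
      refine ⟨(n0 - n1, t'), sub_mem hn0 hn1, ht', ?_, ?_⟩
      · rw [map_sub, hn0', hn1', sub_zero]
      · rw [htt, map_sub]
        abel
  have main' : ∀ x : F M, N.d (v x).1 = (v (D x)).1 ∧
      lin s (v x).1 - f' x = N'.d (v x).2 + (v (D x)).2 := by
    intro x
    induction x using hom_induction (gr M) with
    | h0 => simp
    | hadd x y hx hy =>
      refine ⟨?_, ?_⟩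
      · simp only [map_add, Prod.fst_add, hx.1, hy.1]
      · simp only [map_add, Prod.fst_add, Prod.snd_add, add_sub_add_comm, hx.2, hy.2]
        abel
    | hom n x hx => exact (main hx).2.2
  exact ⟨⟨LinearMap.fst _ _ _ ∘ₗ v, fun h => (main h).1, fun x => (main' x).1.symm⟩,
    LinearMap.snd _ _ _ ∘ₗ v, fun n x h => (main h).2.1, fun x => (main' x).2⟩

lemma hproj_inj {N N' : DGModule A} (s : N ⟶ N') (hs : QIso s) (f₁ f₂ : res M ⟶ N)
    (h : Homotopic (f₁ ≫ s) (f₂ ≫ s)) : Homotopic f₁ f₂ := by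
  obtain ⟨h', hm', hh'⟩ := h
  let f : F M →ₗ[A.carrierᵐᵒᵖ] N.carrier := lin f₁ - lin f₂
  let p : F M →ₗ[A.carrierᵐᵒᵖ] N'.carrier := h'
  have hfm : ∀ {n : ℤ} {x : F M}, x ∈ gr M n → f x ∈ N.gr n :=
    fun h => sub_mem (lin_mem f₁ h) (lin_mem f₂ h)
  have hfe : ∀ x : F M, f x = lin f₁ x - lin f₂ x := fun _ => rfl
  have hfd : ∀ x : F M, f (D x) = N.d (f x) := fun x =>
    (congrArg₂ (· - ·) (lin_d f₁ x) (lin_d f₂ x)).trans (map_sub N.d _ _).symm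
  have hpm : ∀ {n : ℤ} {x : F M}, x ∈ gr M n → p x ∈ N'.gr (n - 1) := fun h => hm' _ _ h
  have hp : ∀ x : F M, lin s (f x) = N'.d (p x) + p (D x) := fun x =>
    (map_sub (lin s) (lin f₁ x) (lin f₂ x)).trans (hh' x)
  clear_value f p
  obtain ⟨v, hv⟩ := exists_ext (M := M) (T := N.carrier × N'.carrier) fun g w v =>
    v.1 ∈ N.gr (g.deg - 1) ∧ v.2 ∈ N'.gr (g.deg - 1 - 1) ∧
      f (Finsupp.single g 1) = N.d v.1 + w.1 ∧
      lin s v.1 - p (Finsupp.single g 1) = N'.d v.2 - w.2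
  have main : ∀ {n : ℤ} {x : F M}, x ∈ gr M n → (v x).1 ∈ N.gr (n - 1) ∧
      (v x).2 ∈ N'.gr (n - 1 - 1) ∧ f x = N.d (v x).1 + (v (D x)).1 ∧
      lin s (v x).1 - p x = N'.d (v x).2 - (v (D x)).2 := by
    intro n x hx
    refine gen_induction
      (E := fun g => (v (Finsupp.single g 1)).1 ∈ N.gr (g.deg - 1) ∧
        (v (Finsupp.single g 1)).2 ∈ N'.gr (g.deg - 1 - 1) ∧
        f (Finsupp.single g 1) = N.d (v (Finsupp.single g 1)).1 + (v g.dm.1).1 ∧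
        lin s (v (Finsupp.single g 1)).1 - p (Finsupp.single g 1) =
          N'.d (v (Finsupp.single g 1)).2 - (v g.dm.1).2)
      (Q := fun n x => (v x).1 ∈ N.gr (n - 1) ∧
        (v x).2 ∈ N'.gr (n - 1 - 1) ∧ f x = N.d (v x).1 + (v (D x)).1 ∧
        lin s (v x).1 - p x = N'.d (v x).2 - (v (D x)).2) ?_ ?_ ?_ ?_ hx
    · intro n
      simp
    · rintro n x y ⟨h1, h2, h3, h4⟩ ⟨h1', h2', h3', h4'⟩
      refine ⟨?_, ?_, ?_, ?_⟩
      · rw [map_add]; exact add_mem h1 h1'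
      · rw [map_add]; exact add_mem h2 h2'
      · simp only [map_add, Prod.fst_add, h3, h3']
        abel
      · simp only [map_add, Prod.fst_add, Prod.snd_add, add_sub_add_comm, h4, h4']
    · rintro n g c hc ⟨h1, h2, h3, h4⟩
      have hx : (Finsupp.single g c : F M) = MulOpposite.op c • Finsupp.single g 1 := by
        rw [op_smul_single, one_mul]
      have hD : D (Finsupp.single g c : F M) = MulOpposite.op c • g.dm.1 +
          g.deg.negOnePow • MulOpposite.op (A.d c) • (Finsupp.single g 1 : F M) := by
        rw [D_single, op_smul_single, one_mul]
      have e1 : g.deg - 1 + (n - g.deg) = n - 1 := by ring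
      have e2 : g.deg - 1 - 1 + (n - g.deg) = n - 1 - 1 := by ring
      rw [hD, hx]
      simp only [map_smul, map_add, map_negOnePow_smul, Prod.smul_fst, Prod.smul_snd,
        Prod.fst_add, Prod.snd_add]
      refine ⟨e1 ▸ N.smul_mem h1 hc, e2 ▸ N'.smul_mem h2 hc, ?_, ?_⟩
      · rw [N.leibniz c h1, h3, smul_add, Int.negOnePow_sub, Int.negOnePow_one]
        simp only [mul_neg, mul_one, Units.neg_smul]
        abel
      · rw [← smul_sub, h4, N'.leibniz c h2, smul_sub, Int.negOnePow_sub, Int.negOnePow_sub,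
          Int.negOnePow_one]
        simp only [mul_neg, mul_one, neg_neg]
        abel
    · rintro g ⟨h1, h2, h3, h4⟩
      refine hv g ?_
      rw [D_dm, map_zero] at h3 h4
      rw [add_sub_cancel_right] at h1 h2
      have hf : f g.dm.1 = N.d (f (Finsupp.single g 1)) := by rw [← hfd, D_single_one]
      have hp1 := hp (Finsupp.single g 1)
      rw [D_single_one] at hp1
      simp only [Prod.fst_zero, Prod.snd_zero, add_zero, sub_zero] at h3 h4
      obtain ⟨n0, hn0, hn0'⟩ := qiso_inj hs (n := g.deg)
        (y := f (Finsupp.single g 1) - (v g.dm.1).1)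
        (t := p (Finsupp.single g 1) - (v g.dm.1).2)
        (sub_mem (hfm (single_one_mem g)) h1)
        (by rw [map_sub, ← hf, h3, sub_self])
        (sub_mem (hpm (single_one_mem g)) h2)
        (by rw [map_sub, map_sub, ← h4, hp1]; abel)
      obtain ⟨n1, hn1, hn1', t', ht', htt⟩ := qiso_surj hs
        (t := lin s n0 - p (Finsupp.single g 1) + (v g.dm.1).2) (n := g.deg - 1)
        (add_mem (sub_mem (lin_mem s hn0) (hpm (single_one_mem g))) h2)
        (by rw [map_add, map_sub, ← lin_d, hn0', ← h4, map_sub, hp1]; abel)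
      refine ⟨(n0 - n1, t'), sub_mem hn0 hn1, ht', ?_, ?_⟩
      · rw [map_sub, hn0', hn1', sub_zero, sub_add_cancel]
      · rw [htt, map_sub]
        abel
  refine ⟨LinearMap.fst _ _ _ ∘ₗ v, fun n x h => (main h).1, fun x => ?_⟩
  have main' : ∀ x : F M, f x = N.d (v x).1 + (v (D x)).1 := by
    intro x
    induction x using hom_induction (gr M) with
    | h0 => simp
    | hadd x y hx hy =>
      simp only [map_add, Prod.fst_add, hx, hy]
      abel
    | hom n x hx => exact (main hx).2.2.1
  exact (hfe x).symm.trans (main' x)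

lemma hproj_res (M : DGModule A) : IsHProjective (res M) := by
  intro N N' s hs
  constructor
  · intro f₁ f₂ h
    obtain ⟨f₁, rfl⟩ := (toHo A).map_surjective f₁
    obtain ⟨f₂, rfl⟩ := (toHo A).map_surjective f₂
    simp only [← Functor.map_comp] at h
    rw [Quotient.functor_map_eq_iff] at h ⊢
    exact hproj_inj s hs f₁ f₂ h
  · intro f
    obtain ⟨f, rfl⟩ := (toHo A).map_surjective f
    obtain ⟨g, hg⟩ := hproj_surj s hs f
    refine ⟨(toHo A).map g, ?_⟩
    simp only [← Functor.map_comp]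
    rw [Quotient.functor_map_eq_iff]
    exact hg

end Res

/-- Every differential graded module has a homotopically projective resolution. -/
lemma exists_hProjective_resolution {A : DGAlgebra k} (M : DGModule A) :
    ∃ (P : DGModule A) (f : P ⟶ M), IsHProjective P ∧ DGModule.QIso f :=
  ⟨Res.res M, Res.aug M, Res.hproj_res M, Res.qiso_aug M⟩

/-- A chosen homotopically projective resolution `pM` of `M`. -/
noncomputable def hProj {A : DGAlgebra k} (M : DGModule A) : DGModule A :=
  (exists_hProjective_resolution M).choose

lemma hProj_spec {A : DGAlgebra k} (M : DGModule A) :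
    ∃ f : hProj M ⟶ M, IsHProjective (hProj M) ∧ DGModule.QIso f :=
  (exists_hProjective_resolution M).choose_spec

/-- The left derived tensor product `M ⊗_A^L X = pM ⊗_A X`. -/
noncomputable def derivedTensor {A : DGAlgebra k} (M : DGModule A) (X : DGModule A.op) : Cpx k :=
  tensor (hProj M) X

end
end DG

/-!
The proof replaces `M` by a semifree resolution `S` whose basis lies in finitely many degrees and
whose differential sends a basis element to a combination of basis elements of smaller degree. Then
`S`, and likewise `S ⊗ X`, is a sum of shifted copies of `A`, respectively `X`, with a differential
which is that of the copies up to terms in smaller shifts (`DG.IsTriangular`). If `i₀` and `i₁` are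
basis elements of smallest and largest degree, the lowest cohomology class of `X` in the copy at
`i₀` is not a boundary, and the highest cohomology class of `X` in the copy at `i₁` extends to a
cocycle which is not a boundary either, since the obstructions lie in degrees where the cohomology
of `X` vanishes (`DG.IsTriangular.infH_supH`). So the cohomology of `S ⊗ X` starts in degree
`deg i₀ + inf X` and does not vanish in degree `deg i₁ + sup X`. Applied to `A` itself, whose
cohomology starts in degree `0`, the same argument gives `inf M = deg i₀` and `amp A ≤ amp M`.

The resolution exists for every module with cohomology bounded below
(`DG.exists_semiBasis_qiso`). Generators are attached degree by degree, those of degree `j` along a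
basis of the degree `j` cohomology of the cone of the map constructed so far. Using a basis, and
`H⁰ A = k`, ensures that attaching them creates no new cohomology in degree `j`; by `H¹ A = 0`
they add nothing to the kernel of the map on cohomology in degree `j + 1`. Hence generators of
degree `j` suffice to make the map surjective on cohomology in degree `j` and injective in degree
`j + 1`, and their differentials only involve older generators
(`DG.Res.Stage.exists_succ`).

Compactness enters twice, through the fact that a morphism from a compact object to a direct sum has
only finitely many nonzero components (`DG.finite_components_of_isCompactObj`), which requires that
direct sums of modules are coproducts in the derived category. The morphism from `M` to the sum of
its truncations shows that the cohomology of `M` is bounded below, so that the resolution is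
available; the morphism from `S` to the sum of its quotients by the generators of small degree shows
that the degrees of the basis are bounded above, because the resolution leaves no room for a
null-homotopy (`DG.SemiBasis.deg_lt_of_homotopic`).
-/

namespace DG

variable {k : Type u} [Field k]

/-! ### Gradings and their projections -/

section Grading

variable {V : Type*} [AddCommGroup V] [Module k V] (gr : ℤ → Submodule k V)

section

variable [DirectSum.Decomposition gr]

/-- The projection of a graded vector space onto its part of degree `n`, as an endomorphism. -/
noncomputable def proj (n : ℤ) : V →ₗ[k] V :=
  (gr n).subtype ∘ₗ DirectSum.component k ℤ (fun i => gr i) n ∘ₗ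
    (DirectSum.decomposeLinearEquiv gr).toLinearMap

lemma proj_mem (n : ℤ) (x : V) : proj gr n x ∈ gr n :=
  (DirectSum.decompose gr x n).2

lemma proj_of_mem {n : ℤ} {x : V} (hx : x ∈ gr n) : proj gr n x = x :=
  DirectSum.decompose_of_mem_same gr hx

lemma proj_of_mem_ne {m n : ℤ} {x : V} (hx : x ∈ gr m) (h : m ≠ n) : proj gr n x = 0 :=
  DirectSum.decompose_of_mem_ne gr hx h

variable {gr} in
lemma map_proj {W : Type*} [AddCommGroup W] [Module k W] {gr' : ℤ → Submodule k W}
    [DirectSum.Decomposition gr'] {F : Type*} [FunLike F V W] [AddMonoidHomClass F V W] (f : F)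
    (m : ℤ) (hf : ∀ (n : ℤ) (x : V), x ∈ gr n → f x ∈ gr' (n + m)) (n : ℤ) (x : V) :
    f (proj gr n x) = proj gr' (n + m) (f x) := by
  induction x using hom_induction gr with
  | h0 => simp
  | hadd x y hx hy => simp only [map_add, hx, hy]
  | hom i x hx =>
    by_cases h : i = n
    · subst h
      rw [proj_of_mem gr hx, proj_of_mem gr' (hf i x hx)]
    · rw [proj_of_mem_ne gr hx h, proj_of_mem_ne gr' (hf i x hx) (by omega), map_zero]

end

/-- A family of subspaces which spans and admits projections is a grading. -/
noncomputable abbrev decompositionOfProj (p : ℤ → V →ₗ[k] V)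
    (h1 : ∀ (n : ℤ) (x : V), x ∈ gr n → p n x = x)
    (h2 : ∀ (m n : ℤ) (x : V), x ∈ gr m → m ≠ n → p n x = 0)
    (h3 : ∀ x : V, x ∈ ⨆ n, gr n) : DirectSum.Decomposition gr := by
  have key : DirectSum.IsInternal gr := by
    constructor
    · rw [injective_iff_map_eq_zero]
      intro x hx
      ext n
      have hp : ∀ y : ⨁ i, gr i,
          p n (DirectSum.coeAddMonoidHom gr y) = ((y n : gr n) : V) := by
        intro y
        induction y using DirectSum.induction_on with
        | zero => simp
        | add y z hy hz => rw [map_add, map_add, hy, hz]; rfl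
        | of i y =>
          rw [DirectSum.coeAddMonoidHom_of]
          by_cases h : i = n
          · subst h
            rw [h1 _ _ y.2, DirectSum.of_eq_same]
          · rw [h2 _ _ _ y.2 h, DirectSum.of_eq_of_ne _ _ _ (Ne.symm h)]
            rfl
      rw [← hp, hx, map_zero]
      rfl
    · intro x
      obtain ⟨y, hy⟩ := (Submodule.mem_iSup_iff_exists_dfinsupp gr x).1 (h3 x)
      exact ⟨y, hy⟩
  exact key.chooseDecomposition

end Grading

/-! ### Cohomology of complexes, elementwise -/

namespace Cpx

variable (V : Cpx k)

/-- Vanishing of the `n`-th cohomology, spelled out on elements. -/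
def ExactAt (n : ℤ) : Prop := ∀ x ∈ V.gr n, V.d x = 0 → ∃ y ∈ V.gr (n - 1), V.d y = x

variable {V}

lemma nontrivial_H_iff (n : ℤ) : Nontrivial (V.H n) ↔ ¬ V.ExactAt n := by
  rw [Submodule.Quotient.nontrivial_iff, not_iff_not]
  constructor
  · intro h x hx hd
    have : (⟨x, hd, hx⟩ : V.Z n) ∈ (V.B n).submoduleOf (V.Z n) := by rw [h]; trivial
    exact this
  · intro h
    rw [eq_top_iff]
    rintro ⟨x, hd, hx⟩ -
    exact h x hx hd

lemma supH_le {c : EReal} (h : ∀ n : ℤ, ¬ V.ExactAt n → (((n : ℤ) : ℝ) : EReal) ≤ c) :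
    V.supH ≤ c :=
  iSup_le fun n => h n ((nontrivial_H_iff _).1 n.2)

lemma le_supH {n : ℤ} (h : ¬ V.ExactAt n) : (((n : ℤ) : ℝ) : EReal) ≤ V.supH :=
  le_iSup (fun n : {n : ℤ // Nontrivial (V.H n)} => (((n : ℤ) : ℝ) : EReal))
    ⟨n, (nontrivial_H_iff _).2 h⟩

lemma infH_le {n : ℤ} (h : ¬ V.ExactAt n) : V.infH ≤ (((n : ℤ) : ℝ) : EReal) :=
  iInf_le (fun n : {n : ℤ // Nontrivial (V.H n)} => (((n : ℤ) : ℝ) : EReal))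
    ⟨n, (nontrivial_H_iff _).2 h⟩

lemma le_infH {c : EReal} (h : ∀ n : ℤ, ¬ V.ExactAt n → c ≤ (((n : ℤ) : ℝ) : EReal)) :
    c ≤ V.infH :=
  le_iInf fun n => h n ((nontrivial_H_iff _).1 n.2)

lemma coe_le_coe_iff {m n : ℤ} : (((m : ℤ) : ℝ) : EReal) ≤ (((n : ℤ) : ℝ) : EReal) ↔ m ≤ n := by
  rw [EReal.coe_le_coe_iff, Int.cast_le]

lemma infH_eq {p : ℤ} (hp : ¬ V.ExactAt p) (h : ∀ n < p, V.ExactAt n) :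
    V.infH = (((p : ℤ) : ℝ) : EReal) :=
  le_antisymm (infH_le hp) (le_infH fun n hn => coe_le_coe_iff.2 (by
    by_contra hlt
    exact hn (h n (by omega))))

lemma supH_eq {q : ℤ} (hq : ¬ V.ExactAt q) (h : ∀ n > q, V.ExactAt n) :
    V.supH = (((q : ℤ) : ℝ) : EReal) :=
  le_antisymm (supH_le fun n hn => coe_le_coe_iff.2 (by
    by_contra hlt
    exact hn (h n (by omega)))) (le_supH hq)

/-- A nonzero finite-dimensional cohomology has a lowest and a highest nonzero degree. -/
lemma exists_inf_sup (hfin : Module.Finite k V.totalH) (h : ∃ n, ¬ V.ExactAt n) :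
    ∃ p q : ℤ, (¬ V.ExactAt p ∧ ∀ n < p, V.ExactAt n) ∧ (¬ V.ExactAt q ∧ ∀ n > q, V.ExactAt n) := by
  classical
  obtain ⟨S, hS⟩ := hfin.fg_top
  have hsupp : {n : ℤ | ¬ V.ExactAt n} ⊆ ((S.biUnion fun s => DFinsupp.support s : Finset ℤ) :
      Set ℤ) := by
    intro n hn
    by_contra hnU
    have hz : ∀ x : V.totalH, x n = 0 := by
      intro x
      have hx : x ∈ Submodule.span k (S : Set V.totalH) := by rw [hS]; trivial
      have hle : Submodule.span k (S : Set V.totalH) ≤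
          LinearMap.ker (DirectSum.component k ℤ (fun n => V.H n) n) := by
        rw [Submodule.span_le]
        intro s hs
        by_contra hne
        exact hnU (Finset.mem_coe.2 (Finset.mem_biUnion.2 ⟨s, hs, DFinsupp.mem_support_iff.2 hne⟩))
      exact hle hx
    obtain ⟨x, hx⟩ := @exists_ne _ ((nontrivial_H_iff n).2 hn) (0 : V.H n)
    apply hx
    have := hz (DirectSum.of (fun n => V.H n) n x)
    rwa [DirectSum.of_eq_same] at this
  have hfinite : {n : ℤ | ¬ V.ExactAt n}.Finite := (Finset.finite_toSet _).subset hsupp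
  obtain ⟨p, hp, hp'⟩ := hfinite.exists_minimalFor id _ h
  obtain ⟨q, hq, hq'⟩ := hfinite.exists_maximalFor id _ h
  refine ⟨p, q, ⟨hp, fun n hn => ?_⟩, hq, fun n hn => ?_⟩
  · by_contra hne
    have := hp' hne hn.le
    simp only [id] at this
    omega
  · by_contra hne
    have := hq' hne (le_of_lt hn)
    simp only [id] at this
    omega

/-- Vanishing of cohomology passes to homotopy retracts. -/
lemma ExactAt.of_retract {V W : Cpx k} (f : V.carrier →ₗ[k] W.carrier)
    (g : W.carrier →ₗ[k] V.carrier)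
    (h : V.carrier →ₗ[k] V.carrier)
    (hf : ∀ n, ∀ x ∈ V.gr n, f x ∈ W.gr n) (hfd : ∀ x, f (V.d x) = W.d (f x))
    (hg : ∀ n, ∀ x ∈ W.gr n, g x ∈ V.gr n) (hgd : ∀ x, g (W.d x) = V.d (g x))
    (hh : ∀ n, ∀ x ∈ V.gr n, h x ∈ V.gr (n - 1))
    (hom : ∀ x, g (f x) - x = V.d (h x) + h (V.d x)) {n : ℤ} (hW : W.ExactAt n) :
    V.ExactAt n := by
  intro x hx hd
  obtain ⟨y, hy, hyd⟩ := hW (f x) (hf n x hx) (by rw [← hfd, hd, map_zero])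
  refine ⟨g y - h x, sub_mem (hg _ _ hy) (hh _ _ hx), ?_⟩
  have := hom x
  rw [hd, map_zero, add_zero] at this
  rw [map_sub, ← hgd, hyd, ← this, sub_sub_cancel]

end Cpx

variable {A : DGAlgebra k}

namespace DGModule

/-! ### Zero morphisms, direct sums and quotients of differential graded modules -/

/-- The zero morphism. -/
instance (M N : DGModule A) : Zero (M ⟶ N) :=
  ⟨⟨0, fun _ => zero_mem _, fun _ => (map_zero N.d).symm⟩⟩

@[simp] lemma lin_zero (M N : DGModule A) (x : M.carrier) : lin (0 : M ⟶ N) x = 0 := rfl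

lemma hom_ext' {M N : DGModule A} {f g : M ⟶ N} (h : ∀ x, lin f x = lin g x) : f = g :=
  Hom.ext (LinearMap.ext h)

/-- The zero differential graded module. -/
noncomputable def zeroModule (A : DGAlgebra k) : DGModule A where
  carrier := PUnit
  gr _ := ⊤
  d := 0
  d_mem _ := trivial
  d_d _ := rfl
  decomposition :=
    decompositionOfProj _ (fun _ => 0) (fun _ _ _ => rfl) (fun _ _ _ _ _ => rfl)
      (fun x => by rw [Subsingleton.elim x 0]; exact zero_mem _)
  smul_mem _ _ := trivial
  leibniz _ _ := rfl

section DirectSum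

variable {ι : Type u} [DecidableEq ι] (Y : ι → DGModule A)

lemma dfinsupp_induction_linear {β : ι → Type*} [∀ i, AddCommGroup (β i)]
    {p : (Π₀ i, β i) → Prop} (h0 : p 0) (hadd : ∀ x y, p x → p y → p (x + y))
    (hs : ∀ i x, p (DFinsupp.single i x)) (x) : p x :=
  DFinsupp.induction x h0 fun i b _ _ _ h => hadd _ _ (hs i b) h

/-- The direct sum of a family of differential graded modules. -/
noncomputable def directSum : DGModule A where
  carrier := Π₀ i, (Y i).carrier
  gr n :=
    { carrier := {x | ∀ i, x i ∈ (Y i).gr n}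
      zero_mem' := fun i => zero_mem _
      add_mem' := fun hx hy i => add_mem (hx i) (hy i)
      smul_mem' := fun c _ hx i => Submodule.smul_mem _ c (hx i) }
  d := DFinsupp.mapRange.linearMap fun i => (Y i).d
  d_mem hx i := (Y i).d_mem (hx i)
  d_d x := by
    ext i
    simp [(Y i).d_d]
  decomposition :=
    decompositionOfProj _ (fun n => DFinsupp.mapRange.linearMap fun i => proj (Y i).gr n)
      (fun n x hx => by
        ext i
        exact proj_of_mem _ (hx i))
      (fun m n x hx h => by
        ext i
        exact proj_of_mem_ne _ (hx i) h)
      (fun x => by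
        induction x using dfinsupp_induction_linear with
        | h0 => exact zero_mem _
        | hadd x y hx hy => exact add_mem hx hy
        | hs i x =>
          induction x using hom_induction (Y i).gr with
          | h0 => simp
          | hadd x y hx hy => rw [DFinsupp.single_add]; exact add_mem hx hy
          | hom n x hx =>
            refine Submodule.mem_iSup_of_mem n fun j => ?_
            by_cases h : i = j
            · subst h
              rwa [DFinsupp.single_eq_same]
            · rw [DFinsupp.single_eq_of_ne (Ne.symm h)]
              exact zero_mem _)
  smul_mem hx ha i := (Y i).smul_mem (hx i) ha
  leibniz {n x} a hx := by
    ext i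
    have := (Y i).leibniz a (hx i)
    simpa [Units.smul_def] using this

/-- The inclusion of a summand. -/
noncomputable def incl (i : ι) : Y i ⟶ directSum Y :=
  let f : (Y i).carrier →ₗ[A.carrierᵐᵒᵖ] Π₀ i, (Y i).carrier :=
    DFinsupp.lsingle (M := fun i => (Y i).carrier) i
  have hf : ∀ {n : ℤ} {x : (Y i).carrier}, x ∈ (Y i).gr n → ∀ j, f x j ∈ (Y j).gr n := by
    intro n x hx j
    change (DFinsupp.single i x : Π₀ i, (Y i).carrier) j ∈ (Y j).gr n
    by_cases h : i = j
    · subst h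
      rwa [DFinsupp.single_eq_same]
    · rw [DFinsupp.single_eq_of_ne (Ne.symm h)]
      exact zero_mem _
  { toLin := f
    map_mem := hf
    map_d := fun x => (DFinsupp.mapRange_single (f := fun i => (Y i).d)
      (hf := fun i => map_zero _) (i := i) (b := x)).symm }

/-- The projection onto a summand. -/
noncomputable def pr (i : ι) : directSum Y ⟶ Y i where
  toLin := DFinsupp.lapply i
  map_mem hx := hx i
  map_d _ := rfl

lemma lin_pr (i : ι) (x : (directSum Y).carrier) :
    lin (pr Y i) x = (show Π₀ i, (Y i).carrier from x) i := rfl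

lemma incl_pr_same (i : ι) : incl Y i ≫ pr Y i = 𝟙 _ :=
  hom_ext' fun x => DFinsupp.single_eq_same (β := fun i => (Y i).carrier) (i := i) (b := x)

lemma incl_pr_ne {i j : ι} (h : i ≠ j) : incl Y i ≫ pr Y j = 0 :=
  hom_ext' fun x =>
    DFinsupp.single_eq_of_ne (β := fun i => (Y i).carrier) (b := x) (Ne.symm h)

variable {Y}

lemma directSum_induction {p : (directSum Y).carrier → Prop} (h0 : p 0)
    (hadd : ∀ x y, p x → p y → p (x + y)) (hs : ∀ i x, p (lin (incl Y i) x)) (x) : p x :=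
  dfinsupp_induction_linear (p := p) h0 hadd hs x

/-- A family of maps of degree `m` out of the summands assembles to a map out of the direct sum. -/
lemma exists_desc_linear {N : DGModule A} (m : ℤ)
    (f : ∀ i, (Y i).carrier →ₗ[A.carrierᵐᵒᵖ] N.carrier)
    (hf : ∀ i n, ∀ x ∈ (Y i).gr n, f i x ∈ N.gr (n + m)) :
    ∃ g : (directSum Y).carrier →ₗ[A.carrierᵐᵒᵖ] N.carrier,
      (∀ n, ∀ x ∈ (directSum Y).gr n, g x ∈ N.gr (n + m)) ∧
      ∀ i x, g (lin (incl Y i) x) = f i x := by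
  refine ⟨DFinsupp.lsum ℕ f, fun n x hx => ?_, fun i x => DFinsupp.lsum_single ℕ f i x⟩
  exact dfinsuppSumAddHom_mem (β := fun i => (Y i).carrier) (N.gr (n + m)) x
    (fun i => (f i).toAddMonoidHom) fun i _ => hf i n _ (hx i)

lemma exists_desc {N : DGModule A} (f : ∀ i, Y i ⟶ N) :
    ∃ g : directSum Y ⟶ N, ∀ i, incl Y i ≫ g = f i := by
  obtain ⟨g, hg, hgi⟩ := exists_desc_linear 0 (fun i => lin (f i))
    (fun i n x hx => by rw [add_zero]; exact lin_mem _ hx)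
  refine ⟨⟨g, fun {n x} hx => by simpa using hg n x hx, fun x => ?_⟩, fun i => hom_ext' (hgi i)⟩
  induction x using directSum_induction with
  | h0 => simp
  | hadd x y hx hy => simp only [map_add, hx, hy]
  | hs i x => rw [← lin_d, hgi, hgi, lin_d]

/-- A family of morphisms which is pointwise finitely supported, on homogeneous elements, lifts to
the direct sum. -/
lemma exists_lift {N : DGModule A} (f : ∀ i, N ⟶ Y i)
    (hf : ∀ n, ∀ x ∈ N.gr n, {i | lin (f i) x ≠ 0}.Finite) :
    ∃ g : N ⟶ directSum Y, ∀ i, g ≫ pr Y i = f i := by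
  have hfin : ∀ x, {i | lin (f i) x ≠ 0}.Finite := by
    intro x
    induction x using hom_induction N.gr with
    | h0 => simp
    | hadd x y hx hy =>
      refine (hx.union hy).subset fun i hi => ?_
      by_contra hcon
      simp only [Set.mem_union, Set.mem_ofPred_eq, not_or, not_not] at hcon
      exact hi (by rw [map_add, hcon.1, hcon.2, add_zero])
    | hom n x hx => exact hf n x hx
  have key : ∀ x i, (DFinsupp.mk (hfin x).toFinset fun i => lin (f i) x :
      Π₀ i, (Y i).carrier) i = lin (f i) x := by
    intro x i
    rw [DFinsupp.mk_apply]
    split_ifs with h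
    · rfl
    · by_contra hne
      exact h ((hfin x).mem_toFinset.2 (Ne.symm hne))
  refine ⟨⟨⟨⟨fun x => (DFinsupp.mk (hfin x).toFinset fun i => lin (f i) x :
      Π₀ i, (Y i).carrier), fun x y => ?_⟩, fun a x => ?_⟩, fun {n x} hx i => ?_, fun x => ?_⟩,
      fun i => hom_ext' fun x => key x i⟩
  · refine DFinsupp.ext fun i => ?_
    exact (key _ i).trans ((map_add _ _ _).trans (congrArg₂ (· + ·) (key x i) (key y i)).symm)
  · refine DFinsupp.ext fun i => ?_
    exact (key _ i).trans ((map_smul _ _ _).trans (congrArg (a • ·) (key x i)).symm)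
  · exact (key x i).symm ▸ lin_mem (f i) hx
  · refine DFinsupp.ext fun i => ?_
    refine (key _ i).trans ((lin_d _ _).trans ?_)
    exact congrArg (Y i).d (key x i).symm

end DirectSum

section Quotient

variable (M : DGModule A) (N : Submodule A.carrierᵐᵒᵖ M.carrier)

/-- The map induced on a quotient by a `k`-linear map which preserves the submodule. -/
noncomputable def mapQuot (f : M.carrier →ₗ[k] M.carrier) (hf : ∀ x ∈ N, f x ∈ N) :
    (M.carrier ⧸ N) →ₗ[k] (M.carrier ⧸ N) :=
  (Submodule.Quotient.restrictScalarsEquiv k N).toLinearMap ∘ₗ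
    (N.restrictScalars k).mapQ (N.restrictScalars k) f hf ∘ₗ
      (Submodule.Quotient.restrictScalarsEquiv k N).symm.toLinearMap

lemma mapQuot_mk (f : M.carrier →ₗ[k] M.carrier) (hf : ∀ x ∈ N, f x ∈ N) (x : M.carrier) :
    mapQuot M N f hf (N.mkQ x) = N.mkQ (f x) := rfl

/-- The quotient of a differential graded module by a graded submodule stable under the
differential. -/
noncomputable def quot (hN : ∀ n, ∀ x ∈ N, proj M.gr n x ∈ N) (hd : ∀ x ∈ N, M.d x ∈ N) :
    DGModule A where
  carrier := M.carrier ⧸ N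
  gr n := (M.gr n).map (N.mkQ.restrictScalars k)
  d := mapQuot M N M.d hd
  d_mem := by
    rintro n _ ⟨x, hx, rfl⟩
    exact ⟨M.d x, M.d_mem hx, rfl⟩
  d_d x := by
    obtain ⟨x, rfl⟩ := N.mkQ_surjective x
    rw [mapQuot_mk, mapQuot_mk, M.d_d, map_zero]
  decomposition :=
    decompositionOfProj _ (fun n => mapQuot M N (proj M.gr n) (hN n))
      (by
        rintro n _ ⟨x, hx, rfl⟩
        exact (mapQuot_mk M N _ _ x).trans (congrArg N.mkQ (proj_of_mem _ hx)))
      (by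
        rintro m n _ ⟨x, hx, rfl⟩ h
        exact (mapQuot_mk M N _ _ x).trans
          ((congrArg N.mkQ (proj_of_mem_ne _ hx h)).trans (map_zero _)))
      (fun x => by
        obtain ⟨x, rfl⟩ := N.mkQ_surjective x
        induction x using hom_induction M.gr with
        | h0 => simp
        | hadd x y hx hy => rw [map_add]; exact add_mem hx hy
        | hom n x hx => exact Submodule.mem_iSup_of_mem n ⟨x, hx, rfl⟩)
  smul_mem := by
    rintro m n _ a ⟨x, hx, rfl⟩ ha
    exact ⟨op a • x, M.smul_mem hx ha, rfl⟩
  leibniz := by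
    rintro n _ a ⟨x, hx, rfl⟩
    change mapQuot M N M.d hd (N.mkQ (op a • x)) = op a • N.mkQ (M.d x) +
      n.negOnePow • (op (A.d a) • N.mkQ x)
    rw [mapQuot_mk, M.leibniz a hx, map_add, map_negOnePow_smul, map_smul, map_smul]

variable (hN : ∀ n, ∀ x ∈ N, proj M.gr n x ∈ N) (hd : ∀ x ∈ N, M.d x ∈ N)

/-- The projection to the quotient. -/
noncomputable def toQuot : M ⟶ quot M N hN hd where
  toLin := N.mkQ
  map_mem {_ x} hx := ⟨x, hx, rfl⟩
  map_d _ := rfl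

lemma toQuot_eq_zero {x : M.carrier} : lin (toQuot M N hN hd) x = 0 ↔ x ∈ N :=
  Submodule.Quotient.mk_eq_zero N

lemma toQuot_surjective {n : ℤ} {y : (quot M N hN hd).carrier} (hy : y ∈ (quot M N hN hd).gr n) :
    ∃ x ∈ M.gr n, lin (toQuot M N hN hd) x = y := hy

end Quotient

end DGModule

open DGModule

/-! ### Morphisms out of homotopically projective modules in the derived category -/

lemma isIso_toDer_map {M N : DGModule A} {f : M ⟶ N} (hf : QIso f) : IsIso ((toDer A).map f) :=
  Localization.inverts (qisHo A).Q (qisHo A) ((toHo A).map f) ⟨f, hf, rfl⟩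

lemma exists_eq_toDer_obj (X : DerCat A) : ∃ N : DGModule A, X = (toDer A).obj N := by
  obtain ⟨Y, rfl⟩ := (Localization.Construction.objEquiv (qisHo A)).surjective X
  exact ⟨Y.as, rfl⟩

section

variable {P : DGModule A}

lemma toHo_map_eq_iff {M N : DGModule A} {f g : M ⟶ N} :
    (toHo A).map f = (toHo A).map g ↔ Homotopic f g :=
  Quotient.functor_map_eq_iff (homotopyRel A) f g

/-- The functor `Hom_{H(A)}(P, -)` descends to the derived category when `P` is homotopically
projective. The universe lift makes it comparable with the morphisms of the localisation. -/
lemma IsHProjective.isInvertedBy (hP : IsHProjective P) : (qisHo A).IsInvertedBy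
    (coyoneda.obj (Opposite.op ((toHo A).obj P)) ⋙ uliftFunctor.{u+1, u}) := by
  rintro X Y f ⟨s, hs, rfl⟩
  have h : IsIso ((coyoneda.obj (Opposite.op ((toHo A).obj P))).map ((toHo A).map s)) := by
    rw [isIso_iff_bijective]
    exact hP s hs
  rw [Functor.comp_map]
  exact Functor.map_isIso _ _

/-- For `P` homotopically projective, `Hom_{H(A)}(P, N) → Hom_{D(A)}(P, N)` is bijective. The
functor `Hom_{H(A)}(P, -)` extends along the localisation functor `L`, and a Yoneda argument
with the class `x₀` of the identity identifies the extension with `Hom_{D(A)}(P, -)`. -/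
lemma IsHProjective.bijective_map (hP : IsHProjective P) (N : HoCat A) :
    Function.Bijective fun g : (toHo A).obj P ⟶ N => (qisHo A).Q.map g := by
  let L := (qisHo A).Q
  let E := coyoneda.obj (Opposite.op ((toHo A).obj P)) ⋙ uliftFunctor.{u+1, u}
  let H := coyoneda.obj (Opposite.op (L.obj ((toHo A).obj P)))
  let η : E ⟶ L ⋙ H :=
    { app := fun X => TypeCat.ofHom fun g => L.map g.down
      naturality := fun X Y f => by
        ext g
        exact L.map_comp g.down f }
  let G := Localization.lift E hP.isInvertedBy L
  let fac : L ⋙ G ≅ E := Localization.fac E hP.isInvertedBy L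
  let η' : G ⟶ H := Localization.liftNatTrans L (qisHo A) E (L ⋙ H) G H η
  have hη' : ∀ (X : HoCat A) (y : E.obj X), η'.app (L.obj X) (fac.inv.app X y) = L.map y.down := by
    intro X y
    have h1 : η'.app (L.obj X) = fac.hom.app X ≫ η.app X ≫ 𝟙 _ :=
      Localization.liftNatTrans_app L (qisHo A) E (L ⋙ H) G H η X
    rw [h1, Category.comp_id]
    change η.app X ((fac.inv.app X ≫ fac.hom.app X) y) = _
    rw [Iso.inv_hom_id_app]
    rfl
  let x₀ : G.obj (L.obj ((toHo A).obj P)) := fac.inv.app _ ⟨𝟙 _⟩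
  have hG : ∀ g : (toHo A).obj P ⟶ N, G.map (L.map g) x₀ = fac.inv.app N ⟨g⟩ := by
    intro g
    have h := congrArg (fun t => t (⟨𝟙 _⟩ : E.obj ((toHo A).obj P))) (fac.inv.naturality g)
    refine h.symm.trans ?_
    change fac.inv.app N ⟨𝟙 _ ≫ g⟩ = _
    rw [Category.id_comp]
  have hinj : Function.Injective (fac.inv.app N) := by
    have : IsIso (fac.inv.app N) := inferInstance
    exact ((isIso_iff_bijective _).1 this).1
  have hsurj : Function.Surjective (fac.inv.app N) := by
    have : IsIso (fac.inv.app N) := inferInstance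
    exact ((isIso_iff_bijective _).1 this).2
  constructor
  · intro g g' h
    have h' : L.map g = L.map g' := h
    have := hinj ((hG g).symm.trans ((by rw [h'] : G.map (L.map g) x₀ = _).trans (hG g')))
    exact congrArg ULift.down this
  · intro f
    obtain ⟨y, hy⟩ := hsurj (G.map f x₀)
    refine ⟨y.down, ?_⟩
    change L.map y.down = f
    rw [← hη', hy]
    have h := congrArg (fun t => t x₀) (η'.naturality f)
    refine h.trans ?_
    have hx : η'.app (L.obj ((toHo A).obj P)) x₀ = L.map (𝟙 _) := hη' _ ⟨𝟙 _⟩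
    refine (congrArg (H.map f) hx).trans ?_
    change L.map (𝟙 _) ≫ f = f
    rw [L.map_id, Category.id_comp]

lemma IsHProjective.exists_toDer_map (hP : IsHProjective P) {N : DGModule A}
    (f : (toDer A).obj P ⟶ (toDer A).obj N) : ∃ g : P ⟶ N, (toDer A).map g = f := by
  obtain ⟨g, hg⟩ := (hP.bijective_map ((toHo A).obj N)).2 f
  obtain ⟨g, rfl⟩ := (toHo A).map_surjective g
  exact ⟨g, hg⟩

lemma IsHProjective.homotopic_of_toDer_map (hP : IsHProjective P) {N : DGModule A} {f g : P ⟶ N}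
    (h : (toDer A).map f = (toDer A).map g) : Homotopic f g := by
  exact toHo_map_eq_iff.1 ((hP.bijective_map ((toHo A).obj N)).1 h)

lemma toDer_map_eq_of_homotopic {M N : DGModule A} {f g : M ⟶ N} (h : Homotopic f g) :
    (toDer A).map f = (toDer A).map g :=
  congrArg (qisHo A).Q.map (toHo_map_eq_iff.2 h)

lemma IsHProjective.exists_lift_homotopic (hP : IsHProjective P) {N N' : DGModule A} {s : N ⟶ N'}
    (hs : QIso s) (f : P ⟶ N') : ∃ g : P ⟶ N, Homotopic (g ≫ s) f := by
  obtain ⟨g, hg⟩ := (hP s hs).2 ((toHo A).map f)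
  obtain ⟨g, rfl⟩ := (toHo A).map_surjective g
  refine ⟨g, ?_⟩
  rwa [← toHo_map_eq_iff, Functor.map_comp]

lemma IsHProjective.homotopic_of_comp (hP : IsHProjective P) {N N' : DGModule A} {s : N ⟶ N'}
    (hs : QIso s) {f g : P ⟶ N} (h : Homotopic (f ≫ s) (g ≫ s)) : Homotopic f g := by
  rw [← toHo_map_eq_iff] at h ⊢
  rw [Functor.map_comp, Functor.map_comp] at h
  exact (hP s hs).1 h

/-- Two homotopically projective resolutions of the same module are homotopy equivalent. -/
lemma IsHProjective.exists_homotopyEquiv {P' M : DGModule A} (hP : IsHProjective P)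
    (hP' : IsHProjective P') {e : P ⟶ M} (he : QIso e) {e' : P' ⟶ M} (he' : QIso e') :
    ∃ (f : P ⟶ P') (g : P' ⟶ P), Homotopic (f ≫ g) (𝟙 P) ∧ Homotopic (g ≫ f) (𝟙 P') := by
  obtain ⟨f, hf⟩ := hP.exists_lift_homotopic he' e
  obtain ⟨g, hg⟩ := hP'.exists_lift_homotopic he e'
  refine ⟨f, g, hP.homotopic_of_comp he ?_, hP'.homotopic_of_comp he' ?_⟩ <;>
    rw [← toHo_map_eq_iff] at hf hg ⊢ <;>
    simp only [Functor.map_comp, Category.assoc, Category.id_comp] at hf hg ⊢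
  · rw [hg, hf]
  · rw [hf, hg]

end

/-! ### Zero objects and direct sums in the derived category -/

lemma isHProjective_zeroModule (A : DGAlgebra k) : IsHProjective (zeroModule A) := by
  have h : ∀ (N : DGModule A) (f g : (toHo A).obj (zeroModule A) ⟶ (toHo A).obj N), f = g := by
    intro N f g
    obtain ⟨f, rfl⟩ := (toHo A).map_surjective f
    obtain ⟨g, rfl⟩ := (toHo A).map_surjective g
    have : f = g := hom_ext' fun x => by
      rw [show x = 0 from rfl, map_zero, map_zero]
    rw [this]
  exact fun N N' s hs => ⟨fun f g _ => h _ _ _, fun f => ⟨(toHo A).map 0, h _ _ _⟩⟩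

lemma isZero_toDer_zeroModule (A : DGAlgebra k) : IsZero ((toDer A).obj (zeroModule A)) := by
  constructor
  · intro X
    obtain ⟨N, rfl⟩ := exists_eq_toDer_obj X
    refine ⟨⟨⟨(toDer A).map 0⟩, fun f => ?_⟩⟩
    obtain ⟨f, rfl⟩ := (isHProjective_zeroModule A).exists_toDer_map f
    exact congrArg (toDer A).map (hom_ext' fun x => by
      rw [show x = 0 from rfl, map_zero, map_zero])
  · intro X
    obtain ⟨N, rfl⟩ := exists_eq_toDer_obj X
    refine ⟨⟨⟨(toDer A).map 0⟩, fun f => ?_⟩⟩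
    have := isIso_toDer_map (Res.qiso_aug N)
    rw [← cancel_epi ((toDer A).map (Res.aug N))]
    obtain ⟨g, hg⟩ := (Res.hproj_res N).exists_toDer_map ((toDer A).map (Res.aug N) ≫ f)
    rw [← hg]
    change _ = (toDer A).map (Res.aug N) ≫ (toDer A).map 0
    rw [← Functor.map_comp]
    exact congrArg (toDer A).map (hom_ext' fun x => rfl)

/-- An acyclic module vanishes in the derived category. -/
lemma isZero_toDer_of_exactAt {M : DGModule A} (h : ∀ n, M.toCpx.ExactAt n) :
    IsZero ((toDer A).obj M) := by
  have hq : QIso (0 : M ⟶ zeroModule A) :=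
    Res.qiso_of (fun n y hy hd _ _ _ => h n y hy hd)
      fun n t _ _ => ⟨0, zero_mem _, map_zero _, rfl⟩
  have := isIso_toDer_map hq
  exact (isZero_toDer_zeroModule A).of_iso (asIso ((toDer A).map (0 : M ⟶ zeroModule A)))

section DirectSum

variable {ι : Type u} [DecidableEq ι]

lemma homotopic_of_incl {Y : ι → DGModule A} {N : DGModule A} {f g : directSum Y ⟶ N}
    (h : ∀ i, Homotopic (incl Y i ≫ f) (incl Y i ≫ g)) : Homotopic f g := by
  choose h hm hh using h
  obtain ⟨H, hH, hHi⟩ := exists_desc_linear (-1) h hm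
  refine ⟨H, hH, fun x => ?_⟩
  induction x using directSum_induction with
  | h0 => simp
  | hadd x y hx hy => simp only [map_add, add_sub_add_comm, hx, hy]; abel
  | hs i x =>
    have := hh i x
    rwa [lin_comp, lin_comp, ← hHi, ← hHi, lin_d] at this

lemma isHProjective_directSum {P : ι → DGModule A} (hP : ∀ i, IsHProjective (P i)) :
    IsHProjective (directSum P) := by
  intro N N' s hs
  constructor
  · intro f g h
    obtain ⟨f, rfl⟩ := (toHo A).map_surjective f
    obtain ⟨g, rfl⟩ := (toHo A).map_surjective g
    simp only [← Functor.map_comp] at h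
    rw [toHo_map_eq_iff] at h ⊢
    refine homotopic_of_incl fun i => (hP i).homotopic_of_comp hs ?_
    rw [Category.assoc, Category.assoc, ← toHo_map_eq_iff, Functor.map_comp,
      (toHo_map_eq_iff (f := f ≫ s)).2 h, ← Functor.map_comp]
  · intro f
    obtain ⟨f, rfl⟩ := (toHo A).map_surjective f
    choose g hg using fun i => (hP i).exists_lift_homotopic hs (incl P i ≫ f)
    obtain ⟨G, hG⟩ := exists_desc g
    refine ⟨(toHo A).map G, ?_⟩
    change (toHo A).map G ≫ (toHo A).map s = _
    rw [← Functor.map_comp, toHo_map_eq_iff]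
    refine homotopic_of_incl fun i => ?_
    rw [← Category.assoc, hG]
    exact hg i

/-- The direct sum of the canonical resolutions resolves the direct sum. -/
lemma exists_qiso_directSum_res (Y : ι → DGModule A) :
    ∃ s : directSum (fun i => Res.res (Y i)) ⟶ directSum Y, QIso s ∧
      ∀ i, incl (fun i => Res.res (Y i)) i ≫ s = Res.aug (Y i) ≫ incl Y i := by
  obtain ⟨s, hs⟩ := exists_desc fun i => Res.aug (Y i) ≫ incl Y i
  have hpr : ∀ i, s ≫ pr Y i = pr _ i ≫ Res.aug (Y i) := by
    intro i
    refine hom_ext' fun x => ?_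
    induction x using directSum_induction with
    | h0 => simp
    | hadd x y hx hy => simp only [map_add, hx, hy]
    | hs j x =>
      rw [← lin_comp, ← lin_comp, ← Category.assoc, ← Category.assoc, hs, Category.assoc]
      by_cases h : j = i
      · subst h
        rw [incl_pr_same, incl_pr_same, Category.comp_id, Category.id_comp]
      · rw [incl_pr_ne _ h, incl_pr_ne _ h]
        simp
  have hpr' : ∀ i x, lin (pr Y i) (lin s x) = lin (Res.aug (Y i)) (lin (pr _ i) x) := by
    intro i x
    rw [← lin_comp, hpr, lin_comp]
  refine ⟨s, Res.qiso_of (fun n y hy hd t ht hty => ?_) (fun n t ht hd => ?_), hs⟩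
  · let y' : Π₀ i, (Res.res (Y i)).carrier := y
    have h : ∀ i, ∃ z ∈ (Res.res (Y i)).gr (n - 1), (Res.res (Y i)).d z = y' i := fun i =>
      Res.qiso_inj (Res.qiso_aug (Y i)) (hy i) (by rw [← lin_pr, ← lin_d, hd, map_zero])
        (t := lin (pr Y i) t) (lin_mem _ ht) (by
          rw [← lin_d, hty, hpr', lin_pr])
    choose z hz hzd using h
    classical
    refine ⟨(DFinsupp.mk y'.support fun i => z i : Π₀ i, (Res.res (Y i)).carrier), fun i => ?_,
      DFinsupp.ext fun i => ?_⟩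
    · rw [DFinsupp.mk_apply]
      split_ifs
      · exact hz i
      · exact zero_mem _
    · change (Res.res (Y i)).d ((DFinsupp.mk y'.support fun i => z i :
        Π₀ i, (Res.res (Y i)).carrier) i) = y' i
      rw [DFinsupp.mk_apply]
      split_ifs with h
      · exact hzd i
      · rw [map_zero, DFinsupp.notMem_support_iff.1 h]
  · let t' : Π₀ i, (Y i).carrier := t
    have h : ∀ i, ∃ z ∈ (Res.res (Y i)).gr n, (Res.res (Y i)).d z = 0 ∧
        lin (Res.aug (Y i)) z = t' i := fun i =>
      Res.aug_surj (ht i) (by rw [← lin_pr, ← lin_d, hd, map_zero])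
    choose z hz hzd hzt using h
    classical
    refine ⟨(DFinsupp.mk t'.support fun i => z i : Π₀ i, (Res.res (Y i)).carrier), fun i => ?_,
      DFinsupp.ext fun i => ?_, DFinsupp.ext fun i => ?_⟩
    · rw [DFinsupp.mk_apply]
      split_ifs
      · exact hz i
      · exact zero_mem _
    · change (Res.res (Y i)).d ((DFinsupp.mk t'.support fun i => z i :
        Π₀ i, (Res.res (Y i)).carrier) i) = 0
      rw [DFinsupp.mk_apply]
      split_ifs with h
      · exact hzd i
      · exact map_zero _
    · refine (hpr' i _).trans ?_
      change lin (Res.aug (Y i)) ((DFinsupp.mk t'.support fun i => z i :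
        Π₀ i, (Res.res (Y i)).carrier) i) = t' i
      rw [DFinsupp.mk_apply]
      split_ifs with h
      · exact hzt i
      · rw [map_zero, DFinsupp.notMem_support_iff.1 h]

lemma toDer_hom_ext_directSum {Y : ι → DGModule A} {N : DerCat A}
    {f g : (toDer A).obj (directSum Y) ⟶ N}
    (h : ∀ i, (toDer A).map (incl Y i) ≫ f = (toDer A).map (incl Y i) ≫ g) : f = g := by
  obtain ⟨N, rfl⟩ := exists_eq_toDer_obj N
  obtain ⟨s, hs, hsi⟩ := exists_qiso_directSum_res Y
  have := isIso_toDer_map hs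
  rw [← cancel_epi ((toDer A).map s)]
  have hP : IsHProjective (directSum fun i => Res.res (Y i)) :=
    isHProjective_directSum fun i => Res.hproj_res (Y i)
  obtain ⟨a, ha⟩ := hP.exists_toDer_map ((toDer A).map s ≫ f)
  obtain ⟨b, hb⟩ := hP.exists_toDer_map ((toDer A).map s ≫ g)
  rw [← ha, ← hb]
  refine toDer_map_eq_of_homotopic (homotopic_of_incl fun i =>
    (Res.hproj_res (Y i)).homotopic_of_toDer_map ?_)
  rw [Functor.map_comp, Functor.map_comp, ha, hb, ← Category.assoc, ← Category.assoc,
    ← Functor.map_comp, hsi, Functor.map_comp, Category.assoc, Category.assoc, h i]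

/-- The direct sum, as a cofan in the derived category. -/
noncomputable abbrev directSumCofan (Y : ι → DGModule A) : Cofan fun i => (toDer A).obj (Y i) :=
  Cofan.mk ((toDer A).obj (directSum Y)) fun i => (toDer A).map (incl Y i)

/-- Direct sums of differential graded modules are coproducts in the derived category. -/
lemma nonempty_isColimit_directSumCofan (Y : ι → DGModule A) :
    Nonempty (IsColimit (directSumCofan Y)) := by
  have key : ∀ t : Cofan fun i => (toDer A).obj (Y i),
      ∃ f : (toDer A).obj (directSum Y) ⟶ t.pt, ∀ i, (toDer A).map (incl Y i) ≫ f = t.inj i := by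
    intro t
    obtain ⟨N, hN⟩ := exists_eq_toDer_obj t.pt
    obtain ⟨s, hs, hsi⟩ := exists_qiso_directSum_res Y
    have := isIso_toDer_map hs
    choose g hg using fun i => (Res.hproj_res (Y i)).exists_toDer_map
      ((toDer A).map (Res.aug (Y i)) ≫ t.inj i ≫ eqToHom hN)
    obtain ⟨G, hG⟩ := exists_desc g
    refine ⟨inv ((toDer A).map s) ≫ (toDer A).map G ≫ eqToHom hN.symm, fun i => ?_⟩
    have := isIso_toDer_map (Res.qiso_aug (Y i))
    rw [← cancel_epi ((toDer A).map (Res.aug (Y i))), ← Category.assoc, ← Functor.map_comp, ← hsi,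
      Functor.map_comp, Category.assoc, IsIso.hom_inv_id_assoc, ← Category.assoc,
      ← Functor.map_comp, hG, hg]
    simp
  choose f hf using key
  exact ⟨Cofan.IsColimit.mk _ f (fun t i => hf t i)
    fun t m hm => toDer_hom_ext_directSum fun i => (hm i).trans (hf t i).symm⟩

/-- A morphism from a compact object to a direct sum has only finitely many nonzero components. -/
lemma finite_components_of_isCompactObj {M : DGModule A} (hM : IsCompactObj ((toDer A).obj M))
    (Y : ι → DGModule A) (f : (toDer A).obj M ⟶ (toDer A).obj (directSum Y)) :
    {i | f ≫ (toDer A).map (pr Y i) ≠ (toDer A).map 0}.Finite := by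
  obtain ⟨hc⟩ := nonempty_isColimit_directSumCofan Y
  obtain ⟨S, c', hc', g, hg⟩ := hM ι _ _ hc f
  refine S.finite_toSet.subset fun i hi => ?_
  by_contra hiS
  apply hi
  have hZ := isZero_toDer_zeroModule A
  have hzero : ∀ N N' : DGModule A, (toDer A).map (0 : N ⟶ N') = hZ.from_ _ ≫ hZ.to_ _ := by
    intro N N'
    have h1 : (0 : N ⟶ N') = (0 : N ⟶ zeroModule A) ≫ 0 := hom_ext' fun x => rfl
    rw [h1, Functor.map_comp]
    exact congrArg₂ _ (hZ.eq_of_tgt _ _) (hZ.eq_of_src _ _)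
  rw [← hg, Category.assoc, hzero]
  have h2 : Cofan.IsColimit.desc hc' (fun i => (directSumCofan Y).inj i) ≫ (toDer A).map (pr Y i) =
      hZ.from_ _ ≫ hZ.to_ _ := by
    refine Cofan.IsColimit.hom_ext hc' _ _ fun j => ?_
    rw [← Category.assoc, Cofan.IsColimit.fac, ← Category.assoc, hZ.eq_of_tgt (c'.inj j ≫ _)
      (hZ.from_ _), ← hzero]
    change (toDer A).map (incl Y j) ≫ (toDer A).map (pr Y i) = _
    rw [← Functor.map_comp, incl_pr_ne _ (fun h : (j : ι) = i => hiS (h ▸ j.2))]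
  rw [h2, ← Category.assoc]
  exact congrArg (· ≫ _) (hZ.eq_of_tgt _ _)

end DirectSum

/-! ### Compact objects have bounded below cohomology -/

namespace DGModule

/-- The elements of `M` whose components of degree less than `c` vanish; a submodule since `A` is
nonnegatively graded. -/
noncomputable def degreeGE (hA : ∀ n < 0, A.gr n = ⊥) (M : DGModule A) (c : ℤ) :
    Submodule A.carrierᵐᵒᵖ M.carrier where
  carrier := {x | ∀ m < c, proj M.gr m x = 0}
  zero_mem' := fun m _ => map_zero _
  add_mem' := fun hx hy m hm => by rw [map_add, hx m hm, hy m hm, add_zero]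
  smul_mem' := by
    classical
    intro a x hx m hm
    rw [← DirectSum.sum_support_decompose M.gr x, Finset.smul_sum, map_sum]
    refine Finset.sum_eq_zero fun n hn => ?_
    have hnc : c ≤ n := by
      by_contra hlt
      rw [DFinsupp.mem_support_iff, ne_eq, ← Submodule.coe_eq_zero] at hn
      exact hn (hx n (by omega))
    obtain ⟨a, rfl⟩ := MulOpposite.op_surjective a
    induction a using hom_induction A.gr with
    | h0 => simp
    | hadd a b ha hb => rw [MulOpposite.op_add, add_smul, map_add, ha, hb, add_zero]
    | hom i a ha =>
      by_cases hi : i < 0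
      · rw [hA i hi, Submodule.mem_bot] at ha
        rw [ha, MulOpposite.op_zero, zero_smul, map_zero]
      · exact proj_of_mem_ne _ (M.smul_mem (DirectSum.decompose M.gr x n).2 ha) (by omega)

variable (hA : ∀ n < 0, A.gr n = ⊥) (M : DGModule A)

lemma mem_degreeGE {c n : ℤ} {x : M.carrier} (hx : x ∈ M.gr n) (h : c ≤ n) :
    x ∈ degreeGE hA M c := fun m hm => proj_of_mem_ne _ hx (by omega)

lemma eq_zero_of_mem_degreeGE {c n : ℤ} {x : M.carrier} (hx : x ∈ M.gr n) (h : n < c)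
    (hx' : x ∈ degreeGE hA M c) : x = 0 := by
  rw [← proj_of_mem _ hx, hx' n h]

/-- The quotient of `M` by its part in degrees at least `c`. -/
noncomputable def truncLT (c : ℤ) : DGModule A :=
  quot M (degreeGE hA M c)
    (fun n x hx m hm => by
      by_cases h : n = m
      · subst h
        rw [hx n hm, map_zero]
      · exact proj_of_mem_ne _ (proj_mem _ n x) h)
    (fun x hx m hm => by
      have h := map_proj (gr' := M.gr) M.d 1 (fun _ _ h => M.d_mem h) (m - 1) x
      rw [hx (m - 1) (by omega), map_zero, sub_add_cancel] at h
      exact h.symm)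

/-- The projection of `M` to `truncLT`. -/
noncomputable def toTruncLT (c : ℤ) : M ⟶ truncLT hA M c := toQuot M _ _ _

lemma toTruncLT_eq_zero {c : ℤ} {x : M.carrier} :
    lin (toTruncLT hA M c) x = 0 ↔ x ∈ degreeGE hA M c := toQuot_eq_zero _ _ _ _

end DGModule

/-- A morphism which vanishes in the derived category sends cocycles to coboundaries. -/
lemma exists_d_eq_of_toDer_map_eq_zero {M N : DGModule A} {f : M ⟶ N}
    (h : (toDer A).map f = (toDer A).map 0) {n : ℤ} {x : M.carrier} (hx : x ∈ M.gr n)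
    (hd : M.d x = 0) : ∃ y ∈ N.gr (n - 1), N.d y = lin f x := by
  have h' : (toDer A).map (Res.aug M ≫ f) = (toDer A).map 0 := by
    rw [Functor.map_comp, h, ← Functor.map_comp]
    exact congrArg (toDer A).map (hom_ext' fun x => rfl)
  obtain ⟨s, hs, hsd⟩ := (Res.hproj_res M).homotopic_of_toDer_map h'
  obtain ⟨z, hz, hzd, rfl⟩ := Res.aug_surj hx hd
  refine ⟨s z, hs _ _ hz, ?_⟩
  have := hsd z
  have hzd' : (Res.res M).d z = 0 := hzd
  rw [hzd', map_zero, add_zero] at this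
  exact this.symm.trans (sub_zero _)

/-- A compact object has cohomology bounded below: its projections to all truncations form a
morphism to a direct sum, almost all of whose components must vanish. -/
lemma exists_bound_of_isCompactObj (hA : ∀ n < 0, A.gr n = ⊥) {M : DGModule A}
    (hM : IsCompactObj ((toDer A).obj M)) : ∃ b : ℤ, ∀ n < b, M.toCpx.ExactAt n := by
  classical
  let Y : ULift.{u} ℕ → DGModule A := fun n => truncLT hA M (-(n.down : ℤ))
  -- An element of degree `m` survives only in the quotients by degrees `≥ -n` with `n < -m`.
  obtain ⟨f, hf⟩ := exists_lift (Y := Y) (fun n => toTruncLT hA M (-(n.down : ℤ))) (by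
    intro m x hx
    refine (Set.Finite.preimage (f := ULift.down) (ULift.down_injective.injOn)
      (Set.finite_lt_nat (-m).toNat)).subset fun n hn => ?_
    by_contra hcon
    refine hn ((toTruncLT_eq_zero hA M).2 (mem_degreeGE hA M hx ?_))
    simp only [Set.mem_preimage, Set.mem_ofPred_eq] at hcon
    omega)
  have hfin := finite_components_of_isCompactObj hM Y ((toDer A).map f)
  obtain ⟨n, hn⟩ := hfin.infinite_compl.nonempty
  simp only [Set.mem_compl_iff, Set.mem_ofPred_eq, not_not] at hn
  rw [← Functor.map_comp, hf] at hn
  refine ⟨-(n.down : ℤ), fun m hm x hx hd => ?_⟩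
  obtain ⟨y, hy, hyd⟩ := exists_d_eq_of_toDer_map_eq_zero hn hx hd
  obtain ⟨y, hy', rfl⟩ := toQuot_surjective _ _ _ _ hy
  refine ⟨y, hy', ?_⟩
  have h0 : lin (toTruncLT hA M (-(n.down : ℤ))) (M.d y - x) = 0 := by
    rw [map_sub, sub_eq_zero, ← hyd]
    exact lin_d _ _
  have hmem : M.d y - x ∈ M.gr m := sub_mem (by simpa using M.d_mem hy') hx
  exact sub_eq_zero.1 (eq_zero_of_mem_degreeGE hA M hmem hm ((toTruncLT_eq_zero hA M).1 h0))

/-! ### Semifree modules whose differential lowers the degree of the basis -/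

section Free

variable {ι : Type u}

/-- The linear extension of a map on the basis of a free module. -/
noncomputable def freeExt {T : Type u} [AddCommGroup T] [Module A.carrierᵐᵒᵖ T] (v : ι → T) :
    (ι →₀ A.carrier) →ₗ[A.carrierᵐᵒᵖ] T :=
  Finsupp.lsum ℕ fun i =>
    { toFun := fun a => op a • v i
      map_add' := fun a b => by rw [MulOpposite.op_add, add_smul]
      map_smul' := fun r a => by
        rw [RingHom.id_apply, smul_smul]
        rfl }

@[simp] lemma freeExt_single {T : Type u} [AddCommGroup T] [Module A.carrierᵐᵒᵖ T] (v : ι → T)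
    (i : ι) (a : A.carrier) : freeExt v (Finsupp.single i a) = op a • v i := by
  simp [freeExt]

lemma free_op_smul_single (i : ι) (a c : A.carrier) :
    op a • (Finsupp.single i c : ι →₀ A.carrier) = Finsupp.single i (c * a) := by
  rw [Finsupp.smul_single]
  rfl

lemma free_negOnePow_smul_single (n : ℤ) (i : ι) (a : A.carrier) :
    (Finsupp.single i (n.negOnePow • a) : ι →₀ A.carrier) = n.negOnePow • Finsupp.single i a :=
  map_negOnePow_smul (Finsupp.singleAddHom i) n a

lemma freeExt_apply {T : Type u} [AddCommGroup T] [Module A.carrierᵐᵒᵖ T] (v : ι → T)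
    (x : ι →₀ A.carrier) : freeExt v x = ∑ i ∈ x.support, op (x i) • v i := by
  conv_lhs => rw [← Finsupp.sum_single x]
  rw [Finsupp.sum, map_sum]
  simp

variable (deg : ι → ℤ) (bd : ι → ι →₀ A.carrier)

/-- The derivation of the free module which takes the values `bd` on the basis. -/
noncomputable def freeD : (ι →₀ A.carrier) →ₗ[k] (ι →₀ A.carrier) :=
  (freeExt bd).restrictScalars k +
    Finsupp.lsum k fun i : ι => (((deg i).negOnePow : ℤˣ) : ℤ) • (Finsupp.lsingle i ∘ₗ A.d)

lemma freeD_single (i : ι) (c : A.carrier) : freeD deg bd (Finsupp.single i c) =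
    op c • bd i + (deg i).negOnePow • (Finsupp.single i (A.d c) : ι →₀ A.carrier) := by
  simp [freeD, Units.smul_def]

variable {deg bd} in
lemma freeD_apply {x : ι →₀ A.carrier} {i : ι} (h : ∀ j, x j ≠ 0 → bd j i = 0) :
    freeD deg bd x i = (deg i).negOnePow • A.d (x i) := by
  classical
  conv_lhs => rw [← Finsupp.sum_single x]
  conv_rhs => rw [← Finsupp.sum_single x]
  rw [Finsupp.sum, map_sum, Finsupp.finsetSum_apply, Finsupp.finsetSum_apply, map_sum,
    Finset.smul_sum]
  refine Finset.sum_congr rfl fun j hj => ?_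
  rw [freeD_single, Finsupp.add_apply, Finsupp.smul_apply, h j (Finsupp.mem_support_iff.1 hj),
    smul_zero, zero_add, ← free_negOnePow_smul_single, Finsupp.single_apply, Finsupp.single_apply]
  split_ifs with h
  · rw [h]
  · rw [map_zero, smul_zero]

variable (A) in
/-- The degree `n` part of the free module on generators of degrees `deg`. -/
def freeGr (n : ℤ) : Submodule k (ι →₀ A.carrier) where
  carrier := {x | ∀ i, x i ∈ A.gr (n - deg i)}
  zero_mem' := fun _ => zero_mem _
  add_mem' := fun hx hy i => add_mem (hx i) (hy i)
  smul_mem' := fun c _ hx i => Submodule.smul_mem _ c (hx i)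

variable {deg bd}

lemma single_mem_freeGr {n : ℤ} {i : ι} {c : A.carrier} (hc : c ∈ A.gr (n - deg i)) :
    (Finsupp.single i c : ι →₀ A.carrier) ∈ freeGr A deg n := by
  classical
  intro j
  rw [Finsupp.single_apply]
  split_ifs with h
  · rwa [← h]
  · exact zero_mem _

lemma single_one_mem_freeGr (i : ι) :
    (Finsupp.single i 1 : ι →₀ A.carrier) ∈ freeGr A deg (deg i) :=
  single_mem_freeGr (by rw [sub_self]; exact SetLike.GradedOne.one_mem)

lemma freeGr_induction {n : ℤ} {Q : (ι →₀ A.carrier) → Prop} (h0 : Q 0)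
    (hadd : ∀ x y, Q x → Q y → Q (x + y))
    (hs : ∀ i c, c ∈ A.gr (n - deg i) → Q (Finsupp.single i c)) {x : ι →₀ A.carrier}
    (hx : x ∈ freeGr A deg n) : Q x := by
  rw [← Finsupp.sum_single x]
  exact Finset.sum_induction _ Q hadd h0 fun i _ => hs i _ (hx i)

lemma freeGr_smul_mem {m n : ℤ} {x : ι →₀ A.carrier} {a : A.carrier} (hx : x ∈ freeGr A deg m)
    (ha : a ∈ A.gr n) : op a • x ∈ freeGr A deg (m + n) := by
  intro i
  have h := SetLike.mul_mem_graded (hx i) ha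
  rw [show m - deg i + n = m + n - deg i by ring] at h
  exact h

lemma freeD_mem (hbd : ∀ i, bd i ∈ freeGr A deg (deg i + 1)) {n : ℤ} {x : ι →₀ A.carrier}
    (hx : x ∈ freeGr A deg n) : freeD deg bd x ∈ freeGr A deg (n + 1) := by
  refine freeGr_induction (Q := fun x => freeD deg bd x ∈ freeGr A deg (n + 1)) (by simp) ?_ ?_ hx
  · intro x y hx hy
    rw [map_add]
    exact add_mem hx hy
  · intro i c hc
    rw [freeD_single]
    refine add_mem ?_ (negOnePow_smul_mem _ _ (single_mem_freeGr ?_))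
    · have h := freeGr_smul_mem (hbd i) hc
      rwa [show deg i + 1 + (n - deg i) = n + 1 by ring] at h
    · have h := A.d_mem hc
      rwa [show n - deg i + 1 = n + 1 - deg i by ring] at h

lemma freeD_leibniz {n : ℤ} {x : ι →₀ A.carrier} (a : A.carrier) (hx : x ∈ freeGr A deg n) :
    freeD deg bd (op a • x) = op a • freeD deg bd x + n.negOnePow • (op (A.d a) • x) := by
  refine freeGr_induction (Q := fun x => freeD deg bd (op a • x) = op a • freeD deg bd x +
      n.negOnePow • (op (A.d a) • x)) (by simp) ?_ ?_ hx
  · intro x y hx hy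
    simp only [smul_add, map_add, hx, hy]
    abel
  · intro i c hc
    rw [free_op_smul_single, freeD_single, freeD_single, A.leibniz a hc, MulOpposite.op_mul,
      mul_smul, smul_add, Finsupp.single_add, Res.op_smul_negOnePow, free_negOnePow_smul_single,
      smul_add, negOnePow_smul_smul, free_op_smul_single,
      free_op_smul_single, add_sub_cancel, add_assoc]

/-- The decomposition of the free module into homogeneous components. -/
noncomputable instance : DirectSum.Decomposition (freeGr A deg) :=
  have key : ∀ (n : ℤ) (x : ι →₀ A.carrier) (i : ι), Finsupp.lsum k (fun i : ι =>
      (Finsupp.lsingle i : A.carrier →ₗ[k] ι →₀ A.carrier) ∘ₗ proj A.gr (n - deg i)) x i =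
        proj A.gr (n - deg i) (x i) := by
    classical
    intro n x i
    induction x using Finsupp.induction_linear with
    | zero => simp
    | add x y hx hy => rw [map_add, Finsupp.add_apply, hx, hy, Finsupp.add_apply, map_add]
    | single j c =>
      rw [Finsupp.lsum_single, LinearMap.comp_apply, Finsupp.lsingle_apply, Finsupp.single_apply,
        Finsupp.single_apply]
      split_ifs with h
      · rw [h]
      · rw [map_zero]
  decompositionOfProj _ (fun n => Finsupp.lsum k (fun i : ι =>
      (Finsupp.lsingle i : A.carrier →ₗ[k] ι →₀ A.carrier) ∘ₗ proj A.gr (n - deg i)))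
    (fun n x hx => by
      ext i
      rw [key, proj_of_mem _ (hx i)])
    (fun m n x hx h => by
      ext i
      rw [key, proj_of_mem_ne _ (hx i) (by omega)]
      rfl)
    (fun x => by
      induction x using Finsupp.induction_linear with
      | zero => exact zero_mem _
      | add x y hx hy => exact add_mem hx hy
      | single i c =>
        induction c using hom_induction A.gr with
        | h0 => simp
        | hadd x y hx hy => rw [Finsupp.single_add]; exact add_mem hx hy
        | hom n c hc =>
          exact Submodule.mem_iSup_of_mem (n + deg i) (single_mem_freeGr (by simpa using hc)))

end Free

variable (A) in
/-- Data for a semifree module: a graded basis and the values of the differential on it, such that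
the differential of a basis element only involves basis elements of smaller degree. -/
structure SemiBasis where
  /-- The index set of the basis. -/
  ι : Type u
  /-- The degrees of the basis elements. -/
  deg : ι → ℤ
  /-- The differentials of the basis elements. -/
  bd : ι → ι →₀ A.carrier
  bd_mem : ∀ i, bd i ∈ freeGr A deg (deg i + 1)
  bd_bd : ∀ i, freeD deg bd (bd i) = 0
  bd_eq_zero : ∀ i j, deg i ≤ deg j → bd i j = 0

namespace SemiBasis

variable (S : SemiBasis A)

/-- The free module on the basis. -/
abbrev Carrier : Type u := S.ι →₀ A.carrier

/-- The differential. -/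
noncomputable abbrev D : S.Carrier →ₗ[k] S.Carrier := freeD S.deg S.bd

/-- The grading. -/
abbrev gr (n : ℤ) : Submodule k S.Carrier := freeGr A S.deg n

variable {S}

lemma D_D (x : S.Carrier) : S.D (S.D x) = 0 := by
  induction x using Finsupp.induction_linear with
  | zero => simp
  | add x y hx hy => rw [map_add, map_add, hx, hy, add_zero]
  | single i c =>
    rw [freeD_single, map_add, freeD_leibniz c (S.bd_mem i), S.bd_bd, map_negOnePow_smul,
      freeD_single, A.d_d, Int.negOnePow_succ]
    simp

lemma D_single_one (i : S.ι) : S.D (Finsupp.single i 1) = S.bd i := by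
  rw [freeD_single, Res.d_one]
  simp

variable (S) in
/-- The semifree module on a semibasis. -/
noncomputable def toModule : DGModule A where
  carrier := S.Carrier
  gr := S.gr
  d := S.D
  d_mem := freeD_mem S.bd_mem
  d_d := D_D
  smul_mem := freeGr_smul_mem
  leibniz := freeD_leibniz

/-- Maps on a semifree module with prescribed relations between the values on each basis element
and on its differential, by recursion on the degree. -/
lemma exists_ext {b : ℤ} (hb : ∀ i, b ≤ S.deg i) {T : Type u} [AddCommGroup T]
    [Module A.carrierᵐᵒᵖ T] (R : S.ι → T → T → Prop) : ∃ v : S.Carrier →ₗ[A.carrierᵐᵒᵖ] T,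
      ∀ i, (∃ t, R i (v (S.bd i)) t) → R i (v (S.bd i)) (v (Finsupp.single i 1)) := by
  classical
  let rank : S.ι → ℕ := fun i => (S.deg i - b).toNat
  let ch : S.ι → T → T := fun i w => if h : ∃ t, R i w t then h.choose else 0
  let G : ∀ i, (∀ j, rank j < rank i → T) → T := fun i rec =>
    ch i (∑ j ∈ (S.bd i).support, if h : rank j < rank i then op (S.bd i j) • rec j h else 0)
  let v : S.ι → T := (measure rank).wf.fix G
  have hv : ∀ i, v i = G i fun j _ => v j := fun i => WellFounded.fix_eq _ G i
  refine ⟨freeExt v, fun i h => ?_⟩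
  have hw : (∑ j ∈ (S.bd i).support, if _ : rank j < rank i then op (S.bd i j) • v j else 0) =
      freeExt v (S.bd i) := by
    rw [freeExt_apply]
    refine Finset.sum_congr rfl fun j hj => dif_pos ?_
    have h1 : S.deg j < S.deg i := by
      by_contra hle
      exact Finsupp.mem_support_iff.1 hj (S.bd_eq_zero i j (by omega))
    have := hb j
    simp only [rank]
    omega
  rw [freeExt_single, MulOpposite.op_one, one_smul]
  have hG : v i = ch i (freeExt v (S.bd i)) := by
    rw [← hw]
    exact hv i
  rw [hG]
  simp only [ch]
  rw [dif_pos h]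
  exact h.choose_spec

/-- Induction for properties of homogeneous elements: a property of a basis element may be deduced
from the property of its differential. -/
lemma basis_induction {b : ℤ} (hb : ∀ i, b ≤ S.deg i) {E : S.ι → Prop} {Q : ℤ → S.Carrier → Prop}
    (h0 : ∀ n, Q n 0) (hadd : ∀ n x y, Q n x → Q n y → Q n (x + y))
    (hmul : ∀ n i c, c ∈ A.gr (n - S.deg i) → E i → Q n (Finsupp.single i c))
    (hstep : ∀ i, Q (S.deg i + 1) (S.bd i) → E i) {n : ℤ} {x : S.Carrier} (hx : x ∈ S.gr n) :
    Q n x := by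
  have hE : ∀ (m : ℕ) (i : S.ι), S.deg i < b + m → E i := by
    intro m
    induction m with
    | zero =>
      intro i hi
      have := hb i
      simp at hi
      omega
    | succ m ih =>
      intro i hi
      apply hstep
      rw [← Finsupp.sum_single (S.bd i)]
      refine Finset.sum_induction _ (Q _) (hadd _) (h0 _) fun j hj =>
        hmul _ _ _ (S.bd_mem i j) (ih j ?_)
      by_contra hle
      push_cast at hi
      exact Finsupp.mem_support_iff.1 hj (S.bd_eq_zero i j (by omega))
  exact freeGr_induction (h0 n) (hadd n)
    (fun i c hc => hmul n i c hc (hE (S.deg i - b + 1).toNat i (by omega))) hx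

/-- Morphisms out of a semifree module lift through quasi-isomorphisms up to homotopy. The lift and
the homotopy are the two components of one map, constructed by recursion on the degree. -/
lemma hproj_surj {b : ℤ} (hb : ∀ i, b ≤ S.deg i) {N N' : DGModule A} (s : N ⟶ N')
    (hs : QIso s) (f : S.toModule ⟶ N') :
    ∃ g : S.toModule ⟶ N, Homotopic (g ≫ s) f := by
  let f' : S.Carrier →ₗ[A.carrierᵐᵒᵖ] N'.carrier := lin f
  have hfm : ∀ {n : ℤ} {x : S.Carrier}, x ∈ S.gr n → f' x ∈ N'.gr n := fun h => lin_mem f h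
  have hfd : ∀ x : S.Carrier, f' (S.D x) = N'.d (f' x) := lin_d f
  obtain ⟨v, hv⟩ := exists_ext hb (T := N.carrier × N'.carrier) fun i w v =>
    v.1 ∈ N.gr (S.deg i) ∧ v.2 ∈ N'.gr (S.deg i - 1) ∧ N.d v.1 = w.1 ∧
      lin s v.1 - f' (Finsupp.single i 1) = N'.d v.2 + w.2
  have main : ∀ {n : ℤ} {x : S.Carrier}, x ∈ S.gr n → (v x).1 ∈ N.gr n ∧ (v x).2 ∈ N'.gr (n - 1) ∧
      N.d (v x).1 = (v (S.D x)).1 ∧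
      lin s (v x).1 - f' x = N'.d (v x).2 + (v (S.D x)).2 := by
    intro n x hx
    refine basis_induction hb
      (E := fun i => (v (Finsupp.single i 1)).1 ∈ N.gr (S.deg i) ∧
        (v (Finsupp.single i 1)).2 ∈ N'.gr (S.deg i - 1) ∧
        N.d (v (Finsupp.single i 1)).1 = (v (S.bd i)).1 ∧
        lin s (v (Finsupp.single i 1)).1 - f' (Finsupp.single i 1) =
          N'.d (v (Finsupp.single i 1)).2 + (v (S.bd i)).2)
      (Q := fun n x => (v x).1 ∈ N.gr n ∧ (v x).2 ∈ N'.gr (n - 1) ∧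
        N.d (v x).1 = (v (S.D x)).1 ∧
        lin s (v x).1 - f' x = N'.d (v x).2 + (v (S.D x)).2) ?_ ?_ ?_ ?_ hx
    · intro n
      simp
    · rintro n x y ⟨h1, h2, h3, h4⟩ ⟨h1', h2', h3', h4'⟩
      refine ⟨?_, ?_, ?_, ?_⟩
      · rw [map_add]; exact add_mem h1 h1'
      · rw [map_add]; exact add_mem h2 h2'
      · simp only [map_add, Prod.fst_add, h3, h3']
      · simp only [map_add, Prod.fst_add, Prod.snd_add, add_sub_add_comm, h4, h4']
        abel
    · rintro n i c hc ⟨h1, h2, h3, h4⟩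
      have hx : (Finsupp.single i c : S.Carrier) = op c • Finsupp.single i 1 := by
        rw [free_op_smul_single, one_mul]
      have hD : S.D (Finsupp.single i c : S.Carrier) = op c • (S.bd i) +
          (S.deg i).negOnePow • op (A.d c) • (Finsupp.single i 1 : S.Carrier) := by
        rw [freeD_single, free_op_smul_single, one_mul]
      have e1 : S.deg i + (n - S.deg i) = n := by ring
      have e2 : S.deg i - 1 + (n - S.deg i) = n - 1 := by ring
      rw [hD, hx]
      simp only [map_smul, map_add, map_negOnePow_smul, Prod.smul_fst, Prod.smul_snd,
        Prod.fst_add, Prod.snd_add]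
      refine ⟨e1 ▸ N.smul_mem h1 hc, e2 ▸ N'.smul_mem h2 hc, ?_, ?_⟩
      · rw [N.leibniz c h1, h3]
      · rw [← smul_sub, h4, N'.leibniz c h2, smul_add, Int.negOnePow_sub, Int.negOnePow_one]
        simp only [mul_neg, mul_one, Units.neg_smul]
        abel
    · rintro i ⟨h1, h2, h3, h4⟩
      refine hv i ?_
      rw [S.bd_bd, map_zero] at h3 h4
      rw [add_sub_cancel_right] at h2
      have hf : f' (S.bd i) = N'.d (f' (Finsupp.single i 1)) := by rw [← hfd, D_single_one]
      simp only [Prod.fst_zero, Prod.snd_zero, add_zero] at h3 h4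
      obtain ⟨n0, hn0, hn0'⟩ := Res.qiso_inj hs h1 h3
        (t := f' (Finsupp.single i 1) + (v (S.bd i)).2)
        (by rw [add_sub_cancel_right]; exact add_mem (hfm (single_one_mem_freeGr i)) h2)
        (by rw [map_add, ← h4, ← hf]; abel)
      rw [add_sub_cancel_right] at hn0
      obtain ⟨n1, hn1, hn1', t', ht', htt⟩ := Res.qiso_surj hs
        (t := lin s n0 - f' (Finsupp.single i 1) - (v (S.bd i)).2) (n := S.deg i)
        (sub_mem (sub_mem (lin_mem s hn0) (hfm (single_one_mem_freeGr i))) h2)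
        (by rw [map_sub, map_sub, ← lin_d, hn0', ← hf, h4, sub_self])
      refine ⟨(n0 - n1, t'), sub_mem hn0 hn1, ht', ?_, ?_⟩
      · rw [map_sub, hn0', hn1', sub_zero]
      · rw [htt, map_sub]
        abel
  have main' : ∀ x : S.Carrier, N.d (v x).1 = (v (S.D x)).1 ∧
      lin s (v x).1 - f' x = N'.d (v x).2 + (v (S.D x)).2 := by
    intro x
    induction x using hom_induction (S.gr) with
    | h0 => simp
    | hadd x y hx hy =>
      refine ⟨?_, ?_⟩
      · simp only [map_add, Prod.fst_add, hx.1, hy.1]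
      · simp only [map_add, Prod.fst_add, Prod.snd_add, add_sub_add_comm, hx.2, hy.2]
        abel
    | hom n x hx => exact (main hx).2.2
  exact ⟨⟨LinearMap.fst _ _ _ ∘ₗ v, fun h => (main h).1, fun x => (main' x).1.symm⟩,
    LinearMap.snd _ _ _ ∘ₗ v, fun n x h => (main h).2.1, fun x => (main' x).2⟩

/-- Morphisms out of a semifree module which become homotopic after a quasi-isomorphism are
homotopic. The first component of `v` is the homotopy, the second one compares it with the given
homotopy. -/
lemma hproj_inj {b : ℤ} (hb : ∀ i, b ≤ S.deg i) {N N' : DGModule A} (s : N ⟶ N')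
    (hs : QIso s) (f₁ f₂ : S.toModule ⟶ N)
    (h : Homotopic (f₁ ≫ s) (f₂ ≫ s)) : Homotopic f₁ f₂ := by
  obtain ⟨h', hm', hh'⟩ := h
  let f : S.Carrier →ₗ[A.carrierᵐᵒᵖ] N.carrier := lin f₁ - lin f₂
  let p : S.Carrier →ₗ[A.carrierᵐᵒᵖ] N'.carrier := h'
  have hfm : ∀ {n : ℤ} {x : S.Carrier}, x ∈ S.gr n → f x ∈ N.gr n :=
    fun h => sub_mem (lin_mem f₁ h) (lin_mem f₂ h)
  have hfe : ∀ x : S.Carrier, f x = lin f₁ x - lin f₂ x := fun _ => rfl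
  have hfd : ∀ x : S.Carrier, f (S.D x) = N.d (f x) := fun x =>
    (congrArg₂ (· - ·) (lin_d f₁ x) (lin_d f₂ x)).trans (map_sub N.d _ _).symm
  have hpm : ∀ {n : ℤ} {x : S.Carrier}, x ∈ S.gr n → p x ∈ N'.gr (n - 1) := fun h => hm' _ _ h
  have hp : ∀ x : S.Carrier, lin s (f x) = N'.d (p x) + p (S.D x) := fun x =>
    (map_sub (lin s) (lin f₁ x) (lin f₂ x)).trans (hh' x)
  clear_value f p
  obtain ⟨v, hv⟩ := exists_ext hb (T := N.carrier × N'.carrier) fun i w v =>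
    v.1 ∈ N.gr (S.deg i - 1) ∧ v.2 ∈ N'.gr (S.deg i - 1 - 1) ∧
      f (Finsupp.single i 1) = N.d v.1 + w.1 ∧
      lin s v.1 - p (Finsupp.single i 1) = N'.d v.2 - w.2
  have main : ∀ {n : ℤ} {x : S.Carrier}, x ∈ S.gr n → (v x).1 ∈ N.gr (n - 1) ∧
      (v x).2 ∈ N'.gr (n - 1 - 1) ∧ f x = N.d (v x).1 + (v (S.D x)).1 ∧
      lin s (v x).1 - p x = N'.d (v x).2 - (v (S.D x)).2 := by
    intro n x hx
    refine basis_induction hb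
      (E := fun i => (v (Finsupp.single i 1)).1 ∈ N.gr (S.deg i - 1) ∧
        (v (Finsupp.single i 1)).2 ∈ N'.gr (S.deg i - 1 - 1) ∧
        f (Finsupp.single i 1) = N.d (v (Finsupp.single i 1)).1 + (v (S.bd i)).1 ∧
        lin s (v (Finsupp.single i 1)).1 - p (Finsupp.single i 1) =
          N'.d (v (Finsupp.single i 1)).2 - (v (S.bd i)).2)
      (Q := fun n x => (v x).1 ∈ N.gr (n - 1) ∧
        (v x).2 ∈ N'.gr (n - 1 - 1) ∧ f x = N.d (v x).1 + (v (S.D x)).1 ∧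
        lin s (v x).1 - p x = N'.d (v x).2 - (v (S.D x)).2) ?_ ?_ ?_ ?_ hx
    · intro n
      simp
    · rintro n x y ⟨h1, h2, h3, h4⟩ ⟨h1', h2', h3', h4'⟩
      refine ⟨?_, ?_, ?_, ?_⟩
      · rw [map_add]; exact add_mem h1 h1'
      · rw [map_add]; exact add_mem h2 h2'
      · simp only [map_add, Prod.fst_add, h3, h3']
        abel
      · simp only [map_add, Prod.fst_add, Prod.snd_add, add_sub_add_comm, h4, h4']
    · rintro n i c hc ⟨h1, h2, h3, h4⟩
      have hx : (Finsupp.single i c : S.Carrier) = op c • Finsupp.single i 1 := by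
        rw [free_op_smul_single, one_mul]
      have hD : S.D (Finsupp.single i c : S.Carrier) = op c • (S.bd i) +
          (S.deg i).negOnePow • op (A.d c) • (Finsupp.single i 1 : S.Carrier) := by
        rw [freeD_single, free_op_smul_single, one_mul]
      have e1 : S.deg i - 1 + (n - S.deg i) = n - 1 := by ring
      have e2 : S.deg i - 1 - 1 + (n - S.deg i) = n - 1 - 1 := by ring
      rw [hD, hx]
      simp only [map_smul, map_add, map_negOnePow_smul, Prod.smul_fst, Prod.smul_snd,
        Prod.fst_add, Prod.snd_add]
      refine ⟨e1 ▸ N.smul_mem h1 hc, e2 ▸ N'.smul_mem h2 hc, ?_, ?_⟩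
      · rw [N.leibniz c h1, h3, smul_add, Int.negOnePow_sub, Int.negOnePow_one]
        simp only [mul_neg, mul_one, Units.neg_smul]
        abel
      · rw [← smul_sub, h4, N'.leibniz c h2, smul_sub, Int.negOnePow_sub, Int.negOnePow_sub,
          Int.negOnePow_one]
        simp only [mul_neg, mul_one, neg_neg]
        abel
    · rintro i ⟨h1, h2, h3, h4⟩
      refine hv i ?_
      rw [S.bd_bd, map_zero] at h3 h4
      rw [add_sub_cancel_right] at h1 h2
      have hf : f (S.bd i) = N.d (f (Finsupp.single i 1)) := by rw [← hfd, D_single_one]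
      have hp1 := hp (Finsupp.single i 1)
      rw [D_single_one] at hp1
      simp only [Prod.fst_zero, Prod.snd_zero, add_zero, sub_zero] at h3 h4
      obtain ⟨n0, hn0, hn0'⟩ := Res.qiso_inj hs (n := S.deg i)
        (y := f (Finsupp.single i 1) - (v (S.bd i)).1)
        (t := p (Finsupp.single i 1) - (v (S.bd i)).2)
        (sub_mem (hfm (single_one_mem_freeGr i)) h1)
        (by rw [map_sub, ← hf, h3, sub_self])
        (sub_mem (hpm (single_one_mem_freeGr i)) h2)
        (by rw [map_sub, map_sub, ← h4, hp1]; abel)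
      obtain ⟨n1, hn1, hn1', t', ht', htt⟩ := Res.qiso_surj hs
        (t := lin s n0 - p (Finsupp.single i 1) + (v (S.bd i)).2) (n := S.deg i - 1)
        (add_mem (sub_mem (lin_mem s hn0) (hpm (single_one_mem_freeGr i))) h2)
        (by rw [map_add, map_sub, ← lin_d, hn0', ← h4, map_sub, hp1]; abel)
      refine ⟨(n0 - n1, t'), sub_mem hn0 hn1, ht', ?_, ?_⟩
      · rw [map_sub, hn0', hn1', sub_zero, sub_add_cancel]
      · rw [htt, map_sub]
        abel
  refine ⟨LinearMap.fst _ _ _ ∘ₗ v, fun n x h => (main h).1, fun x => ?_⟩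
  have main' : ∀ x : S.Carrier, f x = N.d (v x).1 + (v (S.D x)).1 := by
    intro x
    induction x using hom_induction (S.gr) with
    | h0 => simp
    | hadd x y hx hy =>
      simp only [map_add, Prod.fst_add, hx, hy]
      abel
    | hom n x hx => exact (main hx).2.2.1
  exact (hfe x).symm.trans (main' x)

/-- Semifree modules generated in degrees bounded below are homotopically projective. -/
lemma isHProjective {b : ℤ} (hb : ∀ i, b ≤ S.deg i) : IsHProjective S.toModule := by
  intro N N' s hs
  constructor
  · intro f₁ f₂ h
    obtain ⟨f₁, rfl⟩ := (toHo A).map_surjective f₁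
    obtain ⟨f₂, rfl⟩ := (toHo A).map_surjective f₂
    simp only [← Functor.map_comp] at h
    rw [toHo_map_eq_iff] at h ⊢
    exact hproj_inj hb s hs f₁ f₂ h
  · intro f
    obtain ⟨f, rfl⟩ := (toHo A).map_surjective f
    obtain ⟨g, hg⟩ := hproj_surj hb s hs f
    exact ⟨(toHo A).map g, toHo_map_eq_iff.2 hg⟩

end SemiBasis

/-! ### Complexes with a triangular differential -/

/-- A complex `C` identified with a sum of shifted copies of `X`, indexed by `ι` and shifted by
`deg`, so that the differential is, up to sign, that of `X` on each summand, plus terms in summands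
of smaller `deg`. The last condition is stated on elements whose components in summands with
`deg j > l` vanish. -/
structure IsTriangular {ι : Type*} (deg : ι → ℤ) (X C : Cpx k)
    (Φ : C.carrier ≃ₗ[k] (ι →₀ X.carrier)) : Prop where
  mem_gr : ∀ (n : ℤ) (x : C.carrier), x ∈ C.gr n ↔ ∀ i, Φ x i ∈ X.gr (n - deg i)
  d_apply : ∀ (l : ℤ) (x : C.carrier), (∀ j, l < deg j → Φ x j = 0) → ∀ i, l ≤ deg i →
    Φ (C.d x) i = (deg i).negOnePow • X.d (Φ x i)

namespace IsTriangular

variable {ι : Type*} {deg : ι → ℤ} {X C : Cpx k} {Φ : C.carrier ≃ₗ[k] (ι →₀ X.carrier)}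

lemma exists_bound (deg : ι → ℤ) (f : ι →₀ X.carrier) : ∃ l, ∀ j, l < deg j → f j = 0 := by
  obtain ⟨l, hl⟩ := (f.support.image deg).bddAbove
  refine ⟨l, fun j hj => ?_⟩
  by_contra hne
  have := hl (Finset.mem_coe.2 (Finset.mem_image_of_mem deg (Finsupp.mem_support_iff.2 hne)))
  omega

/-- If the cohomology of `X` vanishes in the relevant degrees, the components of an element in
summands with large `deg` can be removed by subtracting boundaries, from the top down. -/
lemma exists_sub_d (h : IsTriangular deg X C Φ) {n l₀ l : ℤ} (hl : l₀ ≤ l) {x : C.carrier}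
    (hx : x ∈ C.gr n) (hxl : ∀ j, l < deg j → Φ x j = 0)
    (hd : ∀ j, l₀ < deg j → Φ (C.d x) j = 0)
    (hX : ∀ j, l₀ < deg j → deg j ≤ l → X.ExactAt (n - deg j)) :
    ∃ z ∈ C.gr (n - 1), (∀ j, l < deg j → Φ z j = 0) ∧
      ∀ j, l₀ < deg j → Φ (x - C.d z) j = 0 := by
  induction l, hl using Int.leInduction generalizing x with
  | base => exact ⟨0, zero_mem _, by simp, by simpa using hxl⟩
  | succ l hl ih =>
    have hy : ∀ i, ∃ y ∈ X.gr (n - 1 - deg i), (deg i = l + 1 → X.d y = Φ x i) ∧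
        (Φ x i = 0 ∨ deg i ≠ l + 1 → y = 0) := by
      intro i
      by_cases h0 : Φ x i = 0 ∨ deg i ≠ l + 1
      · refine ⟨0, zero_mem _, fun hi => ?_, fun _ => rfl⟩
        rw [map_zero, h0.resolve_right (not_not.2 hi)]
      · push Not at h0
        have h1 : X.d (Φ x i) = 0 := by
          have := h.d_apply (l + 1) x hxl i h0.2.ge
          rw [hd i (by omega)] at this
          exact (smul_eq_zero_iff_eq _).1 this.symm
        obtain ⟨y, hy, hyd⟩ := hX i (by omega) h0.2.le (Φ x i) ((h.mem_gr n x).1 hx i) h1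
        exact ⟨y, by rwa [sub_right_comm], fun _ => hyd, fun h' => absurd h' (by simpa using h0)⟩
    choose y hy hyd hy0 using hy
    let f : ι →₀ X.carrier := Finsupp.onFinset (Φ x).support (fun i => (deg i).negOnePow • y i)
      (fun i hi => Finsupp.mem_support_iff.2 fun h0 => hi (by rw [hy0 i (Or.inl h0), smul_zero]))
    have hf : ∀ i, f i = (deg i).negOnePow • y i := fun i => rfl
    have hz : Φ.symm f ∈ C.gr (n - 1) := by
      rw [h.mem_gr]
      intro i
      rw [Φ.apply_symm_apply, hf]
      exact negOnePow_smul_mem _ _ (hy i)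
    have hzl : ∀ j, l + 1 < deg j → Φ (Φ.symm f) j = 0 := by
      intro j hj
      rw [Φ.apply_symm_apply, hf, hy0 j (Or.inr (by omega)), smul_zero]
    have hdd : C.d (x - C.d (Φ.symm f)) = C.d x := by rw [map_sub, C.d_d, sub_zero]
    obtain ⟨w, hw, hwl, hwd⟩ := ih (x := x - C.d (Φ.symm f))
      (sub_mem hx (by simpa using C.d_mem hz))
      (fun j hj => by
        rw [map_sub, Finsupp.sub_apply, h.d_apply (l + 1) _ hzl j (by omega), Φ.apply_symm_apply,
          hf, map_negOnePow_smul, negOnePow_smul_smul, Int.negOnePow_even _ ⟨_, rfl⟩, one_smul]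
        by_cases hj' : deg j = l + 1
        · rw [hyd j hj', sub_self]
        · rw [hxl j (by omega), hy0 j (Or.inr hj'), map_zero, sub_zero])
      (by rwa [hdd]) (fun j hj hj' => hX j hj (by omega))
    refine ⟨Φ.symm f + w, add_mem hz hw, fun j hj => ?_, fun j hj => ?_⟩
    · rw [map_add, Finsupp.add_apply, hzl j hj, hwl j (by omega), add_zero]
    · rw [map_add, ← sub_sub]
      exact hwd j hj

lemma eq_zero_of_lt (b : ℤ) (hb : ∀ i, b ≤ deg i) {x : C.carrier}
    (hx : ∀ j, b - 1 < deg j → Φ x j = 0) : x = 0 := by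
  rw [← Φ.map_eq_zero_iff]
  ext j
  exact hx j (by have := hb j; omega)

/-- Only the shifted copies of `X` with cohomology in degree `n` can contribute to that of `C`. -/
lemma exactAt (h : IsTriangular deg X C Φ) {b : ℤ} (hb : ∀ i, b ≤ deg i) {n : ℤ}
    (hX : ∀ i, X.ExactAt (n - deg i)) : C.ExactAt n := by
  intro x hx hd
  obtain ⟨l, hl⟩ := exists_bound deg (Φ x)
  obtain ⟨z, hz, -, hzd⟩ := h.exists_sub_d (l₀ := b - 1) (l := max l (b - 1)) (le_max_right _ _) hx
    (fun j hj => hl j (by omega)) (fun j _ => by rw [hd, map_zero]; rfl) (fun j _ _ => hX j)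
  exact ⟨z, hz, (sub_eq_zero.1 (eq_zero_of_lt b hb hzd)).symm⟩

/-- The lowest cohomology class of `X`, in a summand with minimal `deg`, survives. -/
lemma not_exactAt_min (h : IsTriangular deg X C Φ) {i₀ : ι} (hi : ∀ i, deg i₀ ≤ deg i) {p : ℤ}
    (hp : ¬ X.ExactAt p) (hX : ∀ q < p, X.ExactAt q) : ¬ C.ExactAt (deg i₀ + p) := by
  classical
  simp only [Cpx.ExactAt, not_forall, not_exists, not_and] at hp ⊢
  obtain ⟨x, hx, hxd, hne⟩ := hp
  have hc : ∀ i, i ≠ i₀ → Φ (Φ.symm (Finsupp.single i₀ x)) i = 0 := by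
    intro i hne
    rw [Φ.apply_symm_apply, Finsupp.single_eq_of_ne hne]
  have hc₀ : Φ (Φ.symm (Finsupp.single i₀ x)) i₀ = x := by
    rw [Φ.apply_symm_apply, Finsupp.single_eq_same]
  refine ⟨Φ.symm (Finsupp.single i₀ x), ?_, ?_, fun z hz hzd => ?_⟩
  · rw [h.mem_gr]
    intro i
    by_cases hii : i = i₀
    · subst hii
      rwa [hc₀, add_sub_cancel_left]
    · rw [hc i hii]
      exact zero_mem _
  · rw [← Φ.map_eq_zero_iff]
    ext i
    rw [h.d_apply (deg i₀) _ (fun j hj => hc j (fun e => by subst e; omega)) i (hi i)]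
    by_cases hii : i = i₀
    · subst hii
      rw [hc₀, hxd, smul_zero]
      rfl
    · rw [hc i hii, map_zero, smul_zero]
      rfl
  · -- A primitive `z` can be moved into the summands of minimal `deg`, where it
    -- would be a primitive of `x` in `X`.
    obtain ⟨l, hl⟩ := exists_bound deg (Φ z)
    obtain ⟨w, hw, -, hwd⟩ := h.exists_sub_d (l₀ := deg i₀) (l := max l (deg i₀))
      (le_max_right _ _) hz (fun j hj => hl j (by omega))
      (fun j hj => by rw [hzd, hc j (fun e => by subst e; omega)])
      (fun j hj _ => hX _ (by omega))
    have h1 := h.d_apply (deg i₀) _ hwd i₀ le_rfl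
    rw [map_sub, C.d_d, sub_zero, hzd, hc₀] at h1
    have h2 : z - C.d w ∈ C.gr (deg i₀ + p - 1) := sub_mem hz (by simpa using C.d_mem hw)
    refine hne ((deg i₀).negOnePow • Φ (z - C.d w) i₀) ?_ ?_
    · have := (h.mem_gr _ _).1 h2 i₀
      rw [show deg i₀ + p - 1 - deg i₀ = p - 1 by ring] at this
      exact negOnePow_smul_mem _ _ this
    · rw [map_negOnePow_smul, ← h1]

/-- The highest cohomology class of `X`, in a summand with maximal `deg`, lifts to a class of
`C` which survives. -/
lemma not_exactAt_max (h : IsTriangular deg X C Φ) {b : ℤ} (hb : ∀ i, b ≤ deg i) {i₁ : ι}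
    (hi : ∀ i, deg i ≤ deg i₁) {q : ℤ} (hq : ¬ X.ExactAt q) (hX : ∀ n > q, X.ExactAt n) :
    ¬ C.ExactAt (deg i₁ + q) := by
  classical
  simp only [Cpx.ExactAt, not_forall, not_exists, not_and] at hq ⊢
  obtain ⟨x, hx, hxd, hne⟩ := hq
  let e : C.carrier := Φ.symm (Finsupp.single i₁ x)
  have hc : ∀ i, i ≠ i₁ → Φ e i = 0 := by
    intro i hne
    rw [Φ.apply_symm_apply, Finsupp.single_eq_of_ne hne]
  have hc₁ : Φ e i₁ = x := by
    rw [Φ.apply_symm_apply, Finsupp.single_eq_same]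
  have he : e ∈ C.gr (deg i₁ + q) := by
    rw [h.mem_gr]
    intro i
    by_cases hii : i = i₁
    · subst hii
      rwa [hc₁, add_sub_cancel_left]
    · rw [hc i hii]
      exact zero_mem _
  have htop : ∀ (y : C.carrier) j, deg i₁ < deg j → Φ y j = 0 := fun y j hj => by
    have := hi j
    omega
  have hde : ∀ j, deg i₁ - 1 < deg j → Φ (C.d e) j = 0 := by
    intro j hj
    rw [h.d_apply (deg i₁) e (htop e) j (by omega)]
    by_cases hii : j = i₁
    · subst hii
      rw [hc₁, hxd, smul_zero]
    · rw [hc j hii, map_zero, smul_zero]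
  -- The boundary of `e` lies in the summands of smaller `deg`, where it is the boundary
  -- of some `w`.
  have hbi := hb i₁
  obtain ⟨w, hw, hwl, hwd⟩ := h.exists_sub_d (l₀ := b - 1) (l := deg i₁ - 1) (by omega)
    (C.d_mem he) hde (fun j _ => by rw [C.d_d, map_zero]; rfl) (fun j _ _ => hX _ (by omega))
  rw [add_sub_cancel_right] at hw
  have hew : C.d (e - w) = 0 := by
    rw [map_sub]
    exact eq_zero_of_lt b hb hwd
  refine ⟨e - w, sub_mem he hw, hew, fun z hz hzd => ?_⟩
  have h1 := h.d_apply (deg i₁) z (htop z) i₁ le_rfl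
  rw [hzd, map_sub, Finsupp.sub_apply, hc₁, hwl i₁ (by omega), sub_zero] at h1
  refine hne ((deg i₁).negOnePow • Φ z i₁) ?_ (by rw [map_negOnePow_smul, ← h1])
  have := (h.mem_gr _ _).1 hz i₁
  rw [show deg i₁ + q - 1 - deg i₁ = q - 1 by ring] at this
  exact negOnePow_smul_mem _ _ this

/-- The bounds on the cohomology of a triangular complex whose shifts lie between `deg i₀` and
`deg i₁`. -/
lemma infH_supH (h : IsTriangular deg X C Φ) {i₀ i₁ : ι} (hi₀ : ∀ i, deg i₀ ≤ deg i)
    (hi₁ : ∀ i, deg i ≤ deg i₁) {p q : ℤ} (hp : ¬ X.ExactAt p) (hp' : ∀ n < p, X.ExactAt n)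
    (hq : ¬ X.ExactAt q) (hq' : ∀ n > q, X.ExactAt n) :
    (¬ C.ExactAt (deg i₀ + p) ∧ ∀ n < deg i₀ + p, C.ExactAt n) ∧ ¬ C.ExactAt (deg i₁ + q) :=
  ⟨⟨h.not_exactAt_min hi₀ hp hp', fun n hn => h.exactAt hi₀ fun i => hp' _ (by
    have := hi₀ i
    omega)⟩, h.not_exactAt_max hi₀ hi₁ hq hq'⟩

end IsTriangular

namespace SemiBasis

variable {S : SemiBasis A}

lemma D_apply {l : ℤ} {x : S.Carrier} (hx : ∀ j, l < S.deg j → x j = 0) {i : S.ι}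
    (hi : l ≤ S.deg i) : S.D x i = (S.deg i).negOnePow • A.d (x i) :=
  freeD_apply fun j hj => S.bd_eq_zero j i (by
    by_contra hlt
    exact hj (hx j (by omega)))

/-- A semifree module is a sum of shifted copies of `A`, with a triangular differential. -/
lemma isTriangular (S : SemiBasis A) :
    IsTriangular S.deg A.toCpx S.toModule.toCpx (LinearEquiv.refl k S.Carrier) where
  mem_gr _ _ := Iff.rfl
  d_apply _ _ hx _ hi := D_apply hx hi

/-! ### Compact semifree modules have generators in finitely many degrees -/

lemma eq_zero_of_mem_gr (hA : ∀ n < 0, A.gr n = ⊥) {n : ℤ} {x : S.Carrier} (hx : x ∈ S.gr n)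
    {i : S.ι} (hi : n < S.deg i) : x i = 0 := by
  have := hx i
  rwa [hA _ (by omega), Submodule.mem_bot] at this

variable (S) in
/-- The submodule generated by the basis elements of degree less than `c`. -/
def genLT (c : ℤ) : Submodule A.carrierᵐᵒᵖ S.Carrier where
  carrier := {x | ∀ i, c ≤ S.deg i → x i = 0}
  zero_mem' := fun _ _ => rfl
  add_mem' := fun hx hy i hi => by rw [Finsupp.add_apply, hx i hi, hy i hi, add_zero]
  smul_mem' := fun a x hx i hi => by rw [Finsupp.smul_apply, hx i hi, smul_zero]

variable (S) in
/-- The quotient of a semifree module by the submodule generated in degrees less than `c`. -/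
noncomputable def quotGenLT (c : ℤ) : DGModule A :=
  quot S.toModule (S.genLT c)
    (fun n x hx i hi => by
      have h := map_proj (gr := S.gr) (gr' := A.gr)
        (Finsupp.lapply i : S.Carrier →ₗ[k] A.carrier) (-S.deg i)
        (fun m y hy => by simpa [← sub_eq_add_neg] using hy i) n x
      have hxi : (Finsupp.lapply i : S.Carrier →ₗ[k] A.carrier) x = 0 := hx i hi
      rw [hxi, map_zero] at h
      exact h)
    (fun x hx i hi => by
      refine (D_apply (l := c - 1) (fun j hj => hx j (by omega)) (by omega)).trans ?_
      rw [hx i hi, map_zero, smul_zero])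

variable (S) in
/-- The projection to `quotGenLT`. -/
noncomputable def toQuotGenLT (c : ℤ) : S.toModule ⟶ S.quotGenLT c := toQuot S.toModule _ _ _

lemma toQuotGenLT_eq_zero {c : ℤ} {x : S.Carrier} :
    lin (S.toQuotGenLT c) x = 0 ↔ x ∈ S.genLT c := toQuot_eq_zero _ _ _ _

/-- If the projection to the quotient by the generators of degree `< c` is null-homotopic, then
there are no generators of degree `≥ c`: one of least degree would have to be killed by the
homotopy, whose values vanish for degree reasons. -/
lemma deg_lt_of_homotopic (hA : ∀ n < 0, A.gr n = ⊥) (h1 : (1 : A.carrier) ≠ 0) {c : ℤ}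
    (h : Homotopic (S.toQuotGenLT c) 0) (i : S.ι) : S.deg i < c := by
  obtain ⟨s, hs, hsd⟩ := h
  have key : ∀ (m : ℕ) (i : S.ι), S.deg i < c + m → S.deg i < c := by
    intro m
    induction m with
    | zero => simp
    | succ m ih =>
      intro i hi
      by_contra hc
      push_cast at hi
      have hvanish : ∀ j : ℤ, j < S.deg i → ∀ y ∈ (S.quotGenLT c).gr j, y = 0 := by
        intro j hj y hy
        obtain ⟨x, hx, rfl⟩ := toQuot_surjective _ _ _ _ hy
        refine toQuotGenLT_eq_zero.2 fun i' hi' => eq_zero_of_mem_gr hA hx ?_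
        by_contra hle
        have := ih i' (by omega)
        omega
      have hs0 : ∀ j, S.deg j ≤ S.deg i → s (Finsupp.single j 1 : S.Carrier) = 0 := fun j hj =>
        hvanish (S.deg j - 1) (by omega) _ (hs _ _ (single_one_mem_freeGr j))
      have hbd : s (S.bd i) = 0 := by
        have hsum : S.bd i = ∑ j ∈ (S.bd i).support, op (S.bd i j) •
            (Finsupp.single j 1 : S.Carrier) := by
          conv_lhs => rw [← Finsupp.sum_single (S.bd i)]
          exact Finset.sum_congr rfl fun j _ => by rw [free_op_smul_single, one_mul]
        rw [hsum]
        refine (map_sum s _ _).trans (Finset.sum_eq_zero fun j hj => ?_)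
        refine (map_smul s _ _).trans ?_
        rw [hs0 j, smul_zero]
        by_contra hle
        exact Finsupp.mem_support_iff.1 hj (S.bd_eq_zero i j (by omega))
      have h2 := hsd (Finsupp.single i 1 : S.Carrier)
      have h3 : S.toModule.d (Finsupp.single i 1 : S.Carrier) = S.bd i := D_single_one i
      rw [h3, hbd, hs0 i le_rfl, map_zero, add_zero] at h2
      have h4 : lin (S.toQuotGenLT c) (Finsupp.single i 1 : S.Carrier) = 0 :=
        (sub_zero _).symm.trans h2
      have h5 := toQuotGenLT_eq_zero.1 h4 i (by omega)
      rw [Finsupp.single_eq_same] at h5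
      exact h1 h5
  exact key (S.deg i - c + 1).toNat i (by omega)

/-- A compact semifree module has its basis in bounded degrees: its projections to the quotients by
the generators of small degree form a morphism to a direct sum, and almost all of them must
vanish. -/
lemma exists_bound_of_isCompactObj (hA : ∀ n < 0, A.gr n = ⊥) (h1 : (1 : A.carrier) ≠ 0) {b : ℤ}
    (hb : ∀ i, b ≤ S.deg i) (hS : IsCompactObj ((toDer A).obj S.toModule)) :
    ∃ c : ℤ, ∀ i, S.deg i < c := by
  classical
  let Y : ULift.{u} ℕ → DGModule A := fun n => S.quotGenLT n.down
  -- An element of degree `m` only involves basis elements of degree at most `m`.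
  obtain ⟨f, hf⟩ := exists_lift (Y := Y) (fun n => S.toQuotGenLT n.down) (by
    intro m x hx
    refine (Set.Finite.preimage (f := ULift.down) (ULift.down_injective.injOn)
      (Set.finite_le_nat m.toNat)).subset fun n hn => ?_
    by_contra hcon
    refine hn (toQuotGenLT_eq_zero.2 fun i hi => eq_zero_of_mem_gr hA hx ?_)
    simp only [Set.mem_preimage, Set.mem_ofPred_eq] at hcon
    omega)
  have hfin := finite_components_of_isCompactObj hS Y ((toDer A).map f)
  obtain ⟨n, hn⟩ := hfin.infinite_compl.nonempty
  simp only [Set.mem_compl_iff, Set.mem_ofPred_eq, not_not] at hn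
  rw [← Functor.map_comp, hf] at hn
  exact ⟨n.down, deg_lt_of_homotopic hA h1 ((isHProjective hb).homotopic_of_toDer_map hn)⟩

end SemiBasis

/-! ### Tensor products with semifree modules -/

section LeftAction

variable (X : DGModule A.op)

/-- The right action of `A^op` as a bilinear map. -/
noncomputable def opAct : A.carrier →ₗ[k] X.carrier →ₗ[k] X.carrier :=
  LinearMap.mk₂ k (fun a y => op (DGAlgebra.toOp a) • y)
    (fun a b y => by rw [map_add, MulOpposite.op_add, add_smul])
    (fun c a y => by rw [map_smul, MulOpposite.op_smul, smul_assoc])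
    (fun a y z => smul_add _ y z)
    (fun c a y => smul_comm _ c y)

/-- The left action `a y = (-1)^(|a| |y|) y a` of `A` on a right `A^op`-module. -/
noncomputable def leftAct : A.carrier →ₗ[k] X.carrier →ₗ[k] X.carrier :=
  DirectSum.toModule k ℤ (X.carrier →ₗ[k] X.carrier)
      (fun r => (LinearMap.lcomp k X.carrier (sgnPow X.gr r)) ∘ₗ opAct X ∘ₗ (A.gr r).subtype) ∘ₗ
    (DirectSum.decomposeLinearEquiv A.gr).toLinearMap

variable {X}

lemma leftAct_of_mem {r q : ℤ} {a : A.carrier} {y : X.carrier} (ha : a ∈ A.gr r) (hy : y ∈ X.gr q) :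
    leftAct X a y = (r * q).negOnePow • (op (DGAlgebra.toOp a) • y) := by
  rw [leftAct, LinearMap.comp_apply, LinearEquiv.coe_coe, DirectSum.decomposeLinearEquiv_apply,
    DirectSum.decompose_of_mem A.gr ha, ← DirectSum.lof_eq_of k, DirectSum.toModule_lof,
    LinearMap.comp_apply, LinearMap.comp_apply, LinearMap.lcomp_apply, sgnPow_of_mem _ _ hy,
    map_negOnePow_smul]
  rfl

lemma leftAct_mem {r q : ℤ} {a : A.carrier} {y : X.carrier} (ha : a ∈ A.gr r) (hy : y ∈ X.gr q) :
    leftAct X a y ∈ X.gr (r + q) := by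
  rw [leftAct_of_mem ha hy, add_comm]
  exact negOnePow_smul_mem _ _ (X.smul_mem hy (DGAlgebra.toOp_mem ha))

lemma leftAct_one (y : X.carrier) : leftAct X 1 y = y := by
  induction y using hom_induction X.gr with
  | h0 => simp
  | hadd x y hx hy => rw [map_add, hx, hy]
  | hom n y hy =>
    rw [leftAct_of_mem SetLike.GradedOne.one_mem hy, zero_mul, Int.negOnePow_zero, one_smul]
    exact one_smul A.op.carrierᵐᵒᵖ y

lemma leftAct_mul (a b : A.carrier) (y : X.carrier) :
    leftAct X (a * b) y = leftAct X a (leftAct X b y) := by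
  induction a using hom_induction A.gr with
  | h0 => simp
  | hadd x y hx hy => simp only [map_add, add_mul, LinearMap.add_apply, hx, hy]
  | hom i a ha =>
  induction b using hom_induction A.gr with
  | h0 => simp
  | hadd x y hx hy => simp only [map_add, mul_add, LinearMap.add_apply, hx, hy]
  | hom j b hb =>
  induction y using hom_induction X.gr with
  | h0 => simp
  | hadd x y hx hy => simp only [map_add, hx, hy]
  | hom q y hy =>
  have h1 := SetLike.mul_mem_graded ha hb
  have h2 : op (DGAlgebra.toOp a) • op (DGAlgebra.toOp b) • y =
      op (DGAlgebra.toOp b * DGAlgebra.toOp a) • y := by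
    rw [MulOpposite.op_mul, mul_smul]
  rw [leftAct_of_mem h1 hy, leftAct_of_mem ha (leftAct_mem hb hy), leftAct_of_mem hb hy,
    Res.op_smul_negOnePow, h2, DGAlgebra.toOp_mul hb ha, negOnePow_smul_smul]
  have h3 : (op ((j * i).negOnePow • DGAlgebra.toOp (a * b)) : A.op.carrierᵐᵒᵖ) • y =
      (j * i).negOnePow • (op (DGAlgebra.toOp (a * b)) : A.op.carrierᵐᵒᵖ) • y := by
    rw [Units.smul_def, Units.smul_def, MulOpposite.op_smul, smul_assoc]
  rw [h3, negOnePow_smul_smul]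
  apply negOnePow_smul_congr
  ring_nf
  simp

end LeftAction

/-! ### Elements and maps of tensor products -/

section Tensor

variable {M N : DGModule A} {X : DGModule A.op}

variable (M X) in
/-- The projection `M ⊗ X → M ⊗_A X`. -/
noncomputable def tensorMk : M.carrier ⊗[k] X.carrier →ₗ[k] (tensor M X).carrier :=
  (tensorRel M X).mkQ

lemma tensorMk_surjective : Function.Surjective (tensorMk M X) := (tensorRel M X).mkQ_surjective

lemma tensorMk_eq_zero {t : M.carrier ⊗[k] X.carrier} (ht : t ∈ tensorRel M X) :
    tensorMk M X t = 0 := (Submodule.Quotient.mk_eq_zero (tensorRel M X)).2 ht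

lemma tensorMk_op_smul_of_mem {p r q : ℤ} {x : M.carrier} {a : A.carrier} {y : X.carrier}
    (hx : x ∈ M.gr p) (ha : a ∈ A.gr r) (hy : y ∈ X.gr q) :
    tensorMk M X ((op a • x) ⊗ₜ y) = tensorMk M X (x ⊗ₜ leftAct X a y) := by
  rw [← sub_eq_zero, ← map_sub, leftAct_of_mem ha hy]
  exact tensorMk_eq_zero (Submodule.subset_span ⟨p, r, q, x, a, y, hx, ha, hy, rfl⟩)

lemma tensorMk_mem {p q : ℤ} {x : M.carrier} {y : X.carrier} (hx : x ∈ M.gr p) (hy : y ∈ X.gr q) :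
    tensorMk M X (x ⊗ₜ y) ∈ (tensor M X).gr (p + q) := by
  have h : (tensorRel M X).mkQ (x ⊗ₜ[k] y) ∈ Submodule.span k {t | ∃ (p' q' : ℤ) (x : M.carrier)
      (y : X.carrier), x ∈ M.gr p' ∧ y ∈ X.gr q' ∧ p' + q' = p + q ∧
        t = (tensorRel M X).mkQ (x ⊗ₜ[k] y)} :=
    Submodule.subset_span ⟨p, q, x, y, hx, hy, rfl, rfl⟩
  exact h

lemma tensor_gr_le {n : ℤ} {W : Submodule k (tensor M X).carrier}
    (h : ∀ p q, ∀ x ∈ M.gr p, ∀ y ∈ X.gr q, p + q = n → tensorMk M X (x ⊗ₜ y) ∈ W) :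
    (tensor M X).gr n ≤ W := by
  let W' : Submodule k ((M.carrier ⊗[k] X.carrier) ⧸ tensorRel M X) := W
  have hle : Submodule.span k {t | ∃ (p q : ℤ) (x : M.carrier) (y : X.carrier), x ∈ M.gr p ∧
      y ∈ X.gr q ∧ p + q = n ∧ t = (tensorRel M X).mkQ (x ⊗ₜ[k] y)} ≤ W' := by
    rw [Submodule.span_le]
    rintro _ ⟨p, q, x, y, hx, hy, hpq, rfl⟩
    exact h p q x hx y hy hpq
  exact hle

lemma tensor_d_mk {p : ℤ} {x : M.carrier} (hx : x ∈ M.gr p) (y : X.carrier) :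
    (tensor M X).d (tensorMk M X (x ⊗ₜ y)) = tensorMk M X (M.d x ⊗ₜ y) +
      p.negOnePow • tensorMk M X (x ⊗ₜ X.d y) := by
  rw [← map_negOnePow_smul, ← map_add, ← tensorD₀_tmul hx]
  rfl

lemma tensor_induction {p : (tensor M X).carrier → Prop} (h0 : p 0)
    (hadd : ∀ x y, p x → p y → p (x + y))
    (hs : ∀ n, ∀ x ∈ M.gr n, ∀ y, p (tensorMk M X (x ⊗ₜ y))) (t) : p t := by
  obtain ⟨t, rfl⟩ := tensorMk_surjective t
  induction t with
  | zero => rwa [map_zero]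
  | add x y hx hy => rw [map_add]; exact hadd _ _ hx hy
  | tmul x y =>
  induction x using hom_induction M.gr with
  | h0 => rwa [TensorProduct.zero_tmul, map_zero]
  | hadd x x' hx hx' => rw [TensorProduct.add_tmul, map_add]; exact hadd _ _ hx hx'
  | hom n x hx => exact hs n x hx y

/-- Linear maps out of `M ⊗_A X`. -/
noncomputable def tensorLift {W : Type*} [AddCommGroup W] [Module k W]
    (f : M.carrier ⊗[k] X.carrier →ₗ[k] W) (hf : ∀ (x : M.carrier) (a : A.carrier) (y : X.carrier),
      f ((op a • x) ⊗ₜ y) = f (x ⊗ₜ leftAct X a y)) : (tensor M X).carrier →ₗ[k] W :=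
  (tensorRel M X).liftQ f (by
    rw [tensorRel, Submodule.span_le]
    rintro _ ⟨p, r, q, x, a, y, -, ha, hy, rfl⟩
    rw [SetLike.mem_coe, LinearMap.mem_ker, map_sub, sub_eq_zero, hf, leftAct_of_mem ha hy])

lemma tensorLift_mk {W : Type*} [AddCommGroup W] [Module k W]
    (f : M.carrier ⊗[k] X.carrier →ₗ[k] W) (hf) (t : M.carrier ⊗[k] X.carrier) :
    tensorLift f hf (tensorMk M X t) = f t := rfl

lemma tensorMk_op_smul (x : M.carrier) (a : A.carrier) (y : X.carrier) :
    tensorMk M X ((op a • x) ⊗ₜ y) = tensorMk M X (x ⊗ₜ leftAct X a y) := by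
  induction x using hom_induction M.gr with
  | h0 => simp
  | hadd x y hx hy => simp only [smul_add, TensorProduct.add_tmul, map_add, hx, hy]
  | hom p x hx =>
  induction a using hom_induction A.gr with
  | h0 => simp
  | hadd x y hx hy =>
    simp only [MulOpposite.op_add, add_smul, TensorProduct.add_tmul, map_add, hx, hy,
      LinearMap.add_apply, TensorProduct.tmul_add]
  | hom r a ha =>
  induction y using hom_induction X.gr with
  | h0 => simp
  | hadd x y hx hy => simp only [TensorProduct.tmul_add, map_add, hx, hy]
  | hom q y hy => exact tensorMk_op_smul_of_mem hx ha hy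

end Tensor

namespace SemiBasis

variable {S : SemiBasis A}

variable (S) in
/-- The multiples of a basis element. -/
noncomputable def single (i : S.ι) : A.carrier →ₗ[k] S.toModule.carrier :=
  (Finsupp.lsingle i : A.carrier →ₗ[k] S.Carrier)

variable (S) in
/-- The coordinates with respect to the basis. -/
noncomputable def coord (i : S.ι) : S.toModule.carrier →ₗ[k] A.carrier :=
  (Finsupp.lapply i : S.Carrier →ₗ[k] A.carrier)

lemma carrier_induction {p : S.toModule.carrier → Prop} (h0 : p 0)
    (hadd : ∀ x y, p x → p y → p (x + y)) (hs : ∀ i a, p (S.single i a)) (x) : p x :=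
  Finsupp.induction_linear (motive := p) x h0 (fun x y => hadd x y) hs

lemma single_mem_gr {i : S.ι} {r : ℤ} {a : A.carrier} (ha : a ∈ A.gr r) :
    S.single i a ∈ S.toModule.gr (S.deg i + r) :=
  single_mem_freeGr (by rwa [add_sub_cancel_left])

lemma op_smul_single (i : S.ι) (a c : A.carrier) : op a • S.single i c = S.single i (c * a) :=
  free_op_smul_single i a c

variable (S) (X : DGModule A.op)

/-- The map `S ⊗ X → ⨁ X` given by the coordinates. -/
noncomputable def tensorCoord₀ : S.toModule.carrier ⊗[k] X.carrier →ₗ[k] (S.ι →₀ X.carrier) :=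
  TensorProduct.lift (Finsupp.lsum k fun i => (leftAct X).compr₂ (Finsupp.lsingle i) :
    S.Carrier →ₗ[k] X.carrier →ₗ[k] (S.ι →₀ X.carrier))

variable {S X}

lemma tensorCoord₀_single (i : S.ι) (a : A.carrier) (y : X.carrier) :
    tensorCoord₀ S X (S.single i a ⊗ₜ y) = Finsupp.single i (leftAct X a y) := by
  change (Finsupp.lsum k fun i => (leftAct X).compr₂ (Finsupp.lsingle i) :
    S.Carrier →ₗ[k] X.carrier →ₗ[k] (S.ι →₀ X.carrier)) (Finsupp.single i a) y = _
  rw [Finsupp.lsum_single]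
  rfl

lemma tensorCoord₀_apply (x : S.toModule.carrier) (y : X.carrier) (i : S.ι) :
    tensorCoord₀ S X (x ⊗ₜ y) i = leftAct X (S.coord i x) y := by
  classical
  induction x using carrier_induction with
  | h0 => simp
  | hadd x y hx hy =>
    rw [TensorProduct.add_tmul, map_add, Finsupp.add_apply, hx, hy, map_add, map_add,
      LinearMap.add_apply]
  | hs j a =>
    rw [tensorCoord₀_single]
    change _ = leftAct X ((Finsupp.single j a : S.Carrier) i) y
    rw [Finsupp.single_apply, Finsupp.single_apply]
    split_ifs with h
    · rfl
    · rw [map_zero, LinearMap.zero_apply]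

lemma tensorCoord₀_smul (x : S.toModule.carrier) (a : A.carrier) (y : X.carrier) :
    tensorCoord₀ S X ((op a • x) ⊗ₜ y) = tensorCoord₀ S X (x ⊗ₜ leftAct X a y) := by
  induction x using carrier_induction with
  | h0 => simp
  | hadd x x' hx hx' => rw [smul_add, TensorProduct.add_tmul, map_add, hx, hx',
      TensorProduct.add_tmul, map_add]
  | hs i c => rw [op_smul_single, tensorCoord₀_single, tensorCoord₀_single, leftAct_mul]

lemma tensorMk_single_tmul (i : S.ι) (a : A.carrier) (y : X.carrier) :
    tensorMk S.toModule X (S.single i 1 ⊗ₜ leftAct X a y) =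
      tensorMk S.toModule X (S.single i a ⊗ₜ y) := by
  rw [← tensorMk_op_smul, op_smul_single, one_mul]

variable (S X) in
/-- The tensor product of a semifree module with `X` is a sum of copies of `X`. -/
noncomputable def tensorCoord : (tensor S.toModule X).carrier ≃ₗ[k] (S.ι →₀ X.carrier) :=
  let f := tensorLift (tensorCoord₀ S X) tensorCoord₀_smul
  let g : (S.ι →₀ X.carrier) →ₗ[k] (tensor S.toModule X).carrier :=
    Finsupp.lsum k fun i => tensorMk S.toModule X ∘ₗ
      TensorProduct.mk k S.toModule.carrier X.carrier (S.single i 1)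
  have hg : ∀ i y, g (Finsupp.single i y) = tensorMk S.toModule X (S.single i 1 ⊗ₜ y) := by
    intro i y
    simp only [g]
    rw [Finsupp.lsum_single]
    rfl
  LinearEquiv.ofLinearMap f g
    (by
      refine Finsupp.lhom_ext fun i y => ?_
      rw [LinearMap.comp_apply, hg, tensorLift_mk, tensorCoord₀_single, leftAct_one,
        LinearMap.id_apply])
    (by
      refine LinearMap.ext fun t => ?_
      rw [LinearMap.comp_apply, LinearMap.id_apply]
      induction t using tensor_induction with
      | h0 => rw [map_zero, map_zero]
      | hadd x y hx hy => rw [map_add, map_add, hx, hy]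
      | hs n x hx y =>
      clear hx
      rw [tensorLift_mk]
      induction x using carrier_induction with
      | h0 => simp
      | hadd x x' hx hx' => rw [TensorProduct.add_tmul, map_add, map_add, hx, hx', map_add]
      | hs i a => rw [tensorCoord₀_single, hg, tensorMk_single_tmul])

lemma tensorCoord_mk (t : S.toModule.carrier ⊗[k] X.carrier) :
    tensorCoord S X (tensorMk S.toModule X t) = tensorCoord₀ S X t := rfl

lemma tensorCoord_symm_single (i : S.ι) (y : X.carrier) :
    (tensorCoord S X).symm (Finsupp.single i y) = tensorMk S.toModule X (S.single i 1 ⊗ₜ y) := by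
  rw [LinearEquiv.symm_apply_eq, tensorCoord_mk, tensorCoord₀_single, leftAct_one]

lemma tensorCoord_d_single (i j : S.ι) (y : X.carrier) :
    tensorCoord S X ((tensor S.toModule X).d ((tensorCoord S X).symm (Finsupp.single j y))) i =
      leftAct X (S.bd j i) y + (S.deg j).negOnePow • (Finsupp.single j (X.d y) : S.ι →₀ _) i := by
  have h1 : S.single j 1 ∈ S.toModule.gr (S.deg j) := by
    simpa using single_mem_gr (S := S) (i := j) SetLike.GradedOne.one_mem
  have h2 : S.toModule.d (S.single j 1) = S.bd j := D_single_one j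
  rw [tensorCoord_symm_single, tensor_d_mk h1, map_add, Finsupp.add_apply, map_negOnePow_smul,
    tensorCoord_mk, tensorCoord_mk, Finsupp.smul_apply, tensorCoord₀_apply, tensorCoord₀_single,
    leftAct_one, h2]
  rfl

/-- The tensor product of a semifree module with `X` is a sum of shifted copies of `X`, with a
triangular differential. -/
lemma isTriangular_tensor (S : SemiBasis A) (X : DGModule A.op) :
    IsTriangular S.deg X.toCpx (tensor S.toModule X) (tensorCoord S X) where
  mem_gr n x := by
    constructor
    · intro hx i
      let W : Submodule k (tensor S.toModule X).carrier :=
        (X.gr (n - S.deg i)).comap (Finsupp.lapply i ∘ₗ (tensorCoord S X).toLinearMap)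
      refine tensor_gr_le (W := W) (fun p q x hx y hy hpq => ?_) hx
      change tensorCoord S X (tensorMk S.toModule X (x ⊗ₜ y)) i ∈ X.gr (n - S.deg i)
      rw [tensorCoord_mk, tensorCoord₀_apply, ← hpq]
      have := leftAct_mem (X := X) (hx i) hy
      rwa [show p - S.deg i + q = p + q - S.deg i by ring] at this
    · intro hx
      rw [← (tensorCoord S X).symm_apply_apply x, ← Finsupp.sum_single (tensorCoord S X x),
        Finsupp.sum, map_sum]
      refine sum_mem fun i _ => ?_
      rw [tensorCoord_symm_single]
      have := tensorMk_mem (single_mem_gr (i := i) SetLike.GradedOne.one_mem) (hx i)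
      rwa [show S.deg i + 0 + (n - S.deg i) = n by ring] at this
  d_apply l x hx i hi := by
    classical
    have key : ∀ f : S.ι →₀ X.carrier, (∀ j, l < S.deg j → f j = 0) →
        tensorCoord S X ((tensor S.toModule X).d ((tensorCoord S X).symm f)) i =
          (S.deg i).negOnePow • X.d (f i) := by
      intro f hf
      conv_lhs => rw [← Finsupp.sum_single f]
      conv_rhs => rw [← Finsupp.sum_single f]
      rw [Finsupp.sum, map_sum, map_sum, map_sum, Finsupp.finsetSum_apply,
        Finsupp.finsetSum_apply, map_sum, Finset.smul_sum]
      refine Finset.sum_congr rfl fun j hj => ?_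
      have hji : S.deg j ≤ S.deg i := by
        by_contra hlt
        exact Finsupp.mem_support_iff.1 hj (hf j (by omega))
      rw [tensorCoord_d_single, S.bd_eq_zero j i hji, map_zero, LinearMap.zero_apply, zero_add,
        Finsupp.single_apply, Finsupp.single_apply]
      split_ifs with h
      · rw [h]
      · rw [map_zero, smul_zero, smul_zero]
    have := key (tensorCoord S X x) hx
    rwa [LinearEquiv.symm_apply_apply] at this

end SemiBasis

/-! ### Homotopy invariance of the tensor product -/

section

variable {M N : DGModule A} (X : DGModule A.op)

/-- The map induced on tensor products by an `A`-linear map. -/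
noncomputable def tensorMap (f : M.carrier →ₗ[A.carrierᵐᵒᵖ] N.carrier) :
    (tensor M X).carrier →ₗ[k] (tensor N X).carrier :=
  tensorLift (tensorMk N X ∘ₗ TensorProduct.map (f.restrictScalars k) LinearMap.id)
    fun x a y => by
      rw [LinearMap.comp_apply, LinearMap.comp_apply, TensorProduct.map_tmul,
        TensorProduct.map_tmul, LinearMap.coe_restrictScalars, map_smul]
      exact tensorMk_op_smul _ _ _

variable {X}

lemma tensorMap_mk (f : M.carrier →ₗ[A.carrierᵐᵒᵖ] N.carrier) (x : M.carrier) (y : X.carrier) :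
    tensorMap X f (tensorMk M X (x ⊗ₜ y)) = tensorMk N X (f x ⊗ₜ y) := rfl

lemma tensorMap_mem {f : M.carrier →ₗ[A.carrierᵐᵒᵖ] N.carrier} (m : ℤ)
    (hf : ∀ n, ∀ x ∈ M.gr n, f x ∈ N.gr (n + m)) {n : ℤ} {t : (tensor M X).carrier}
    (ht : t ∈ (tensor M X).gr n) : tensorMap X f t ∈ (tensor N X).gr (n + m) := by
  refine tensor_gr_le (W := ((tensor N X).gr (n + m)).comap (tensorMap X f))
    (fun p q x hx y hy hpq => ?_) ht
  rw [Submodule.mem_comap, tensorMap_mk, ← hpq, add_right_comm]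
  exact tensorMk_mem (hf _ _ hx) hy

lemma tensorMap_lin_mem (f : M ⟶ N) {n : ℤ} {t : (tensor M X).carrier}
    (ht : t ∈ (tensor M X).gr n) : tensorMap X (lin f) t ∈ (tensor N X).gr n := by
  have := tensorMap_mem (X := X) (f := lin f) 0 (fun n x hx => by
    rw [add_zero]; exact lin_mem f hx) ht
  rwa [add_zero] at this

lemma tensorMap_lin_d (f : M ⟶ N) (t : (tensor M X).carrier) :
    tensorMap X (lin f) ((tensor M X).d t) = (tensor N X).d (tensorMap X (lin f) t) := by
  induction t using tensor_induction with
  | h0 => simp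
  | hadd x y hx hy => simp only [map_add, hx, hy]
  | hs n x hx y =>
    rw [tensor_d_mk hx, tensorMap_mk, tensor_d_mk (lin_mem f hx), map_add, map_negOnePow_smul,
      tensorMap_mk, tensorMap_mk, lin_d]

/-- Vanishing of the cohomology of `- ⊗ X` passes to homotopy retracts. -/
lemma exactAt_tensor_of_homotopic {f : M ⟶ N} {g : N ⟶ M} (h : Homotopic (f ≫ g) (𝟙 M)) {n : ℤ}
    (hN : (tensor N X).ExactAt n) : (tensor M X).ExactAt n := by
  obtain ⟨s, hs, hsd⟩ := h
  refine Cpx.ExactAt.of_retract (tensorMap X (lin f)) (tensorMap X (lin g)) (tensorMap X s)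
    (fun _ _ => tensorMap_lin_mem f) (tensorMap_lin_d f) (fun _ _ => tensorMap_lin_mem g)
    (tensorMap_lin_d g) (fun _ _ => tensorMap_mem (-1) hs) (fun x => ?_) hN
  induction x using tensor_induction with
  | h0 => simp
  | hadd x y hx hy => simp only [map_add, add_sub_add_comm, hx, hy]; abel
  | hs n x hx y =>
    have h1 := hsd x
    rw [lin_comp, lin_id] at h1
    rw [tensor_d_mk hx, tensorMap_mk, tensorMap_mk, tensorMap_mk, tensor_d_mk (hs n x hx),
      map_add, map_negOnePow_smul, tensorMap_mk, tensorMap_mk, ← map_sub,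
      ← TensorProduct.sub_tmul, h1, TensorProduct.add_tmul, map_add, Int.negOnePow_sub,
      Int.negOnePow_one]
    simp only [mul_neg, mul_one, Units.neg_smul]
    abel

end

/-! ### Partial resolutions by free modules on sets of generators -/

/-- A subspace `U` of `V` has a complement in `V` with a basis consisting of values of `v`, if every
vector of `V` is a value of `v`. -/
lemma exists_linearIndepOn_complement {ι W : Type*} [AddCommGroup W] [Module k W] (v : ι → W)
    (G : Set ι) {U V : Submodule k W} (hUV : U ≤ V) (hv : ∀ w ∈ V, ∃ i ∈ G, v i = w) :
    ∃ N : Set ι, (∀ i ∈ N, i ∈ G ∧ v i ∈ V) ∧ LinearIndepOn k v N ∧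
      Disjoint (Submodule.span k (v '' N)) U ∧ V ≤ U ⊔ Submodule.span k (v '' N) := by
  obtain ⟨U', hU'⟩ := exists_isCompl U
  obtain ⟨N, hN, -, hspan, hind⟩ := exists_linearIndepOn_extension (K := k) (v := v)
    (linearIndepOn_empty k v) (Set.empty_subset {i | i ∈ G ∧ v i ∈ U' ⊓ V})
  have hle : Submodule.span k (v '' N) ≤ U' ⊓ V := by
    rw [Submodule.span_le]
    rintro _ ⟨i, hi, rfl⟩
    exact (hN hi).2
  refine ⟨N, fun i hi => ⟨(hN hi).1, (hN hi).2.2⟩, hind,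
    hU'.disjoint.symm.mono_left (hle.trans inf_le_left), fun w hw => ?_⟩
  obtain ⟨y, hy, z, hz, rfl⟩ := Submodule.mem_sup.1 (hU'.sup_eq_top ▸ Submodule.mem_top (x := w))
  have hzV : z ∈ V := by
    have := sub_mem hw (hUV hy)
    rwa [add_sub_cancel_left] at this
  obtain ⟨i, hi, rfl⟩ := hv z hzV
  exact Submodule.add_mem_sup hy (hspan ⟨i, ⟨hi, hz, hzV⟩, rfl⟩)

namespace Res

variable {M : DGModule A}

variable (M) in
/-- The augmentation of the free module on all generators, as a `k`-linear map. -/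
noncomputable def augLin : F M →ₗ[k] M.carrier :=
  (ext fun g : Gen M => g.dm.2).restrictScalars k

lemma augLin_mem {n : ℤ} {x : F M} (hx : x ∈ gr M n) : augLin M x ∈ M.gr n := ext_mem hx

lemma augLin_D (x : F M) : augLin M (D x) = M.d (augLin M x) := ext_D x

/-- Every admissible differential and image in `M` are those of a generator. -/
lemma exists_gen {j : ℤ} {y : F M} (hy : y ∈ gr M (j + 1)) (hd : D y = 0) {t : M.carrier}
    (ht : t ∈ M.gr j) (hty : M.d t = augLin M y) : ∃ g : Gen M, g.deg = j ∧ g.dm = (y, t) := by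
  let e := y.support.equivFin
  let g : Gen M := .mk _ (fun i => (e.symm i : Gen M)) (fun i => y (e.symm i)) t j
  have hsum : ∑ i, Finsupp.single (e.symm i : Gen M) (y (e.symm i)) = y := by
    rw [Equiv.sum_comp e.symm (fun g : y.support => Finsupp.single (g : Gen M) (y g)),
      Finset.sum_coe_sort y.support (fun g => Finsupp.single g (y g))]
    exact Finsupp.sum_single y
  refine ⟨g, rfl, ?_⟩
  rw [Gen.dm, if_pos, hsum]
  refine ⟨fun i => hy (e.symm i), ht, ?_, ?_⟩
  · rw [← hsum] at hd
    simpa only [map_sum, D_single] using hd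
  · have h : ext (fun g : Gen M => g.dm.2)
        (∑ i, Finsupp.single (e.symm i : Gen M) (y (e.symm i))) = M.d t := by
      rw [hsum, hty]
      rfl
    simpa only [map_sum, ext_single] using h

variable (M) in
/-- The combinations of generators with scalar coefficients. -/
noncomputable def scalarComb : (Gen M →₀ k) →ₗ[k] F M :=
  Finsupp.mapRange.linearMap (Algebra.linearMap k A.carrier)

lemma scalarComb_apply (c : Gen M →₀ k) (g : Gen M) :
    scalarComb M c g = algebraMap k A.carrier (c g) := rfl

lemma scalarComb_single (g : Gen M) (r : k) :
    scalarComb M (Finsupp.single g r) = r • (Finsupp.single g 1 : F M) := by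
  rw [scalarComb, Finsupp.mapRange.linearMap_apply, Finsupp.mapRange_single, Finsupp.smul_single,
    Algebra.linearMap_apply, Algebra.algebraMap_eq_smul_one]

lemma D_scalarComb (c : Gen M →₀ k) :
    (D (scalarComb M c), augLin M (scalarComb M c)) =
      Finsupp.linearCombination k (Gen.dm (M := M)) c := by
  induction c using Finsupp.induction_linear with
  | zero => simp
  | add x y hx hy => rw [map_add, map_add, map_add, map_add, ← hx, ← hy, Prod.mk_add_mk]
  | single g r =>
    have h : augLin M (Finsupp.single g 1) = g.dm.2 := by simp [augLin]
    rw [scalarComb_single, map_smul, map_smul, D_single_one, h,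
      Finsupp.linearCombination_single]
    rfl

lemma scalarComb_mem_gr {j : ℤ} {c : Gen M →₀ k} (hc : ∀ g, c g ≠ 0 → g.deg = j) :
    scalarComb M c ∈ gr M j := by
  intro g
  rw [scalarComb_apply]
  by_cases h : c g = 0
  · rw [h, map_zero]
    exact zero_mem _
  · rw [hc g h, sub_self, Algebra.algebraMap_eq_smul_one]
    exact Submodule.smul_mem _ _ SetLike.GradedOne.one_mem

lemma D_apply {x : F M} {g : Gen M} (h : ∀ g', x g' ≠ 0 → g'.dm.1 g = 0) :
    D x g = g.deg.negOnePow • A.d (x g) :=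
  freeD_apply (deg := Gen.deg) (bd := fun g : Gen M => g.dm.1) h

/-- The elements of the free module which only involve the generators in `T`. -/
abbrev on (T : Set (Gen M)) : Submodule k (F M) := Finsupp.supported A.carrier k T

lemma mem_on {T : Set (Gen M)} {x : F M} : x ∈ on T ↔ ∀ g ∉ T, x g = 0 :=
  Finsupp.mem_supported' k x

lemma mem_on_of_apply_ne_zero {T : Set (Gen M)} {x : F M} (hx : x ∈ on T) {g : Gen M}
    (h : x g ≠ 0) : g ∈ T := by
  by_contra hg
  exact h (mem_on.1 hx g hg)

lemma on_mono {T T' : Set (Gen M)} (h : T ⊆ T') : on T ≤ on T' :=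
  Finsupp.supported_mono h

lemma D_mem_on {T : Set (Gen M)} (hT : ∀ g ∈ T, g.dm.1 ∈ on T) {x : F M} (hx : x ∈ on T) :
    D x ∈ on T := by
  rw [mem_on]
  intro g hg
  rw [D_apply, mem_on.1 hx g hg, map_zero, smul_zero]
  exact fun g' hg' => mem_on.1 (hT g' (mem_on_of_apply_ne_zero hx hg')) g hg

/-- Elements of degree `m` only involve generators of degree at most `m`. -/
lemma mem_on_of_mem_gr (hA : ∀ n < 0, A.gr n = ⊥) {T T' : Set (Gen M)} {m : ℤ}
    (h : ∀ g ∈ T', g.deg ≤ m → g ∈ T) {x : F M} (hx : x ∈ gr M m) (hx' : x ∈ on T') :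
    x ∈ on T := by
  rw [mem_on]
  intro g hg
  by_contra hne
  have hlt : ¬g.deg ≤ m := fun hle => hg (h g (mem_on_of_apply_ne_zero hx' hne) hle)
  have := hx g
  rw [hA _ (by omega), Submodule.mem_bot] at this
  exact hne this

variable (M) in
/-- `T` generates a partial resolution: its generators have degrees in `[b, j)` and span a
subcomplex, on which the augmentation is bijective on cohomology in degrees less than `j` and
injective in degree `j`. -/
structure Stage (b j : ℤ) (T : Set (Gen M)) : Prop where
  le_deg : ∀ g ∈ T, b ≤ g.deg
  deg_lt : ∀ g ∈ T, g.deg < j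
  dm_mem_on : ∀ g ∈ T, g.dm.1 ∈ on T
  dm_eq_zero : ∀ g ∈ T, ∀ g', g.deg ≤ g'.deg → g.dm.1 g' = 0
  surj : ∀ m < j, ∀ t ∈ M.gr m, M.d t = 0 →
    ∃ x ∈ gr M m ⊓ on T, D x = 0 ∧ ∃ t' ∈ M.gr (m - 1), M.d t' = t - augLin M x
  inj : ∀ m ≤ j, ∀ x ∈ gr M m ⊓ on T, D x = 0 → ∀ t ∈ M.gr (m - 1), M.d t = augLin M x →
    ∃ z ∈ gr M (m - 1) ⊓ on T, D z = x

lemma stage_empty (b : ℤ) (hM : ∀ n < b, M.toCpx.ExactAt n) : Stage M b b ∅ where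
  le_deg := fun g hg => hg.elim
  deg_lt := fun g hg => hg.elim
  dm_mem_on := fun g hg => hg.elim
  dm_eq_zero := fun g hg => hg.elim
  surj := fun m hm t ht hd => by
    obtain ⟨t', ht', h⟩ := hM m hm t ht hd
    exact ⟨0, zero_mem _, map_zero _, t', ht', by rw [map_zero, sub_zero]; exact h⟩
  inj := fun m hm x hx _ _ _ _ => ⟨0, zero_mem _, by
    rw [map_zero]
    ext g
    exact (mem_on.1 hx.2 g (Set.notMem_empty g)).symm⟩

/-- The differentials and images in `M` which a generator of degree `j` attached to the subcomplex
generated by `T` can have; up to signs, the cocycles of the cone of the augmentation. -/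
def attach (j : ℤ) (T : Set (Gen M)) : Submodule k (F M × M.carrier) where
  carrier := {p | p.1 ∈ gr M (j + 1) ⊓ on T ∧ D p.1 = 0 ∧ p.2 ∈ M.gr j ∧ M.d p.2 = augLin M p.1}
  zero_mem' := ⟨zero_mem _, map_zero _, zero_mem _, by simp⟩
  add_mem' := fun hp hq => ⟨add_mem hp.1 hq.1, by
      rw [Prod.fst_add, map_add, hp.2.1, hq.2.1, add_zero], add_mem hp.2.2.1 hq.2.2.1, by
      rw [Prod.fst_add, Prod.snd_add, map_add, map_add, hp.2.2.2, hq.2.2.2]⟩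
  smul_mem' := fun c p hp => ⟨Submodule.smul_mem _ c hp.1, by
      rw [Prod.smul_fst, map_smul, hp.2.1, smul_zero], Submodule.smul_mem _ c hp.2.2.1, by
      rw [Prod.smul_fst, Prod.smul_snd, map_smul, map_smul, hp.2.2.2]⟩

/-- The elements of `attach j T` which are, up to signs, coboundaries in the cone of the
augmentation. -/
def attachBdry (j : ℤ) (T : Set (Gen M)) : Submodule k (F M × M.carrier) where
  carrier := {p | ∃ z ∈ gr M j ⊓ on T, ∃ t ∈ M.gr (j - 1), p = (D z, augLin M z + M.d t)}
  zero_mem' := ⟨0, zero_mem _, 0, zero_mem _, by simp only [map_zero, add_zero]; rfl⟩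
  add_mem' := by
    rintro _ _ ⟨z, hz, t, ht, rfl⟩ ⟨z', hz', t', ht', rfl⟩
    refine ⟨z + z', add_mem hz hz', t + t', add_mem ht ht', ?_⟩
    rw [map_add, map_add, map_add, Prod.mk_add_mk, add_add_add_comm]
  smul_mem' := by
    rintro c _ ⟨z, hz, t, ht, rfl⟩
    refine ⟨c • z, Submodule.smul_mem _ c hz, c • t, Submodule.smul_mem _ c ht, ?_⟩
    rw [map_smul, map_smul, map_smul, Prod.smul_mk, smul_add]

lemma attachBdry_le {j : ℤ} {T : Set (Gen M)} (hT : ∀ g ∈ T, g.dm.1 ∈ on T) :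
    attachBdry j T ≤ attach j T := by
  rintro _ ⟨z, hz, t, ht, rfl⟩
  refine ⟨⟨D_mem hz.1, D_mem_on hT hz.2⟩, D_D z, add_mem (augLin_mem hz.1) ?_, ?_⟩
  · simpa using M.d_mem ht
  · rw [map_add, M.d_d, add_zero, augLin_D]

end Res

/-! ### Cohomology of a simply connected algebra in degrees `0` and `1` -/

namespace DGAlgebra.IsSimplyConnectedOfFiniteType

lemma not_exactAt_zero (hA : A.IsSimplyConnectedOfFiniteType) : ¬A.toCpx.ExactAt 0 := by
  rw [← Cpx.nontrivial_H_iff]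
  exact hA.h_zero.some.toEquiv.nontrivial

lemma exactAt_of_neg (hA : A.IsSimplyConnectedOfFiniteType) {n : ℤ} (hn : n < 0) :
    A.toCpx.ExactAt n := by
  have h0 : ∀ x ∈ A.gr n, x = 0 := fun x hx => by
    rwa [hA.gr_eq_bot n hn, Submodule.mem_bot] at hx
  exact fun x hx _ => ⟨0, zero_mem _, (map_zero _).trans (h0 x hx).symm⟩

lemma d_eq_zero (hA : A.IsSimplyConnectedOfFiniteType) {n : ℤ} (hn : n < 0) {y : A.carrier}
    (hy : y ∈ A.gr n) : A.d y = 0 := by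
  rw [hA.gr_eq_bot n hn, Submodule.mem_bot] at hy
  rw [hy, map_zero]

lemma one_ne_zero (hA : A.IsSimplyConnectedOfFiniteType) : (1 : A.carrier) ≠ 0 := by
  intro h
  have h0 : ∀ x : A.carrier, x = 0 := fun x => by rw [← mul_one x, h, mul_zero]
  exact hA.not_exactAt_zero fun x _ _ => ⟨0, zero_mem _, (map_zero _).trans (h0 x).symm⟩

/-- The cocycles of degree `0` are the scalars. -/
lemma exists_eq_algebraMap (hA : A.IsSimplyConnectedOfFiniteType) {a : A.carrier}
    (ha : a ∈ A.gr 0) (hd : A.d a = 0) : ∃ c : k, a = algebraMap k A.carrier c := by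
  obtain ⟨φ⟩ := hA.h_zero
  let cls : A.toCpx.Z 0 →ₗ[k] k := φ.toLinearMap ∘ₗ Submodule.mkQ _
  have hcls : ∀ z : A.toCpx.Z 0, cls z = 0 → z.1 = 0 := by
    intro z hz
    have h0 : (Submodule.Quotient.mk z : A.toCpx.H 0) = 0 := φ.map_eq_zero_iff.1 hz
    rw [Submodule.Quotient.mk_eq_zero] at h0
    obtain ⟨y, hy, hyz⟩ := h0
    exact hyz.symm.trans (hA.d_eq_zero (by norm_num) hy)
  let z1 : A.toCpx.Z 0 := ⟨(1 : A.carrier), Res.d_one A,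
    (SetLike.GradedOne.one_mem : (1 : A.carrier) ∈ A.gr 0)⟩
  let za : A.toCpx.Z 0 := ⟨a, hd, ha⟩
  have h1 : cls z1 ≠ 0 := fun h => hA.one_ne_zero (hcls z1 h)
  refine ⟨cls za / cls z1, ?_⟩
  have h := hcls (za - (cls za / cls z1) • z1) (by
    rw [map_sub, map_smul, smul_eq_mul, div_mul_cancel₀ _ h1, sub_self])
  rw [Algebra.algebraMap_eq_smul_one]
  exact sub_eq_zero.1 h

lemma exists_d_eq (hA : A.IsSimplyConnectedOfFiniteType) {a : A.carrier} (ha : a ∈ A.gr 1)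
    (hd : A.d a = 0) : ∃ b ∈ A.gr 0, A.d b = a := by
  have h : A.toCpx.ExactAt 1 := by
    by_contra h
    rw [← Cpx.nontrivial_H_iff] at h
    exact not_subsingleton _ hA.h_one
  obtain ⟨b, hb, hba⟩ := h a ha hd
  rw [sub_self] at hb
  exact ⟨b, hb, hba⟩

end DGAlgebra.IsSimplyConnectedOfFiniteType

/-! ### Attaching generators along a basis -/

namespace Res

variable {M : DGModule A}

/-- A vector in the span of the values of `dm` on `N` is the value on a scalar combination. -/
lemma exists_scalarComb {N : Set (Gen M)} {p : F M × M.carrier}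
    (hp : p ∈ Submodule.span k (Gen.dm '' N)) : ∃ c ∈ Finsupp.supported k k N,
      (D (scalarComb M c), augLin M (scalarComb M c)) = p := by
  obtain ⟨c, hc, rfl⟩ := (Finsupp.mem_span_image_iff_linearCombination k).1 hp
  exact ⟨c, hc, D_scalarComb c⟩

lemma scalarComb_mem_on {N : Set (Gen M)} {c : Gen M →₀ k} (hc : c ∈ Finsupp.supported k k N) :
    scalarComb M c ∈ on N := by
  rw [mem_on]
  intro g hg
  rw [scalarComb_apply, (Finsupp.mem_supported' k c).1 hc g hg, map_zero]

/-- Splitting an element along the old and the new generators. -/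
lemma exists_add_of_mem_on_union {T N : Set (Gen M)} {n : ℤ} {x : F M}
    (hx : x ∈ gr M n ⊓ on (T ∪ N)) :
    ∃ y ∈ gr M n ⊓ on T, ∃ z ∈ gr M n ⊓ on N, x = y + z := by
  classical
  refine ⟨x.filter (· ∈ T), ⟨fun g => ?_, ?_⟩, x.filter (· ∉ T), ⟨fun g => ?_, ?_⟩,
    (Finsupp.filter_add_filter_not x _).symm⟩
  · rw [Finsupp.filter_apply]
    split_ifs
    exacts [hx.1 g, zero_mem _]
  · exact mem_on.2 fun g hg => Finsupp.filter_apply_neg _ _ hg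
  · rw [Finsupp.filter_apply]
    split_ifs
    exacts [zero_mem _, hx.1 g]
  · refine mem_on.2 fun g hg => ?_
    rw [Finsupp.filter_apply]
    split_ifs with h
    · rfl
    · exact mem_on.1 hx.2 g (by simp [hg, h])

/-- Attaching generators of degree `j` along a basis of the degree `j` cohomology of the cone of
the augmentation extends a partial resolution by one degree. Since the basis is linearly independent
in cohomology and `H⁰ A = k`, no new classes arise in degree `j`; since `H¹ A = 0`, none arise in
degree `j + 1`. -/
lemma Stage.exists_succ (hA : A.IsSimplyConnectedOfFiniteType) {b j : ℤ} (hbj : b ≤ j)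
    {T : Set (Gen M)} (hT : Stage M b j T) :
    ∃ T', T ⊆ T' ∧ Stage M b (j + 1) T' ∧ ∀ g ∈ T', g.deg < j → g ∈ T := by
  obtain ⟨N, hN, hind, hdisj, hspan⟩ := exists_linearIndepOn_complement (k := k) (Gen.dm (M := M))
    {g | g.deg = j} (attachBdry_le (j := j) hT.dm_mem_on) (by
      rintro ⟨y, t⟩ ⟨hy, hd, ht, hty⟩
      exact exists_gen hy.1 hd ht hty)
  have hNdeg : ∀ g ∈ N, g.deg = j := fun g hg => (hN g hg).1
  have hNT : ∀ g ∈ N, g.dm.1 ∈ on T := fun g hg => (hN g hg).2.1.2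
  have hdis : ∀ g ∈ N, g ∉ T := fun g hg hgT => by
    have := hT.deg_lt g hgT
    have := hNdeg g hg
    omega
  have hold : ∀ g ∈ T ∪ N, g.deg < j → g ∈ T := by
    rintro g (hg | hg) hlt
    · exact hg
    · exact absurd (hNdeg g hg) hlt.ne
  have hclosed : ∀ g ∈ T ∪ N, g.dm.1 ∈ on T := by
    rintro g (hg | hg)
    exacts [hT.dm_mem_on g hg, hNT g hg]
  -- The differential of a generator never involves new generators.
  have hcoef : ∀ x ∈ on (T ∪ N), ∀ g ∈ N, D x g = g.deg.negOnePow • A.d (x g) := by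
    intro x hx g hg
    exact D_apply fun g' hg' =>
      mem_on.1 (hclosed g' (mem_on_of_apply_ne_zero hx hg')) g (hdis g hg)
  have hcocycle : ∀ x ∈ on (T ∪ N), D x = 0 → ∀ g ∈ N, A.d (x g) = 0 := by
    intro x hx hd g hg
    have h := hcoef x hx g hg
    rw [hd, Finsupp.zero_apply, eq_comm, smul_eq_zero_iff_eq] at h
    exact h
  have hcomb : ∀ c ∈ Finsupp.supported k k N, scalarComb M c ∈ gr M j ⊓ on (T ∪ N) :=
    fun c hc => ⟨scalarComb_mem_gr fun g hg => hNdeg g (by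
      by_contra hgN
      exact hg ((Finsupp.mem_supported' k c).1 hc g hgN)),
      on_mono Set.subset_union_right (scalarComb_mem_on hc)⟩
  -- Every pair in `attach j T` becomes a coboundary.
  have hkill : ∀ y t, (y, t) ∈ attach j T → ∃ x ∈ gr M j ⊓ on (T ∪ N), D x = y ∧
      ∃ t' ∈ M.gr (j - 1), M.d t' = t - augLin M x := by
    intro y t hyt
    obtain ⟨p, ⟨z, hz, t', ht', rfl⟩, q, hq, hpq⟩ := Submodule.mem_sup.1 (hspan hyt)
    obtain ⟨c, hc, rfl⟩ := exists_scalarComb hq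
    obtain ⟨h1, h2⟩ := Prod.ext_iff.1 hpq
    simp only [Prod.fst_add, Prod.snd_add] at h1 h2
    refine ⟨z + scalarComb M c, add_mem ⟨hz.1, on_mono Set.subset_union_left hz.2⟩ (hcomb c hc),
      by rw [map_add, h1], t', ht', ?_⟩
    rw [← h2, map_add]
    abel
  refine ⟨T ∪ N, Set.subset_union_left, ⟨?_, ?_, ?_, ?_, ?_, ?_⟩, hold⟩
  · rintro g (hg | hg)
    · exact hT.le_deg g hg
    · exact hbj.trans (hNdeg g hg).ge
  · rintro g (hg | hg)
    · exact (hT.deg_lt g hg).trans (lt_add_one j)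
    · rw [hNdeg g hg]
      exact lt_add_one j
  · exact fun g hg => on_mono Set.subset_union_left (hclosed g hg)
  · rintro g (hg | hg) g' hle
    · exact hT.dm_eq_zero g hg g' hle
    · refine mem_on.1 (hNT g hg) g' fun hg' => ?_
      have := hT.deg_lt g' hg'
      have := hNdeg g hg
      omega
  · intro m hm t ht hd
    obtain hlt | rfl := (Int.lt_add_one_iff.1 hm).lt_or_eq
    · obtain ⟨x, hx, h⟩ := hT.surj m hlt t ht hd
      exact ⟨x, ⟨hx.1, on_mono Set.subset_union_left hx.2⟩, h⟩
    · exact hkill 0 t ⟨zero_mem _, map_zero _, ht, by rw [hd, map_zero]⟩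
  · intro m hm x hx hd t ht htx
    have fin : ∀ m ≤ j, x ∈ gr M m ⊓ on T → t ∈ M.gr (m - 1) →
        ∃ z ∈ gr M (m - 1) ⊓ on (T ∪ N), D z = x := by
      intro m hm hx ht
      obtain ⟨z, hz, h⟩ := hT.inj m hm x hx hd t ht htx
      exact ⟨z, ⟨hz.1, on_mono Set.subset_union_left hz.2⟩, h⟩
    obtain hlt | hge := lt_or_ge m j
    · exact fin m hlt.le ⟨hx.1, mem_on_of_mem_gr hA.gr_eq_bot
        (fun g hg hle => hold g hg (hle.trans_lt hlt)) hx.1 hx.2⟩ ht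
    obtain rfl | rfl : m = j ∨ m = j + 1 := by omega
    · -- The coefficients of `x` at the new generators are scalars, hence vanish by independence.
      refine fin m le_rfl ?_ ht
      obtain ⟨y, hy, z, hz, rfl⟩ := exists_add_of_mem_on_union hx
      have hscal : ∀ g, ∃ c : k, z g = algebraMap k A.carrier c := by
        intro g
        by_cases hg : g ∈ N
        · have hyg : y g = 0 := mem_on.1 hy.2 g (hdis g hg)
          have hdz : A.d (z g) = 0 := by
            have := hcocycle _ hx.2 hd g hg
            rwa [Finsupp.add_apply, hyg, zero_add] at this
          have hz0 := hz.1 g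
          rw [hNdeg g hg, sub_self] at hz0
          exact hA.exists_eq_algebraMap hz0 hdz
        · exact ⟨0, by rw [mem_on.1 hz.2 g hg, map_zero]⟩
      choose c₀ hc₀ using hscal
      have hinj : Function.Injective (algebraMap k A.carrier) := by
        have : Nontrivial A.carrier := ⟨1, 0, hA.one_ne_zero⟩
        exact (algebraMap k A.carrier).injective
      have hsupp : ∀ g, c₀ g ≠ 0 → g ∈ z.support := fun g hg => by
        rw [Finsupp.mem_support_iff, hc₀]
        exact fun h => hg (hinj (h.trans (map_zero _).symm))
      let c : Gen M →₀ k := Finsupp.onFinset z.support c₀ hsupp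
      have hcz : scalarComb M c = z := by
        ext g
        rw [scalarComb_apply, hc₀ g]
        rfl
      have hcN : c ∈ Finsupp.supported k k N := (Finsupp.mem_supported' k c).2 fun g hg =>
        hinj (by rw [map_zero, ← scalarComb_apply, hcz, mem_on.1 hz.2 g hg])
      have hU : Finsupp.linearCombination k (Gen.dm (M := M)) c ∈ attachBdry m T := by
        rw [← D_scalarComb, hcz]
        refine ⟨-y, neg_mem hy, t, ht, ?_⟩
        rw [map_add] at hd htx
        rw [htx, map_neg, map_neg, neg_add_cancel_left, eq_neg_of_add_eq_zero_right hd]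
      have h0 := Submodule.disjoint_def.1 hdisj _
        ((Finsupp.mem_span_image_iff_linearCombination k).2 ⟨c, hcN, rfl⟩) hU
      have hc0 : c = 0 := linearIndepOn_iff.1 hind c hcN h0
      rw [hc0, map_zero] at hcz
      rwa [← hcz, add_zero]
    · -- The coefficients of `x` at the new generators are coboundaries, and can be removed.
      have hprim : ∀ g, ∃ b ∈ A.gr 0, g ∈ N → A.d b = j.negOnePow • x g := by
        intro g
        by_cases hg : g ∈ N
        · have h1 := hx.1 g
          rw [hNdeg g hg, add_sub_cancel_left] at h1
          obtain ⟨b, hb, hbx⟩ := hA.exists_d_eq (negOnePow_smul_mem _ j h1)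
            (by rw [map_negOnePow_smul, hcocycle x hx.2 hd g hg, smul_zero])
          exact ⟨b, hb, fun _ => hbx⟩
        · exact ⟨0, zero_mem _, fun h => absurd h hg⟩
      choose p hp hpx using hprim
      classical
      -- The sign in `hprim` is that of the differential on generators of degree `j`, so that `D w`
      -- agrees with `x` on the new generators.
      let w : F M := Finsupp.onFinset (x.support.filter (· ∈ N))
        (fun g => if g ∈ N ∧ x g ≠ 0 then p g else 0) (fun g hg => by
          rw [Finset.mem_filter, Finsupp.mem_support_iff]
          by_contra h
          exact hg (if_neg fun h' => h h'.symm))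
      have hw : ∀ g, w g = if g ∈ N ∧ x g ≠ 0 then p g else 0 := fun g => rfl
      have hwm : w ∈ gr M j ⊓ on (T ∪ N) := by
        constructor
        · intro g
          rw [hw]
          split_ifs with h
          · rw [hNdeg g h.1, sub_self]
            exact hp g
          · exact zero_mem _
        · refine mem_on.2 fun g hg => ?_
          rw [hw, if_neg fun h => hg (Or.inr h.1)]
      have hwx : ∀ g ∈ N, D w g = x g := by
        intro g hg
        rw [hcoef w hwm.2 g hg, hw]
        split_ifs with h
        · rw [hpx g hg, hNdeg g hg, negOnePow_smul_smul, Int.negOnePow_even _ ⟨j, rfl⟩,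
            one_smul]
        · rw [map_zero, smul_zero]
          by_contra hne
          exact h ⟨hg, fun h0 => hne h0.symm⟩
      rw [add_sub_cancel_right] at ht ⊢
      obtain ⟨z, hz, hzd, -⟩ := hkill (x - D w) (t - augLin M w) (by
        refine ⟨⟨sub_mem hx.1 (D_mem hwm.1), mem_on.2 fun g hg => ?_⟩, ?_,
          sub_mem ht (augLin_mem hwm.1), ?_⟩
        · rw [Finsupp.sub_apply]
          by_cases hgN : g ∈ N
          · rw [hwx g hgN, sub_self]
          · have hgU : g ∉ T ∪ N := by simp [hg, hgN]
            rw [mem_on.1 hx.2 g hgU, mem_on.1 (D_mem_on (fun g hg =>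
              on_mono Set.subset_union_left (hclosed g hg)) hwm.2) g hgU, sub_self]
        · change D (x - D w) = 0
          rw [map_sub, hd, D_D, sub_self]
        · change M.d (t - augLin M w) = augLin M (x - D w)
          rw [map_sub, map_sub, htx, augLin_D])
      exact ⟨w + z, add_mem hwm hz, by rw [map_add, hzd, add_sub_cancel]⟩

end Res

/-! ### Semifree resolutions -/

namespace Res

variable {M : DGModule A}

/-- A set of generators which is closed under the differential and on which the augmentation is
bijective on cohomology. -/
structure IsResolving (b : ℤ) (T : Set (Gen M)) : Prop where
  le_deg : ∀ g ∈ T, b ≤ g.deg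
  dm_mem_on : ∀ g ∈ T, g.dm.1 ∈ on T
  dm_eq_zero : ∀ g ∈ T, ∀ g', g.deg ≤ g'.deg → g.dm.1 g' = 0
  surj : ∀ m, ∀ t ∈ M.gr m, M.d t = 0 →
    ∃ x ∈ gr M m ⊓ on T, D x = 0 ∧ ∃ t' ∈ M.gr (m - 1), M.d t' = t - augLin M x
  inj : ∀ m, ∀ x ∈ gr M m ⊓ on T, D x = 0 → ∀ t ∈ M.gr (m - 1), M.d t = augLin M x →
    ∃ z ∈ gr M (m - 1) ⊓ on T, D z = x

/-- Starting from the empty set, the union of the successive partial resolutions is a resolution: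
the generators of degree less than `b + n` are all present at stage `n`. -/
lemma exists_isResolving (hA : A.IsSimplyConnectedOfFiniteType) {b : ℤ}
    (hM : ∀ n < b, M.toCpx.ExactAt n) : ∃ T : Set (Gen M), IsResolving b T := by
  have step : ∀ (n : ℕ) (T : {T : Set (Gen M) // Stage M b (b + n) T}),
      ∃ T' : {T : Set (Gen M) // Stage M b (b + (n + 1 : ℕ)) T},
        T.1 ⊆ T'.1 ∧ ∀ g ∈ T'.1, g.deg < b + n → g ∈ T.1 := by
    rintro n ⟨T, hT⟩
    obtain ⟨T', h1, h2, h3⟩ := hT.exists_succ hA (by omega)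
    exact ⟨⟨T', by rw [Nat.cast_succ, ← add_assoc]; exact h2⟩, h1, h3⟩
  choose next hnext hnext' using step
  let seq : ∀ n : ℕ, {T : Set (Gen M) // Stage M b (b + n) T} := fun n =>
    Nat.rec ⟨∅, by simpa using stage_empty b hM⟩ (fun n T => next n T) n
  have hmono : Monotone fun n => (seq n).1 := monotone_nat_of_le_succ fun n => hnext n (seq n)
  have hstable : ∀ m n : ℕ, ∀ g ∈ (seq m).1, g.deg < b + n → g ∈ (seq n).1 := by
    intro m n g hg hlt
    obtain hmn | hnm := le_total m n
    · exact hmono hmn hg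
    · induction m, hnm using Nat.le_induction with
      | base => exact hg
      | succ m hm ih => exact ih (hnext' m (seq m) g hg (by omega))
  have hsub : ∀ n, (seq n).1 ⊆ ⋃ n, (seq n).1 := fun n => Set.subset_iUnion (fun n => (seq n).1) n
  refine ⟨⋃ n, (seq n).1, ⟨?_, ?_, ?_, ?_, ?_⟩⟩
  · intro g hg
    obtain ⟨n, hn⟩ := Set.mem_iUnion.1 hg
    exact (seq n).2.le_deg g hn
  · intro g hg
    obtain ⟨n, hn⟩ := Set.mem_iUnion.1 hg
    exact on_mono (hsub n) ((seq n).2.dm_mem_on g hn)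
  · intro g hg
    obtain ⟨n, hn⟩ := Set.mem_iUnion.1 hg
    exact (seq n).2.dm_eq_zero g hn
  · intro m t ht hd
    obtain ⟨x, hx, h⟩ := (seq (m + 1 - b).toNat).2.surj m (by omega) t ht hd
    exact ⟨x, ⟨hx.1, on_mono (hsub _) hx.2⟩, h⟩
  · intro m x hx hd t ht htx
    obtain ⟨z, hz, h⟩ := (seq (m + 1 - b).toNat).2.inj m (by omega) x ⟨hx.1,
      mem_on_of_mem_gr hA.gr_eq_bot (fun g hg hle => by
        obtain ⟨n, hn⟩ := Set.mem_iUnion.1 hg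
        exact hstable n _ g hn (by omega)) hx.1 hx.2⟩ hd t ht htx
    exact ⟨z, ⟨hz.1, on_mono (hsub _) hz.2⟩, h⟩

section embed

variable (T : Set (Gen M))

/-- The inclusion of the free module on `T` into the free module on all generators. -/
noncomputable def embed : (T →₀ A.carrier) →ₗ[A.carrierᵐᵒᵖ] F M :=
  Finsupp.lmapDomain A.carrier A.carrierᵐᵒᵖ Subtype.val

variable {T}

lemma embed_single (g : T) (a : A.carrier) :
    embed T (Finsupp.single g a) = Finsupp.single g.1 a :=
  Finsupp.mapDomain_single

lemma embed_apply (x : T →₀ A.carrier) (g : T) : embed T x g.1 = x g :=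
  Finsupp.mapDomain_apply Subtype.val_injective x g

lemma embed_mem_on (x : T →₀ A.carrier) : embed T x ∈ on T :=
  mem_on.2 fun _ hg => Finsupp.mapDomain_of_notMem_range x _ (by simpa using hg)

lemma embed_injective : Function.Injective (embed T) :=
  Finsupp.mapDomain_injective Subtype.val_injective

lemma embed_mem_gr {n : ℤ} {x : T →₀ A.carrier} :
    embed T x ∈ gr M n ↔ x ∈ freeGr A (fun g : T => g.1.deg) n := by
  refine ⟨fun h g => embed_apply x g ▸ h g.1, fun h g => ?_⟩
  by_cases hg : g ∈ T
  · exact (embed_apply x ⟨g, hg⟩).symm ▸ h ⟨g, hg⟩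
  · rw [mem_on.1 (embed_mem_on x) g hg]
    exact zero_mem _

lemma exists_embed_eq {x : F M} (hx : x ∈ on T) : ∃ y, embed T y = x := by
  refine ⟨x.comapDomain Subtype.val Subtype.val_injective.injOn, ?_⟩
  ext g
  by_cases hg : g ∈ T
  · exact embed_apply _ ⟨g, hg⟩
  · rw [mem_on.1 (embed_mem_on _) g hg, mem_on.1 hx g hg]

/-- The free module on a resolving set of generators is a subcomplex. -/
lemma exists_bd {b : ℤ} (hT : IsResolving b T) : ∃ bd : T → T →₀ A.carrier,
    (∀ g, embed T (bd g) = g.1.dm.1) ∧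
      ∀ x, embed T (freeD (fun g : T => g.1.deg) bd x) = D (embed T x) := by
  choose bd hbd using fun g : T => exists_embed_eq (hT.dm_mem_on g.1 g.2)
  refine ⟨bd, hbd, fun x => ?_⟩
  induction x using Finsupp.induction_linear with
  | zero => simp
  | add x y hx hy => simp only [map_add, hx, hy]
  | single g c =>
    rw [freeD_single, embed_single, D_single, map_add, map_smul, hbd, map_negOnePow_smul,
      embed_single]

end embed

end Res

/-- Over a simply connected algebra, a module with cohomology bounded below by `b` has a semifree
resolution with generators of degrees at least `b`, such that the differential of each generator
only involves generators of smaller degree. -/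
lemma exists_semiBasis_qiso (hA : A.IsSimplyConnectedOfFiniteType) {M : DGModule A} {b : ℤ}
    (hM : ∀ n < b, M.toCpx.ExactAt n) : ∃ S : SemiBasis A, (∀ i, b ≤ S.deg i) ∧
      ∃ e : S.toModule ⟶ M, QIso e := by
  obtain ⟨T, hT⟩ := Res.exists_isResolving hA hM
  obtain ⟨bd, hbd, hD⟩ := Res.exists_bd hT
  let S : SemiBasis A :=
    { ι := T
      deg := fun g => g.1.deg
      bd := bd
      bd_mem := fun g => Res.embed_mem_gr.1 (by rw [hbd]; exact Res.dm_mem g.1)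
      bd_bd := fun g => Res.embed_injective (by rw [hD, hbd, Res.D_dm, map_zero])
      bd_eq_zero := fun g g' h => by
        rw [← Res.embed_apply, hbd]
        exact hT.dm_eq_zero g.1 g.2 g'.1 h }
  let e : S.toModule ⟶ M :=
    { toLin := (Res.ext fun g : Res.Gen M => g.dm.2) ∘ₗ Res.embed T
      map_mem := fun h => Res.ext_mem (Res.embed_mem_gr.2 h)
      map_d := fun x => (congrArg (Res.augLin M) (hD x)).trans (Res.augLin_D _) }
  refine ⟨S, fun g => hT.le_deg g.1 g.2, e, ?_⟩
  intro n
  constructor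
  · rw [injective_iff_map_eq_zero]
    intro y hy
    obtain ⟨⟨y, hy1, hy2⟩, rfl⟩ := Submodule.Quotient.mk_surjective _ y
    rw [Res.mapH_mk, Res.mk_eq_zero_iff] at hy
    obtain ⟨t, ht, ht'⟩ := hy
    rw [Res.mk_eq_zero_iff]
    have hd : Res.D (Res.embed T y) = 0 :=
      (hD y).symm.trans ((congrArg (Res.embed T) hy1).trans (map_zero _))
    obtain ⟨z, hz, hzy⟩ := hT.inj n (Res.embed T y) ⟨Res.embed_mem_gr.2 hy2, Res.embed_mem_on y⟩ hd
      t ht ht'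
    obtain ⟨z, rfl⟩ := Res.exists_embed_eq hz.2
    exact ⟨z, Res.embed_mem_gr.1 hz.1, Res.embed_injective ((hD z).trans hzy)⟩
  · intro t
    obtain ⟨⟨t, ht1, ht2⟩, rfl⟩ := Submodule.Quotient.mk_surjective _ t
    obtain ⟨x, hx, hxd, t', ht', h⟩ := hT.surj n t ht2 ht1
    obtain ⟨x, rfl⟩ := Res.exists_embed_eq hx.2
    have hd : S.toModule.d x = 0 := Res.embed_injective ((hD x).trans (hxd.trans (map_zero _).symm))
    refine ⟨Submodule.Quotient.mk ⟨x, hd, Res.embed_mem_gr.1 hx.1⟩, ?_⟩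
    rw [Res.mapH_mk, eq_comm, ← sub_eq_zero, ← Submodule.Quotient.mk_sub, Res.mk_eq_zero_iff]
    exact ⟨t', ht', h⟩

/-! ### The amplitude inequalities -/

lemma IsCompactObj.of_iso {C : Type (u + 1)} [Category C] {M N : C} (e : M ≅ N)
    (hM : IsCompactObj M) : IsCompactObj N := by
  intro I Y c hc f
  obtain ⟨S, c', hc', g, hg⟩ := hM I Y c hc (e.hom ≫ f)
  exact ⟨S, c', hc', e.inv ≫ g, by rw [Category.assoc, hg, e.inv_hom_id_assoc]⟩

lemma DGModule.QIso.exactAt_iff {M N : DGModule A} {f : M ⟶ N} (hf : QIso f) (n : ℤ) :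
    M.toCpx.ExactAt n ↔ N.toCpx.ExactAt n := by
  rw [← not_iff_not, ← Cpx.nontrivial_H_iff, ← Cpx.nontrivial_H_iff]
  exact (Equiv.ofBijective _ (hf n)).nontrivial_congr

lemma Cpx.le_amp {V : Cpx k} {p q : ℤ} (hp : ¬V.ExactAt p) (hp' : ∀ n < p, V.ExactAt n)
    (hq : ¬V.ExactAt q) : (((q - p : ℤ) : ℝ) : EReal) ≤ V.amp := by
  rw [Cpx.amp, infH_eq hp hp', Int.cast_sub, EReal.coe_sub]
  exact EReal.sub_le_sub (le_supH hq) le_rfl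

/-- A nonzero compact module over a simply connected algebra has a semifree resolution with a basis
which has elements of smallest and of largest degree. -/
lemma exists_semiBasis_of_isCompactObj (hA : A.IsSimplyConnectedOfFiniteType) {M : DGModule A}
    (hM : IsCompactObj ((toDer A).obj M)) (hM0 : ¬IsZero ((toDer A).obj M)) :
    ∃ (S : SemiBasis A) (i₀ i₁ : S.ι), (∀ i, S.deg i₀ ≤ S.deg i) ∧ (∀ i, S.deg i ≤ S.deg i₁) ∧
      ∃ e : S.toModule ⟶ M, QIso e := by
  obtain ⟨b, hb⟩ := exists_bound_of_isCompactObj hA.gr_eq_bot hM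
  obtain ⟨S, hS, e, he⟩ := exists_semiBasis_qiso hA hb
  have := isIso_toDer_map he
  obtain ⟨c, hc⟩ := SemiBasis.exists_bound_of_isCompactObj hA.gr_eq_bot hA.one_ne_zero hS
    (hM.of_iso (asIso ((toDer A).map e)).symm)
  have hne : Nonempty S.ι := by
    by_contra hne
    rw [not_nonempty_iff] at hne
    refine hM0 (isZero_toDer_of_exactAt fun n => (he.exactAt_iff n).1 fun x _ _ => ?_)
    exact ⟨0, zero_mem _, (map_zero _).trans (Subsingleton.elim (α := S.ι →₀ A.carrier) 0 x)⟩
  have hfin : (Set.range S.deg).Finite := (Set.finite_Ico b c).subset (by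
    rintro _ ⟨i, rfl⟩
    exact ⟨hS i, hc i⟩)
  obtain ⟨_, ⟨i₀, rfl⟩, h₀⟩ := hfin.exists_minimalFor id _ (Set.range_nonempty _)
  obtain ⟨_, ⟨i₁, rfl⟩, h₁⟩ := hfin.exists_maximalFor id _ (Set.range_nonempty _)
  refine ⟨S, i₀, i₁, fun i => ?_, fun i => ?_, e, he⟩
  · obtain h | h := le_total (S.deg i₀) (S.deg i)
    exacts [h, h₀ ⟨i, rfl⟩ h]
  · obtain h | h := le_total (S.deg i) (S.deg i₁)
    exacts [h, h₁ ⟨i, rfl⟩ h]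

/-- The derived tensor product can be computed with a semifree resolution. -/
lemma exactAt_derivedTensor_iff {S : SemiBasis A} {b : ℤ} (hb : ∀ i, b ≤ S.deg i) {M : DGModule A}
    {e : S.toModule ⟶ M} (he : QIso e) (X : DGModule A.op) (n : ℤ) :
    (derivedTensor M X).ExactAt n ↔ (tensor S.toModule X).ExactAt n := by
  obtain ⟨e', hP, he'⟩ := hProj_spec M
  obtain ⟨f, g, hfg, hgf⟩ := hP.exists_homotopyEquiv (SemiBasis.isHProjective hb) he' he
  exact ⟨exactAt_tensor_of_homotopic hgf, exactAt_tensor_of_homotopic hfg⟩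

end DG

theorem proposition3p11 {k : Type u} [Field k] (A : DG.DGAlgebra k)
    (hA : A.IsSimplyConnectedOfFiniteType)
    (M : DG.DGModule A) (hM : DG.IsCompactObj ((DG.toDer A).obj M))
    (hM0 : ¬ CategoryTheory.Limits.IsZero ((DG.toDer A).obj M)) :
    (∀ X : DG.DGModule A.op, ¬ CategoryTheory.Limits.IsZero ((DG.toDer A.op).obj X) →
      Module.Finite k X.totalH →
        (DG.derivedTensor M X).infH = M.infH + X.infH ∧
        M.infH + X.supH ≤ (DG.derivedTensor M X).supH ∧
        X.amp ≤ (DG.derivedTensor M X).amp) ∧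
    A.toCpx.amp ≤ M.amp := by
  obtain ⟨S, i₀, i₁, h₀, h₁, e, he⟩ := DG.exists_semiBasis_of_isCompactObj hA hM hM0
  obtain ⟨pA, qA, ⟨hpA, hpA'⟩, hqA, hqA'⟩ :=
    DG.Cpx.exists_inf_sup hA.finite ⟨0, hA.not_exactAt_zero⟩
  obtain rfl : pA = 0 := by
    apply le_antisymm
    · by_contra hlt
      exact hA.not_exactAt_zero (hpA' 0 (by omega))
    · by_contra hlt
      exact hpA (hA.exactAt_of_neg (by omega))
  obtain ⟨⟨hM₀, hM₀'⟩, hM₁⟩ := S.isTriangular.infH_supH h₀ h₁ hpA hpA' hqA hqA'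
  simp only [he.exactAt_iff, add_zero] at hM₀ hM₀' hM₁
  have hle : S.deg i₀ ≤ S.deg i₁ := h₀ i₁
  have hMinf := DG.Cpx.infH_eq hM₀ hM₀'
  refine ⟨fun X hX hfin => ?_, ?_⟩
  · obtain ⟨p, q, ⟨hp, hp'⟩, hq, hq'⟩ := DG.Cpx.exists_inf_sup hfin (by
      by_contra h
      push Not at h
      exact hX (DG.isZero_toDer_of_exactAt h))
    obtain ⟨⟨hT₀, hT₀'⟩, hT₁⟩ := (S.isTriangular_tensor X).infH_supH h₀ h₁ hp hp' hq hq'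
    simp only [← DG.exactAt_derivedTensor_iff h₀ he X] at hT₀ hT₀' hT₁
    rw [hMinf, DG.Cpx.infH_eq hp hp', DG.Cpx.infH_eq hT₀ hT₀', DG.Cpx.supH_eq hq hq',
      ← EReal.coe_add, ← EReal.coe_add, ← Int.cast_add, ← Int.cast_add]
    refine ⟨rfl, le_trans (DG.Cpx.coe_le_coe_iff.2 (by omega)) (DG.Cpx.le_supH hT₁), ?_⟩
    rw [DG.Cpx.amp, DG.Cpx.infH_eq hp hp', DG.Cpx.supH_eq hq hq', ← EReal.coe_sub, ← Int.cast_sub]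
    exact le_trans (DG.Cpx.coe_le_coe_iff.2 (by omega)) (DG.Cpx.le_amp hT₀ hT₀' hT₁)
  · rw [DG.Cpx.amp, DG.Cpx.infH_eq hpA hpA', DG.Cpx.supH_eq hqA hqA', ← EReal.coe_sub,
      ← Int.cast_sub]
    exact le_trans (DG.Cpx.coe_le_coe_iff.2 (by omega)) (DG.Cpx.le_amp hM₀ hM₀' hM₁)
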